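/- **Setting.** All graphs are finite and directed; $G(-,v)$ denotes the set of parents of $v$ in $G$. Let $B=(V_B,E_B)$ be a finite directed acyclic graph. A *perceptron module* $\mathbb B$ over $B$ consists of a set $I_B\subseteq V_B$ of vertices without parents, a set $T_B\subseteq V_B$, finite-dimensional Euclidean spaces $\mathcal Y_v$ ($v\in V_B$), $\mathcal W_e,\mathcal Z_e$ ($e\in E_B$), maps $M_{(u,v)}:\mathcal W_{(u,v)}\times\mathcal Y_u\to\mathcal Z_{(u,v)}$ for $(u,v)\in E_B$, and maps $\sigma_v:\prod_{u\in B(-,v)}\mathcal Z_{(u,v)}\to\mathcal Y_v$ for $v\in V_B\setminus I_B$. Its forward function maps weights $w\in\prod_e\mathcal W_e$ and inputs $\Phi\in\prod_{v\in I_B}\mathcal Y_v$ to the family $(f_v)_{v\in V_B}$ with $f_v=\Phi_v$ for $v\in I_B$ and $f_v=F_v\big((w_{(u,v)})_u,(f_u)_u\big):=\sigma_v\big((M_{(u,v)}(w_{(u,v)},f_u))_{u\in B(-,v)}\big)$ otherwise. Assume that all $M_e$ and $\sigma_v$ are $C^1$. Let $n^0:I_B\to\mathbb N$ and $\mathcal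 C=\coprod_{b\in I_B}\{1,\dots,n^0_b\}$. A *lifted module* is a triple $\mathbb G=(G,\pi,c)$ of a finite graph $G=(V_G,E_G)$, a graph homomorphism $\pi:G\to B$, and an injection $c:\pi^{-1}(I_B)\to\mathcal C$ such that $c(v)$ lies in the block of index $\pi(v)$. It defines the perceptron module over $G$ with initial set $\pi^{-1}(I_B)$, terminal set $T(\mathbb G)=\pi^{-1}(T_B)$, spaces $\mathcal Y_{\pi(v)},\mathcal W_{\pi(e)},\mathcal Z_{\pi(e)}$, maps $M_{\pi(e)}$, and $\bar\sigma_v(z)=\sigma_{\pi(v)}\big((\sum_{u\in G(-,v),\,\pi(u)=a}z_{(u,v)})_{a\in B(-,\pi(v))}\big)$. For $x\in\prod_{(b,i)\in\mathcal C}\mathcal Y_b$ let $F_{\mathbb G}(w,x)$ be the forward function of this module with inputs $(x_{c(v)})_v$. For $k\in\mathbb N$, a linear readout is $a=(a_{i,v})\in\prod_{v\in T(\mathbb G)}\mathcal Y_{\pi(v)}^k$, acting by $$(a\cdot y)_i=\sum_{b\in T_B}\frac1{\sqrt{\#\pi^{-1}(b)}}\sum_{v\in\pi^{-1}(b)}\langle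 a_{i,v},y_v\rangle .$$ Let $\mathcal X\subseteq\prod_{(b,i)\in\mathcal C}\mathcal Y_b$ be compact, $\mathcal D$ a probability distribution on $\mathcal X$, $f^\star:\mathcal X\to\mathbb R^k$ with $\|f^\star\|_{\mathcal D}^2=\mathbb E_{x\sim\mathcal D}\|f^\star(x)\|^2<\infty$, and $\mathcal L[\mathbb G](w,a)=\mathbb E_{x\sim\mathcal D}\|a\cdot F_{\mathbb G}(w,x)-f^\star(x)\|^2$. Let $\lambda:E_B\to(0,\infty)$ satisfy $\lambda_{(a,b)}\le\min\{n^0_a/2,\sqrt{n^0_a/3}\}$ whenever $a\in I_B$, and let $\mathcal N_e$ be a full-support probability distribution on $\mathcal W_e$ for each $e\in E_B$. For $n:V_B\to\mathbb N$ with $n_b=n^0_b$ for $b\in I_B$, the *random sparse lift along $(n,\lambda)$ with distribution $\mathcal N$* has vertices $(b,i)$, $b\in V_B$, $1\le i\le n_b$, with $\pi(b,i)=b$ and $c$ the identity; it contains each pair $((a,i),(b,j))$ with $(a,b)\in E_B$ as an edge with probability $\min(1,\lambda_{(a,b)}/n_a)$, and each pair carries a weight with law $\mathcal N_{(a,b)}$,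 all these variables being independent; $w$ denotes the weights of the edges that are present. Let $\mathcal S_0$ be the set of $n:V_B\to\mathbb N$ with $n_b=n^0_b$ for $b\in I_B$ and $n_b\ge n_a\log n_a$ for all $(a,b)\in E_B$. A pair $(\mathcal L,\theta_0)$ *satisfies the convergence criterion with limit error $\varepsilon$ and constant $\kappa\in(0,\infty]$* if every $\theta:[0,\infty)\to\Theta$ with $\theta(0)=\theta_0$ and $\partial_t\theta=-\nabla\mathcal L(\theta)$ satisfies $\mathcal L(\theta_t)\le\varepsilon+\big(\kappa t+1/\mathcal L(\theta_0)^3\big)^{-1/3}$ for all $t>0$ (with $1/0=\infty$ and $\infty^{-1/3}=0$). Gradients are taken for the product Euclidean norm on the parameters $(w,a)$. **Theorem.** Let $\varepsilon>0$ and $\delta\in(0,1]$. (1) Suppose there are a lifted module $\mathbb G^\star$ and parameters $(w^\star,a^\star)$ with $\mathcal L[\mathbb G^\star](w^\star,a^\star)<\varepsilon$. Then there are $\kappa\in(0,\infty)$ and $N_1:V_B\to\mathbb N$, with $N_1(b)=n^0_b$ for $b\in I_B$, such that for every $n\in\mathcal S_0$ with $n_b\ge N_1(b)$ for all $b$: with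 probability at least $1-\delta$ over the random sparse lift $(\mathbb G,w)$ along $(n,\lambda)$ with distribution $\mathcal N$, the pair $(\mathcal L[\mathbb G],(w,0))$ satisfies the convergence criterion with limit error $\varepsilon$ and constant $\kappa$. (2) More precisely, let $\mathbb G^\star=((V^\star,E^\star),\pi_\star,c_\star)$ and $(w^\star,a^\star)$ be such that $\varepsilon_0:=\mathcal L[\mathbb G^\star](w^\star,a^\star)<\varepsilon$, and define the following quantities (in $[0,\infty]$, with $r/0=\infty$ for $r>0$, $r/\infty=0$ for $r<\infty$, and $\inf\varnothing=\infty$). For $x\in\mathcal X$ and $\eta>0$ let $[L(\eta,x)]_v=0$ if $v\in\pi_\star^{-1}(I_B)$ and otherwise, inductively, $$[L(\eta,x)]_v=\sup\big\{\|F_v(w,g)-F_v(w^\star,g^\star)\|:\ \|w_u-w^\star_{(u,v)}\|\le\eta,\ \|g_u-g^\star_u\|\le[L(\eta,x)]_u\ \ \forall u\in G^\star(-,v)\big\},$$ where $g^\star=F_{\mathbb G^\star}(w^\star,x)$ and $F_v$ is the map defined above for the module over $G^\star$; let $L(\eta)=\sup_{x\in\mathcal X}\max_{v\in V^\star}[L(\eta,x)]_v$.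 Put $$C^\star=\sum_{i\le k}\sum_{v\in T(\mathbb G^\star)}\frac{\|a^\star_{i,v}\|}{\sqrt{\#\pi_\star^{-1}(\pi_\star(v))}},\qquad \eta=\sup\Big\{\eta>0:\ L(\eta)<\frac1{C^\star}\Big(\sqrt{\tfrac{\varepsilon+\varepsilon_0}2}-\sqrt{\varepsilon_0}\Big)\Big\},$$ $$\Lambda=\sum_{e\in E_B}\big(7\lambda_e+1+\log2+\log(\#V^\star+\#E_B)-\log\delta\big).$$ Let $\alpha:V^\star\to[0,\infty]$ be defined inductively by $\alpha(v)=1/n^0_{\pi_\star(v)}$ if $\pi_\star(v)\in I_B$ and otherwise $$\alpha(v)=\frac{1}{2^{1+\#B(-,\pi_\star(v))}\,\#\pi_\star^{-1}(\pi_\star(v))}\prod_{a\in B(-,\pi_\star(v))}\frac{e^{-\lambda_{(a,\pi_\star(v))}}\lambda_{(a,\pi_\star(v))}^{k_a(v)}}{k_a(v)!}\prod_{u\in G^\star(-,v)}\mathcal N_{\pi_\star(u,v)}\big(\{s:\|s-w^\star_{(u,v)}\|\le\tfrac\eta2\}\big)\,\alpha(u),$$ with $k_a(v)=\#(G^\star(-,v)\cap\pi_\star^{-1}(a))$.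 Put $$c=\Big(\sum_{i\le k}\sum_{v\in T(\mathbb G^\star)}\frac{2\|a^\star_{i,v}\|^2}{\alpha(v)\,\#\pi_\star^{-1}(\pi_\star(v))}\Big)^{1/2},\qquad \kappa=\frac{3}{c^{2}\,\|f^\star\|_{\mathcal D}^{4}},$$ $$N=8\Big(1+\frac{4c}{\eta}\,\frac{\|f^\star\|_{\mathcal D}^2}{\varepsilon-\varepsilon_0}\Big)^2\frac{(1+\Lambda)^{1+\#V_B}}{\inf_{v\in V^\star}\alpha(v)} .$$ Then $\eta>0$, $\alpha(v)>0$ for all $v$, $\kappa>0$ and $N<\infty$, and for every $n\in\mathcal S_0$ with $n_b\ge N$ for all $b\in V_B\setminus I_B$, with probability at least $1-\delta$ over the random sparse lift $(\mathbb G,w)$ along $(n,\lambda)$ with distribution $\mathcal N$, the pair $(\mathcal L[\mathbb G],(w,0))$ satisfies the convergence criterion with limit error $\varepsilon$ and constant $\kappa$. -/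

import Mathlib

universe u v w

namespace SparseLift

noncomputable section

open MeasureTheory
open scoped ENNReal NNReal Classical

/-! ### Graphs -/

/-- The edge set of a directed graph. -/
abbrev Edge {V : Type u} (G : Digraph V) : Type u := {e : V × V // G.Adj e.1 e.2}

/-- The set `G(-,v)` of parents of `v`. -/
abbrev Parent {V : Type u} (G : Digraph V) (v : V) : Type u := {a : V // G.Adj a v}

/-- The edge `(a, v)` attached to a parent `a` of `v`. -/
abbrev Parent.edge {V : Type u} {G : Digraph V} {v : V} (a : Parent G v) : Edge G :=
  ⟨(a.1, v), a.2⟩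

/-- A directed graph is acyclic if it has no directed cycle. -/
def IsAcyclic {V : Type u} (G : Digraph V) : Prop := ∀ v, ¬ Relation.TransGen G.Adj v v

theorem IsAcyclic.wf {V : Type u} [Finite V] {G : Digraph V} (h : IsAcyclic G) :
    WellFounded G.Adj := by
  have : Std.Irrefl (Relation.TransGen G.Adj) := ⟨h⟩
  have : IsTrans V (Relation.TransGen G.Adj) := ⟨fun _ _ _ => Relation.TransGen.trans⟩
  exact Subrelation.wf (fun h => Relation.TransGen.single h)
    (Finite.wellFounded_of_trans_of_irrefl (Relation.TransGen G.Adj))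

/-- `π` is a homomorphism of directed graphs. -/
def IsHom {V : Type u} {V' : Type w} (G : Digraph V') (B : Digraph V) (π : V' → V) : Prop :=
  ∀ ⦃a b : V'⦄, G.Adj a b → B.Adj (π a) (π b)

section Hom

variable {V : Type u} {V' : Type w} {G : Digraph V'} {B : Digraph V} {π : V' → V}

/-- The map on edges induced by a graph homomorphism. -/
abbrev IsHom.edge (h : IsHom G B π) (e : Edge G) : Edge B := ⟨(π e.1.1, π e.1.2), h e.2⟩

/-- The map on parents induced by a graph homomorphism. -/
abbrev IsHom.parent (h : IsHom G B π) {b : V'} (a : Parent G b) : Parent B (π b) :=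
  ⟨π a.1, h a.2⟩

theorem IsHom.isAcyclic (h : IsHom G B π) (hB : IsAcyclic B) : IsAcyclic G := fun a ha =>
  hB (π a) (Relation.TransGen.lift π (fun _ _ hab => h hab) a a ha)

end Hom

/-! ### Euclidean bundles and perceptron modules -/

/-- A Euclidean bundle over `ι`: one finite-dimensional real inner product space per index. -/
structure EuclideanBundle (ι : Type u) where
  fiber : ι → Type v
  [normedAddCommGroup : ∀ i, NormedAddCommGroup (fiber i)]
  [innerProductSpace : ∀ i, InnerProductSpace ℝ (fiber i)]
  [finiteDimensional : ∀ i, FiniteDimensional ℝ (fiber i)]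

attribute [instance] EuclideanBundle.normedAddCommGroup EuclideanBundle.innerProductSpace
  EuclideanBundle.finiteDimensional

instance {ι : Type u} : CoeFun (EuclideanBundle.{u, v} ι) (fun _ => ι → Type v) :=
  ⟨EuclideanBundle.fiber⟩

instance {ι : Type u} (Y : EuclideanBundle.{u, v} ι) (i : ι) : CompleteSpace (Y i) :=
  FiniteDimensional.complete ℝ (Y i)

instance {ι : Type u} (Y : EuclideanBundle.{u, v} ι) (i : ι) : MeasurableSpace (Y i) :=
  borel (Y i)

instance {ι : Type u} (Y : EuclideanBundle.{u, v} ι) (i : ι) : BorelSpace (Y i) := ⟨rfl⟩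

/-- Pullback of a Euclidean bundle. -/
abbrev EuclideanBundle.pullback {ι : Type u} {κ : Type w} (π : κ → ι)
    (Y : EuclideanBundle.{u, v} ι) : EuclideanBundle.{w, v} κ where
  fiber := fun i => Y (π i)

/-- A perceptron module over the finite directed acyclic graph `B`. -/
structure PerceptronModule {V : Type u} (B : Digraph V) where
  acyclic : IsAcyclic B
  /-- initial vertices -/
  I : Set V
  /-- terminal vertices -/
  T : Set V
  no_parent : ∀ v ∈ I, ∀ a, ¬ B.Adj a v
  /-- activations -/
  Y : EuclideanBundle.{u, v} V
  /-- pre-activations -/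
  Z : EuclideanBundle.{u, v} (Edge B)
  /-- weights -/
  W : EuclideanBundle.{u, v} (Edge B)
  M : ∀ e : Edge B, W e × Y e.1.1 → Z e
  σ : ∀ v : {v // v ∉ I}, (∀ a : Parent B v.1, Z a.edge) → Y v.1

namespace PerceptronModule

variable {V : Type u} {B : Digraph V}

/-- All the maps `M_e` and `σ_v` are continuously differentiable. -/
def IsC1 [Fintype V] (𝔹 : PerceptronModule.{u, v} B) : Prop :=
  (∀ e, ContDiff ℝ 1 (𝔹.M e)) ∧ ∀ v, ContDiff ℝ 1 (𝔹.σ v)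

/-- The lift `π^* 𝔹` along a graph homomorphism `π : G → B`: copies of all spaces and of all maps
`M`, and before applying `σ` the pre-activations of all parents of the same type are summed. -/
abbrev lift (𝔹 : PerceptronModule.{u, v} B) {V' : Type w} [Fintype V'] {G : Digraph V'}
    {π : V' → V} (h : IsHom G B π) : PerceptronModule.{w, v} G where
  acyclic := h.isAcyclic 𝔹.acyclic
  I := π ⁻¹' 𝔹.I
  T := π ⁻¹' 𝔹.T
  no_parent := fun b hb _ hab => 𝔹.no_parent (π b) hb _ (h hab)
  Y := 𝔹.Y.pullback π
  Z := 𝔹.Z.pullback h.edge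
  W := 𝔹.W.pullback h.edge
  M := fun e => 𝔹.M (h.edge e)
  σ := fun b z => 𝔹.σ ⟨π b.1, b.2⟩ fun a =>
    ∑ p : Parent G b.1, if hp : h.parent p = a then hp ▸ z p else 0

variable [Fintype V] (𝔹 : PerceptronModule.{u, v} B)

/-- The map `F_v = σ_v ∘ (M_{(a,v)})_a` computing the activation at `v` from the weights of the
incoming edges and the activations of the parents. -/
def vertexMap (b : V) (hb : b ∉ 𝔹.I) (w : ∀ a : Parent B b, 𝔹.W a.edge)
    (g : ∀ a : Parent B b, 𝔹.Y a.1) : 𝔹.Y b :=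
  𝔹.σ ⟨b, hb⟩ fun a => 𝔹.M a.edge (w a, g a)

/-- The activation map (forward function). -/
def forward (w : ∀ e, 𝔹.W e) (Φ : ∀ b : 𝔹.I, 𝔹.Y b.1) : ∀ b, 𝔹.Y b :=
  𝔹.acyclic.wf.fix fun b f =>
    if hb : b ∈ 𝔹.I then Φ ⟨b, hb⟩
    else 𝔹.vertexMap b hb (fun a => w a.edge) (fun a => f a.1 a.2)

theorem forward_eq (w : ∀ e, 𝔹.W e) (Φ : ∀ b : 𝔹.I, 𝔹.Y b.1) (b : V) :
    𝔹.forward w Φ b = if hb : b ∈ 𝔹.I then Φ ⟨b, hb⟩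
      else 𝔹.vertexMap b hb (fun a => w a.edge) (fun a => 𝔹.forward w Φ a.1) :=
  𝔹.acyclic.wf.fix_eq _ b

/-- The deviation bound `[L(η, Φ)]_b` around the reference weights `w₀`, for the input `Φ`: it is `0`
at initial vertices, and otherwise the largest deviation of `F_b` when the incoming weights move by
at most `η` and the activation of each parent `a` moves by at most `[L(η, Φ)]_a`. -/
def deviation (w₀ : ∀ e, 𝔹.W e) (Φ : ∀ b : 𝔹.I, 𝔹.Y b.1) (η : ℝ≥0) : V → ℝ≥0∞ :=
  𝔹.acyclic.wf.fix fun b L =>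
    if hb : b ∈ 𝔹.I then 0
    else ⨆ (w : ∀ a : Parent B b, 𝔹.W a.edge) (g : ∀ a : Parent B b, 𝔹.Y a.1)
      (_ : ∀ a, ‖w a - w₀ a.edge‖ₑ ≤ η)
      (_ : ∀ a : Parent B b, ‖g a - 𝔹.forward w₀ Φ a.1‖ₑ ≤ L a.1 a.2),
      ‖𝔹.vertexMap b hb w g -
        𝔹.vertexMap b hb (fun a => w₀ a.edge) (fun a => 𝔹.forward w₀ Φ a.1)‖ₑ

theorem deviation_eq (w₀ : ∀ e, 𝔹.W e) (Φ : ∀ b : 𝔹.I, 𝔹.Y b.1) (η : ℝ≥0) (b : V) :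
    𝔹.deviation w₀ Φ η b = if hb : b ∈ 𝔹.I then 0
      else ⨆ (w : ∀ a : Parent B b, 𝔹.W a.edge) (g : ∀ a : Parent B b, 𝔹.Y a.1)
        (_ : ∀ a, ‖w a - w₀ a.edge‖ₑ ≤ η)
        (_ : ∀ a : Parent B b, ‖g a - 𝔹.forward w₀ Φ a.1‖ₑ ≤ 𝔹.deviation w₀ Φ η a.1),
        ‖𝔹.vertexMap b hb w g -
          𝔹.vertexMap b hb (fun a => w₀ a.edge) (fun a => 𝔹.forward w₀ Φ a.1)‖ₑ :=
  𝔹.acyclic.wf.fix_eq _ b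

end PerceptronModule

/-! ### Lifted perceptron modules -/

section Lifted

variable {VB : Type u} {B : Digraph VB}

/-- The set `𝒞 = ∐_{b ∈ I} [n⁰_b]` of names of lifted inputs. -/
abbrev InputName (𝔹 : PerceptronModule.{u, v} B) (n₀ : 𝔹.I → ℕ) : Type u :=
  Σ b : 𝔹.I, Fin (n₀ b)

/-- The input space `∏_{u ∈ 𝒞} 𝒴_{p(u)}`. -/
abbrev InputSpace (𝔹 : PerceptronModule.{u, v} B) (n₀ : 𝔹.I → ℕ) : Type (max u v) :=
  ∀ i : InputName 𝔹 n₀, 𝔹.Y i.1.1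

/-- A lifted perceptron module `(G, π, c)`: a finite graph `G`, a homomorphism `π : G → B`, and
an injection `c : π⁻¹(I) → 𝒞` over `I`. -/
structure LiftedModule (𝔹 : PerceptronModule.{u, v} B) (n₀ : 𝔹.I → ℕ) where
  V : Type w
  [fintype : Fintype V]
  G : Digraph V
  π : V → VB
  hom : IsHom G B π
  /-- the component of `c a` in the block `[n⁰_{π a}]` -/
  c : ∀ a : {a // π a ∈ 𝔹.I}, Fin (n₀ ⟨π a.1, a.2⟩)
  c_injective : Function.Injective
    (fun a => ⟨⟨π a.1, a.2⟩, c a⟩ : {a // π a ∈ 𝔹.I} → InputName 𝔹 n₀)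

attribute [instance] LiftedModule.fintype

namespace LiftedModule

variable {𝔹 : PerceptronModule.{u, v} B} {n₀ : 𝔹.I → ℕ}

section

variable (𝔾 : LiftedModule.{u, v, w} 𝔹 n₀)

/-- The perceptron module `π^* 𝔹` over `G`. -/
abbrev toModule : PerceptronModule.{w, v} 𝔾.G := 𝔹.lift 𝔾.hom

/-- Weights of the lifted module, as a Euclidean space. -/
abbrev Param : Type (max v w) := PiLp 2 fun e : Edge 𝔾.G => 𝔹.W (𝔾.hom.edge e)

/-- Terminal vertices of the lifted module. -/
abbrev Terminal : Type w := {a : 𝔾.V // 𝔾.π a ∈ 𝔹.T}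

/-- The linear readouts `∏_{v ∈ T} 𝒴_{π v}^k`, as a Euclidean space. -/
abbrev Readout (k : ℕ) : Type (max v w) :=
  PiLp 2 fun p : Fin k × 𝔾.Terminal => 𝔹.Y (𝔾.π p.2.1)

/-- All trainable parameters `(w, a)`, as a Euclidean space. -/
abbrev Theta (k : ℕ) : Type (max v w) := WithLp 2 (𝔾.Param × 𝔾.Readout k)

/-- The number of vertices of type `b`. -/
def fiberCard (b : VB) : ℕ := Nat.card {a : 𝔾.V // 𝔾.π a = b}

/-- The pullback `c^* x` of an input. -/
def pullInput (x : InputSpace 𝔹 n₀) : ∀ a : 𝔾.toModule.I, 𝔾.toModule.Y a.1 :=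
  fun a => x ⟨⟨𝔾.π a.1, a.2⟩, 𝔾.c a⟩

/-- The forward function of the lifted module. -/
def forward (w : ∀ e : Edge 𝔾.G, 𝔹.W (𝔾.hom.edge e)) (x : InputSpace 𝔹 n₀) :
    ∀ a : 𝔾.V, 𝔹.Y (𝔾.π a) :=
  𝔾.toModule.forward w (𝔾.pullInput x)

/-- The linear readout action `a · y`. -/
def readout {k : ℕ} [Fintype VB] (a : 𝔾.Readout k) (y : ∀ p : 𝔾.V, 𝔹.Y (𝔾.π p)) :
    EuclideanSpace ℝ (Fin k) :=
  WithLp.toLp 2 fun i => ∑ b : 𝔹.T, √(1 / (𝔾.fiberCard b.1 : ℝ)) *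
    ∑ p : {p : 𝔾.Terminal // 𝔾.π p.1 = b.1}, inner ℝ (a (i, p.1)) (y p.1.1)

/-- The quadratic loss `(w, a) ↦ E_{x ∼ D} ‖a · F(w, x) - f⋆(x)‖²`. -/
def loss {k : ℕ} [Fintype VB] {X : Set (InputSpace 𝔹 n₀)} (D : Measure X)
    (f : X → EuclideanSpace ℝ (Fin k)) (θ : 𝔾.Theta k) : ℝ :=
  ∫ x, ‖𝔾.readout θ.snd (𝔾.forward θ.fst x.1) - f x‖ ^ 2 ∂D

end

end LiftedModule

end Lifted

/-! ### Gradient flows, the convergence criterion, and probability -/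

/-- `θ` is a gradient flow of `L` on `[0, ∞)` started at `θ₀`. -/
def IsGradientFlow {E : Type*} [NormedAddCommGroup E] [InnerProductSpace ℝ E] [CompleteSpace E]
    (L : E → ℝ) (θ₀ : E) (θ : ℝ → E) : Prop :=
  θ 0 = θ₀ ∧ ∀ t, 0 ≤ t → HasDerivWithinAt θ (-gradient L (θ t)) (Set.Ici 0) t

/-- Convergence criterion with limit error `ε` and constant `κ`: every gradient flow satisfies
`L(θ_t) ≤ ε + 1 / (κ t + 1 / L(θ₀)³)^{1/3}` for all `t > 0`. The bound is computed in `[0, ∞]`, so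
`κ = ∞` or `L(θ₀) = 0` means `L(θ_t) ≤ ε`. -/
def ConvergenceCriterion {E : Type*} [NormedAddCommGroup E] [InnerProductSpace ℝ E]
    [CompleteSpace E] (L : E → ℝ) (θ₀ : E) (ε : ℝ) (κ : ℝ≥0∞) : Prop :=
  ∀ θ : ℝ → E, IsGradientFlow L θ₀ θ → ∀ t : ℝ, 0 < t →
    ENNReal.ofReal (L (θ t)) ≤ ENNReal.ofReal ε +
      1 / (κ * ENNReal.ofReal t + 1 / ENNReal.ofReal (L θ₀) ^ 3) ^ (1 / 3 : ℝ)

/-- `P` holds with probability at least `p`, i.e. on a measurable event of probability at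
least `p`. -/
def HoldsWithProbability {Ω : Type*} [MeasurableSpace Ω] (μ : Measure Ω) (p : ℝ)
    (P : Ω → Prop) : Prop :=
  ∃ A : Set Ω, MeasurableSet A ∧ ENNReal.ofReal p ≤ μ A ∧ ∀ ω ∈ A, P ω

/-! ### Random sparse lifts -/

section RandomLift

variable {VB : Type u} (B : Digraph VB)

/-- The fully-connected lift of `B` along the widths `n`. -/
def fullLift (n : VB → ℕ) : Digraph (Σ b : VB, Fin (n b)) where
  Adj := fun a b => B.Adj a.1 b.1

variable {B}

theorem fullLift_isHom (n : VB → ℕ) : IsHom (fullLift B n) B Sigma.fst := fun _ _ h => h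

/-- The subgraph of the fully-connected lift made of the edges kept by the mask `m`. -/
def sparseGraph (n : VB → ℕ) (m : Edge (fullLift B n) → Bool) :
    Digraph (Σ b : VB, Fin (n b)) where
  Adj := fun a b => ∃ h : (fullLift B n).Adj a b, m ⟨(a, b), h⟩ = true

theorem sparseGraph_isHom (n : VB → ℕ) (m : Edge (fullLift B n) → Bool) :
    IsHom (sparseGraph n m) B Sigma.fst := fun _ _ h => h.1

variable [Fintype VB] {𝔹 : PerceptronModule.{u, v} B} {n₀ : 𝔹.I → ℕ}

/-- The sparse lift along `n` with mask `m`; its inputs are in bijection with `𝒞`. -/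
def sparseLift (n : VB → ℕ) (hn : ∀ b : 𝔹.I, n b.1 = n₀ b)
    (m : Edge (fullLift B n) → Bool) : LiftedModule.{u, v, u} 𝔹 n₀ where
  V := Σ b : VB, Fin (n b)
  G := sparseGraph n m
  π := Sigma.fst
  hom := sparseGraph_isHom n m
  c := fun a => Fin.cast (hn ⟨a.1.1, a.2⟩) a.1.2
  c_injective := by
    rintro ⟨⟨a, i⟩, ha⟩ ⟨⟨b, j⟩, hb⟩ h
    obtain ⟨h₁, h₂⟩ := Sigma.mk.inj h
    obtain rfl : a = b := congrArg Subtype.val h₁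
    have h₃ := eq_of_heq h₂
    simp only [Fin.cast_inj] at h₃
    subst h₃
    rfl

/-- The initial parameters: the weights `w` restricted to the kept edges, and a zero readout. -/
def sparseInit (k : ℕ) (n : VB → ℕ) (hn : ∀ b : 𝔹.I, n b.1 = n₀ b)
    (m : Edge (fullLift B n) → Bool)
    (w : ∀ e : Edge (fullLift B n), 𝔹.W ((fullLift_isHom n).edge e)) :
    (sparseLift (n₀ := n₀) n hn m).Theta k :=
  WithLp.toLp 2 (WithLp.toLp 2 fun e => w ⟨e.1, e.2.1⟩, 0)

/-- The law of `(m, w)`: all the variables are independent, with `m_{(a,b)}` Bernoulli with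
parameter `λ_{π(a,b)} / n_{π a}` (truncated to `[0, 1]`), and `w_e` distributed according
to `N_{π e}`. -/
def sparseLiftLaw (𝔹 : PerceptronModule.{u, v} B) (n : VB → ℕ) (lam : Edge B → ℝ)
    (N : ∀ e : Edge B, Measure (𝔹.W e)) :
    Measure ((Edge (fullLift B n) → Bool) ×
      (∀ e : Edge (fullLift B n), 𝔹.W ((fullLift_isHom n).edge e))) :=
  (Measure.pi fun e : Edge (fullLift B n) =>
    ProbabilityTheory.bernoulliMeasure true false
      (Set.projIcc (0 : ℝ) 1 zero_le_one
        (lam ((fullLift_isHom n).edge e) / (n e.1.1.1 : ℝ)))).prod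
  (Measure.pi fun e : Edge (fullLift B n) => N ((fullLift_isHom n).edge e))

/-- Admissible widths: `n_b = n⁰_b` on inputs and `n_b ≥ n_a log n_a` along edges `(a, b)`. -/
def Admissible (𝔹 : PerceptronModule.{u, v} B) (n₀ : 𝔹.I → ℕ) (n : VB → ℕ) : Prop :=
  (∀ b : 𝔹.I, n b.1 = n₀ b) ∧
    ∀ a b : VB, B.Adj a b → (n a : ℝ) * Real.log (n a) ≤ (n b : ℝ)

/-- With probability at least `1 - δ`, the random sparse lift along `n`, started with a zero
readout, satisfies the convergence criterion with limit error `ε` and constant `κ`. -/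
def RandomLiftConverges {k : ℕ} {X : Set (InputSpace 𝔹 n₀)} (D : Measure X)
    (f : X → EuclideanSpace ℝ (Fin k)) (lam : Edge B → ℝ) (N : ∀ e : Edge B, Measure (𝔹.W e))
    (n : VB → ℕ) (hn : Admissible 𝔹 n₀ n) (ε δ : ℝ) (κ : ℝ≥0∞) : Prop :=
  HoldsWithProbability (sparseLiftLaw 𝔹 n lam N) (1 - δ) fun mw =>
    ConvergenceCriterion ((sparseLift n hn.1 mw.1).loss D f) (sparseInit k n hn.1 mw.1 mw.2) ε κ

end RandomLift

/-! ### Explicit constants attached to a witness -/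

namespace LiftedModule

variable {VB : Type u} [Fintype VB] {B : Digraph VB} {𝔹 : PerceptronModule.{u, v} B}
  {n₀ : 𝔹.I → ℕ} (𝔾 : LiftedModule.{u, v, w} 𝔹 n₀)

/-- The continuity constant `L[𝔾, w](η, X)`. -/
def continuityConstant (w : ∀ e : Edge 𝔾.G, 𝔹.W (𝔾.hom.edge e)) (X : Set (InputSpace 𝔹 n₀))
    (η : ℝ≥0) : ℝ≥0∞ :=
  ⨆ x ∈ X, ⨆ b : 𝔾.V, 𝔾.toModule.deviation w (𝔾.pullInput x) η b

/-- The coverage parameter `α_η`. -/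
def alpha (lam : Edge B → ℝ) (N : ∀ e : Edge B, Measure (𝔹.W e))
    (w : ∀ e : Edge 𝔾.G, 𝔹.W (𝔾.hom.edge e)) (η : ℝ≥0∞) : 𝔾.V → ℝ≥0∞ :=
  (𝔾.hom.isAcyclic 𝔹.acyclic).wf.fix fun b α =>
    if hb : 𝔾.π b ∈ 𝔹.I then (n₀ ⟨𝔾.π b, hb⟩ : ℝ≥0∞)⁻¹
    else
      1 / ((2 ^ (1 + Nat.card (Parent B (𝔾.π b))) * 𝔾.fiberCard (𝔾.π b) : ℕ) : ℝ≥0∞) *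
      (∏ a : Parent B (𝔾.π b),
        let k := Nat.card {p : Parent 𝔾.G b // 𝔾.π p.1 = a.1}
        ENNReal.ofReal (Real.exp (-lam a.edge) * lam a.edge ^ k / (Nat.factorial k : ℝ))) *
      ∏ p : Parent 𝔾.G b,
        N (𝔾.hom.edge p.edge) (Metric.closedEBall (w p.edge) η) * α p.1 p.2

theorem alpha_eq (lam : Edge B → ℝ) (N : ∀ e : Edge B, Measure (𝔹.W e))
    (w : ∀ e : Edge 𝔾.G, 𝔹.W (𝔾.hom.edge e)) (η : ℝ≥0∞) (b : 𝔾.V) :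
    𝔾.alpha lam N w η b = if hb : 𝔾.π b ∈ 𝔹.I then (n₀ ⟨𝔾.π b, hb⟩ : ℝ≥0∞)⁻¹
    else
      1 / ((2 ^ (1 + Nat.card (Parent B (𝔾.π b))) * 𝔾.fiberCard (𝔾.π b) : ℕ) : ℝ≥0∞) *
      (∏ a : Parent B (𝔾.π b),
        let k := Nat.card {p : Parent 𝔾.G b // 𝔾.π p.1 = a.1}
        ENNReal.ofReal (Real.exp (-lam a.edge) * lam a.edge ^ k / (Nat.factorial k : ℝ))) *
      ∏ p : Parent 𝔾.G b,
        N (𝔾.hom.edge p.edge) (Metric.closedEBall (w p.edge) η) * 𝔾.alpha lam N w η p.1 :=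
  (𝔾.hom.isAcyclic 𝔹.acyclic).wf.fix_eq _ b

variable {k : ℕ} {X : Set (InputSpace 𝔹 n₀)} (D : Measure X)
  (f : X → EuclideanSpace ℝ (Fin k)) (lam : Edge B → ℝ) (N : ∀ e : Edge B, Measure (𝔹.W e))
  (ε δ : ℝ) (θ : 𝔾.Theta k)

/-- The constant `C⋆` of a witness `θ = (w⋆, a⋆)`. -/
def cStar : ℝ :=
  ∑ i : Fin k, ∑ p : 𝔾.Terminal, ‖θ.snd (i, p)‖ / √(𝔾.fiberCard (𝔾.π p.1) : ℝ)

/-- The supremum (in `[0, ∞]`) of all `η > 0` such that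
`L(η) < (√((ε + ε₀) / 2) - √ε₀) / C⋆`, where `ε₀` is the loss of the witness. -/
def etaStar : ℝ≥0∞ :=
  ⨆ (η : ℝ≥0) (_ : 0 < η)
    (_ : 𝔾.continuityConstant θ.fst X η <
      ENNReal.ofReal (√((ε + 𝔾.loss D f θ) / 2) - √(𝔾.loss D f θ)) /
        ENNReal.ofReal (𝔾.cStar θ)), (η : ℝ≥0∞)

/-- The parameter `α_{η/2}` of the witness, for the above `η`. -/
def alphaStar : 𝔾.V → ℝ≥0∞ := 𝔾.alpha lam N θ.fst (𝔾.etaStar D f ε θ / 2)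

/-- The constant `Λ`. -/
def lambdaStar : ℝ :=
  ∑ e : Edge B, (7 * lam e + 1 + Real.log 2 +
    Real.log ((Nat.card 𝔾.V : ℝ) + (Nat.card (Edge B) : ℝ)) - Real.log δ)

/-- The intercept `c`. -/
def intercept : ℝ≥0∞ :=
  (∑ i : Fin k, ∑ p : 𝔾.Terminal,
    2 * ENNReal.ofReal (‖θ.snd (i, p)‖ ^ 2) /
      (𝔾.alphaStar D f lam N ε θ p.1 * (𝔾.fiberCard (𝔾.π p.1) : ℝ≥0∞))) ^ (1 / 2 : ℝ)

end LiftedModule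

/-- The squared seminorm `‖f‖_D² = E_{x ∼ D} ‖f(x)‖²`. -/
def normSqD {X : Type*} [MeasurableSpace X] {k : ℕ} (D : Measure X)
    (f : X → EuclideanSpace ℝ (Fin k)) : ℝ :=
  ∫ x, ‖f x‖ ^ 2 ∂D

namespace LiftedModule

variable {VB : Type u} [Fintype VB] {B : Digraph VB} {𝔹 : PerceptronModule.{u, v} B}
  {n₀ : 𝔹.I → ℕ} (𝔾 : LiftedModule.{u, v, w} 𝔹 n₀)
  {k : ℕ} {X : Set (InputSpace 𝔹 n₀)} (D : Measure X)
  (f : X → EuclideanSpace ℝ (Fin k)) (lam : Edge B → ℝ) (N : ∀ e : Edge B, Measure (𝔹.W e))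
  (ε δ : ℝ) (θ : 𝔾.Theta k)

/-- The explicit rate `κ = 3 c⁻² / ‖f⋆‖_D⁴` (equal to `∞` when `c = 0` or `‖f⋆‖_D = 0`). -/
def rate : ℝ≥0∞ :=
  3 * (𝔾.intercept D f lam N ε θ ^ 2)⁻¹ / ENNReal.ofReal (normSqD D f) ^ 2

/-- The explicit size threshold at the non-initial vertices. -/
def sizeThreshold : ℝ≥0∞ :=
  8 * (1 + 4 * 𝔾.intercept D f lam N ε θ / 𝔾.etaStar D f ε θ *
      (ENNReal.ofReal (normSqD D f) / ENNReal.ofReal (ε - 𝔾.loss D f θ))) ^ 2 *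
    (ENNReal.ofReal (1 + 𝔾.lambdaStar lam δ) ^ (1 + Nat.card VB) /
      ⨅ b : 𝔾.V, 𝔾.alphaStar D f lam N ε θ b)

end LiftedModule

end

end SparseLift

open MeasureTheory SparseLift

/-! The output is linear in the readout, so the loss is convex in `a` for fixed weights. Let θ₀ =
(w, 0), L₀ = L(θ₀) = ‖f⋆‖² and ε' = (ε + ε₀)/2. Suppose that for every p = (w', a') in the ball of
radius c L₀/(ε - ε') around θ₀ some readout a with ‖a‖ ≤ c gives (w', a) a loss at most ε'.
Convexity on the segment from a' to a yields L(p) - ε' ≤ ‖∇L(p)‖ (‖p - θ₀‖ + c)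
(`loss_sub_le_norm_gradient_mul`). Along the flow (‖θ - θ₀‖ + c)(L(θ) - ε') then cannot increase, so
the flow stays in the ball as long as L > ε, and ‖∇L‖ ≥ (L - ε')²/(c L₀). Since L decreases at speed
‖∇L‖², (L - ε)⁻³ grows at rate at least 3/(c² L₀²): this is the convergence criterion
(`convergenceCriterion_of_gradient_domination`).

The good readout comes from copies of the reference network inside the sparse lift. A vertex over
π(v) is a copy of v if its parents are exactly one copy of each parent of v, with weights η/2-close
to the reference. In-degrees are roughly Poisson, so given the layers below this happens with
probability bounded below independently of the widths, and independently for different vertices of a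
layer. A Chernoff bound and induction over the reference graph give at least α(v) n copies of every
v (`measure_scarceEvent_le`).

Sparsity makes the copies robust. Within distance R of θ₀ at most K = (2R/η)² edges have moved by
η/2 or more, whatever the widths. With high probability out-degrees from a to b are O(n_b/n_a)
(`measure_exists_lt_outSet_le`), so the descendants of those edges are a proportion O(K/n) of each
layer (`card_deadSet_le`), and at least half of the copies of every vertex survive. The activation
of a surviving copy is within L(η) of the reference (`IsCopy.enorm_forward_sub_le`). Spreading a⋆
evenly over survivors therefore reproduces the reference output up to C⋆ L(η), with norm at most c
because of the 1/√n normalisation (`exists_averaged_readout`). `convergenceCriterion_of_copies`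
joins the two halves, and `randomLiftConverges_of_le` adds the probabilistic estimates. -/

namespace SparseLift

noncomputable section

set_option linter.unusedSectionVars false

open MeasureTheory
open scoped ENNReal NNReal Classical Topology

/-! ### Gradient flows under a gradient domination condition with drift. -/

section GradientFlow

variable {E : Type*} [NormedAddCommGroup E] [InnerProductSpace ℝ E] [CompleteSpace E]
  {L : E → ℝ} {θ₀ : E} {θ : ℝ → E}

theorem IsGradientFlow.hasDerivWithinAt_comp (h : IsGradientFlow L θ₀ θ)
    (hL : Differentiable ℝ L) {t : ℝ} (ht : 0 ≤ t) :
    HasDerivWithinAt (fun s => L (θ s)) (-‖gradient L (θ t)‖ ^ 2) (Set.Ici 0) t := by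
  have h1 := (hL (θ t)).hasGradientAt.hasFDerivAt
  have h2 := h1.comp_hasDerivWithinAt t (h.2 t ht)
  refine h2.congr_deriv ?_
  rw [map_neg, InnerProductSpace.toDual_apply_apply, real_inner_self_eq_norm_sq]

theorem IsGradientFlow.antitoneOn (h : IsGradientFlow L θ₀ θ) (hL : Differentiable ℝ L) :
    AntitoneOn (fun s => L (θ s)) (Set.Ici 0) := by
  refine antitoneOn_of_hasDerivWithinAt_nonpos (f' := fun t => -‖gradient L (θ t)‖ ^ 2)
    (convex_Ici 0) (fun t ht => (h.hasDerivWithinAt_comp hL ht).continuousWithinAt) ?_ ?_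
  · intro t ht
    exact (h.hasDerivWithinAt_comp hL (interior_subset ht)).mono interior_subset
  · intro t _
    simp only [Left.neg_nonpos_iff]
    positivity

/-- While the loss stays above `ε`, the distance travelled is controlled by the decrease of the
loss. -/
theorem IsGradientFlow.norm_sub_le (h : IsGradientFlow L θ₀ θ) (hL : Differentiable ℝ L)
    {ε ε' c t : ℝ} (hε' : 0 < ε') (hεε' : ε' < ε) (hc : 0 < c) (ht : 0 ≤ t)
    (hεt : ε < L (θ t))
    (H : ∀ p, ‖p - θ₀‖ ≤ c * L θ₀ / (ε - ε') →
      L p - ε' ≤ ‖gradient L p‖ * (‖p - θ₀‖ + c)) {s : ℝ} (hs : 0 ≤ s) (hst : s ≤ t) :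
    ‖θ s - θ₀‖ ≤ c * L θ₀ / (L (θ s) - ε') - c * L θ₀ / (L θ₀ - ε') := by
  have hanti := h.antitoneOn hL
  have hgt : ∀ r, 0 ≤ r → r ≤ t → ε < L (θ r) := fun r hr hrt =>
    hεt.trans_le (hanti hr ht hrt)
  have hL0 : ε < L θ₀ := by have := hgt 0 le_rfl ht; rwa [h.1] at this
  have hder : ∀ x ∈ Set.Ici (0 : ℝ), HasDerivWithinAt θ (-gradient L (θ x)) (Set.Ici 0) x := h.2
  -- Equality in `H` would give the sharp barrier c (L(θ₀) - ε')/(L - ε') - c. Putting c L(θ₀) in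
  -- the numerator, larger because ε' > 0, creates the strict inequality that the comparison
  -- principle needs. `H` is only used where the norm meets the barrier, which lies below c L(θ₀)/(ε
  -- - ε'), so the radius restriction in `H` is harmless.
  refine image_norm_le_of_norm_deriv_right_lt_deriv_boundary'
    (f := fun s => θ s - θ₀) (f' := fun s => -gradient L (θ s)) (a := 0) (b := t)
    (B := fun s => c * L θ₀ / (L (θ s) - ε') - c * L θ₀ / (L θ₀ - ε'))
    (B' := fun s => c * L θ₀ * ‖gradient L (θ s)‖ ^ 2 / (L (θ s) - ε') ^ 2)
    ?_ ?_ ?_ ?_ ?_ ?_ ⟨hs, hst⟩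
  · intro x hx
    exact (((hder x hx.1).sub_const θ₀).continuousWithinAt).mono fun y hy => hy.1
  · intro x hx
    exact ((hder x hx.1).sub_const θ₀).mono (Set.Ici_subset_Ici.2 hx.1)
  · simp [h.1]
  · intro x hx
    have h1 := (h.hasDerivWithinAt_comp hL hx.1).continuousWithinAt.mono
      (fun y (hy : y ∈ Set.Icc 0 t) => hy.1)
    have h2 : L (θ x) - ε' ≠ 0 := by have := hgt x hx.1 hx.2; linarith
    exact (continuousWithinAt_const.div (h1.sub continuousWithinAt_const) h2).sub
      continuousWithinAt_const
  · intro x hx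
    have h1 := ((h.hasDerivWithinAt_comp hL hx.1).mono (Set.Ici_subset_Ici.2 hx.1)).sub_const ε'
    have h2 : L (θ x) - ε' ≠ 0 := by have := hgt x hx.1 hx.2.le; linarith
    refine (((h1.inv h2).const_mul (c * L θ₀)).sub_const
      (c * L θ₀ / (L θ₀ - ε'))).congr_deriv ?_
    ring
  · intro x hx hxe
    have hux := hgt x hx.1 hx.2.le
    have hu : 0 < L (θ x) - ε' := by linarith
    have hu0 : 0 < L θ₀ - ε' := by linarith
    have hL0p : 0 < L θ₀ := by linarith
    have hcc : c < c * L θ₀ / (L θ₀ - ε') := by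
      rw [lt_div_iff₀ hu0]; nlinarith
    have hle : c * L θ₀ / (L (θ x) - ε') ≤ c * L θ₀ / (ε - ε') :=
      div_le_div_of_nonneg_left (by positivity) (by linarith) (by linarith)
    have h3 := H (θ x) (by rw [hxe]; linarith)
    rw [hxe] at h3
    rw [norm_neg]
    set q := ‖gradient L (θ x)‖
    have hq : 0 ≤ q := norm_nonneg _
    have hq0 : 0 < q := by
      rcases hq.eq_or_lt with h0 | h0
      · rw [← h0] at h3; linarith
      · exact h0
    have h4 : L (θ x) - ε' < q * (c * L θ₀ / (L (θ x) - ε')) :=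
      h3.trans_lt (mul_lt_mul_of_pos_left (by linarith) hq0)
    rw [mul_div_assoc', lt_div_iff₀ hu] at h4
    rw [lt_div_iff₀ (by positivity)]
    nlinarith

/-- The distance bound turns `H` into (L - ε')² ≤ ‖∇L‖ c L(θ₀), while (L - ε)⁻³ has derivative
3‖∇L‖²/(L - ε)⁴ along the flow. As ε' < ε, this derivative is at least 3/(c² L(θ₀)²). The initial
value (L(θ₀) - ε)⁻³ is finally weakened to L(θ₀)⁻³. -/
theorem IsGradientFlow.inv_cube_le (h : IsGradientFlow L θ₀ θ) (hL : Differentiable ℝ L)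
    {ε ε' c t : ℝ} (hε' : 0 < ε') (hεε' : ε' < ε) (hc : 0 < c) (ht : 0 ≤ t)
    (hεt : ε < L (θ t))
    (H : ∀ p, ‖p - θ₀‖ ≤ c * L θ₀ / (ε - ε') →
      L p - ε' ≤ ‖gradient L p‖ * (‖p - θ₀‖ + c)) :
    3 / (c ^ 2 * L θ₀ ^ 2) * t + 1 / L θ₀ ^ 3 ≤ 1 / (L (θ t) - ε) ^ 3 := by
  have hanti := h.antitoneOn hL
  have hgt : ∀ r, 0 ≤ r → r ≤ t → ε < L (θ r) := fun r hr hrt =>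
    hεt.trans_le (hanti hr ht hrt)
  have hL0 : ε < L θ₀ := by have := hgt 0 le_rfl ht; rwa [h.1] at this
  have hL0p : 0 < L θ₀ := by linarith
  have hmono : MonotoneOn (fun s => ((L (θ s) - ε) ^ 3)⁻¹ - 3 / (c ^ 2 * L θ₀ ^ 2) * s)
      (Set.Icc 0 t) := by
    have hd : ∀ x ∈ Set.Icc 0 t, HasDerivWithinAt
        (fun s => ((L (θ s) - ε) ^ 3)⁻¹ - 3 / (c ^ 2 * L θ₀ ^ 2) * s)
        (3 * ‖gradient L (θ x)‖ ^ 2 / (L (θ x) - ε) ^ 4 - 3 / (c ^ 2 * L θ₀ ^ 2))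
        (Set.Icc 0 t) x := by
      intro x hx
      have h1 := ((h.hasDerivWithinAt_comp hL hx.1).mono
        (fun y (hy : y ∈ Set.Icc 0 t) => hy.1)).sub_const ε
      have h2 : L (θ x) - ε ≠ 0 := by have := hgt x hx.1 hx.2; linarith
      refine (((h1.pow 3).inv (pow_ne_zero 3 h2)).sub
        ((hasDerivWithinAt_id x _).const_mul (3 / (c ^ 2 * L θ₀ ^ 2)))).congr_deriv ?_
      simp only [Pi.pow_apply, mul_one]
      congr 1
      field_simp
      norm_num
      ring
    refine monotoneOn_of_hasDerivWithinAt_nonneg (convex_Icc 0 t)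
      (fun x hx => (hd x hx).continuousWithinAt)
      (fun x hx => (hd x (interior_subset hx)).mono interior_subset) ?_
    intro x hx
    have hx' := interior_subset hx
    have hux := hgt x hx'.1 hx'.2
    have hu : 0 < L (θ x) - ε' := by linarith
    have hu2 : 0 < L (θ x) - ε := by linarith
    have hu0 : 0 < L θ₀ - ε' := by linarith
    have hcc : c < c * L θ₀ / (L θ₀ - ε') := by
      rw [lt_div_iff₀ hu0]; nlinarith
    have hle : c * L θ₀ / (L (θ x) - ε') ≤ c * L θ₀ / (ε - ε') :=
      div_le_div_of_nonneg_left (by positivity) (by linarith) (by linarith)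
    have hn := h.norm_sub_le hL hε' hεε' hc ht hεt H hx'.1 hx'.2
    have h3 := H (θ x) (by linarith)
    set q := ‖gradient L (θ x)‖
    have hq : 0 ≤ q := norm_nonneg _
    have h4 : L (θ x) - ε' ≤ q * (c * L θ₀ / (L (θ x) - ε')) :=
      h3.trans (mul_le_mul_of_nonneg_left (by linarith) hq)
    rw [mul_div_assoc', le_div_iff₀ hu] at h4
    have h5 : (L (θ x) - ε) ^ 2 ≤ q * (c * L θ₀) := by nlinarith
    rw [sub_nonneg, div_le_div_iff₀ (by positivity) (by positivity)]
    have h6 : ((L (θ x) - ε) ^ 2) ^ 2 ≤ (q * (c * L θ₀)) ^ 2 := by gcongr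
    nlinarith
  have h1 := hmono (Set.left_mem_Icc.2 ht) (Set.right_mem_Icc.2 ht) ht
  simp only [h.1, mul_zero, sub_zero] at h1
  have h2 : 1 / L θ₀ ^ 3 ≤ ((L θ₀ - ε) ^ 3)⁻¹ := by
    rw [← one_div]
    have : 0 < L θ₀ - ε := by linarith
    exact one_div_le_one_div_of_le (by positivity) (by gcongr; linarith)
  rw [one_div ((L (θ t) - ε) ^ 3)]
  linarith

/-- A gradient domination condition with drifting constant implies the convergence criterion. -/
theorem convergenceCriterion_of_gradient_domination (hL : Differentiable ℝ L)
    {ε ε' c : ℝ} (hε' : 0 < ε') (hεε' : ε' < ε) (hc : 0 < c) (hL0 : 0 < L θ₀)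
    (H : ∀ p, ‖p - θ₀‖ ≤ c * L θ₀ / (ε - ε') →
      L p - ε' ≤ ‖gradient L p‖ * (‖p - θ₀‖ + c)) :
    ConvergenceCriterion L θ₀ ε (ENNReal.ofReal (3 / (c ^ 2 * L θ₀ ^ 2))) := by
  intro θ hθ t ht
  rcases le_or_gt (L (θ t)) ε with hle | hgt
  · exact (ENNReal.ofReal_le_ofReal hle).trans le_self_add
  have h1 := hθ.inv_cube_le hL hε' hεε' hc ht.le hgt H
  have hu : 0 < L (θ t) - ε := by linarith
  set K := 3 / (c ^ 2 * L θ₀ ^ 2)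
  have hK : 0 < K := by positivity
  have hpos : 0 < K * t + 1 / L θ₀ ^ 3 := by positivity
  have e1 : ENNReal.ofReal K * ENNReal.ofReal t + 1 / ENNReal.ofReal (L θ₀) ^ 3 =
      ENNReal.ofReal (K * t + 1 / L θ₀ ^ 3) := by
    rw [ENNReal.ofReal_add (by positivity) (by positivity), ENNReal.ofReal_mul hK.le,
      ← ENNReal.ofReal_one, ← ENNReal.ofReal_pow hL0.le, ← ENNReal.ofReal_div_of_pos (by positivity)]
  rw [e1, ENNReal.ofReal_rpow_of_pos hpos, one_div (ENNReal.ofReal _),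
    ← ENNReal.ofReal_inv_of_pos (by positivity), ← ENNReal.ofReal_add (by linarith) (by positivity)]
  apply ENNReal.ofReal_le_ofReal
  have h2 : (K * t + 1 / L θ₀ ^ 3) ^ (1 / 3 : ℝ) ≤ (L (θ t) - ε)⁻¹ := by
    refine (Real.rpow_le_rpow hpos.le h1 (by norm_num)).trans_eq ?_
    rw [one_div, ← inv_pow, ← Real.rpow_natCast, ← Real.rpow_mul (by positivity)]
    norm_num
  have h3 := inv_anti₀ (by positivity) h2
  rw [inv_inv] at h3
  linarith

/-- Serves to replace a possibly infinite rate by a finite one. -/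
theorem ConvergenceCriterion.mono {ε : ℝ} {κ κ' : ℝ≥0∞} (h : ConvergenceCriterion L θ₀ ε κ)
    (hκ : κ' ≤ κ) : ConvergenceCriterion L θ₀ ε κ' := by
  intro θ hθ t ht
  refine (h θ hθ t ht).trans ?_
  gcongr

theorem convergenceCriterion_of_le (hL : Differentiable ℝ L) {ε : ℝ} (h0 : L θ₀ ≤ ε)
    (κ : ℝ≥0∞) : ConvergenceCriterion L θ₀ ε κ := by
  intro θ hθ t ht
  have h1 := hθ.antitoneOn hL Set.self_mem_Ici ht.le ht.le
  simp only [hθ.1] at h1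
  exact (ENNReal.ofReal_le_ofReal (h1.trans h0)).trans le_self_add

end GradientFlow

/-! ### Continuous differentiability of the forward function and of the output. -/

section Smooth

variable {V : Type u} [Fintype V] {B : Digraph V}

theorem PerceptronModule.contDiff_forward {𝔹 : PerceptronModule.{u, v} B} (h𝔹 : 𝔹.IsC1)
    {E : Type*} [NormedAddCommGroup E] [NormedSpace ℝ E]
    {w : E → ∀ e, 𝔹.W e} {Φ : E → ∀ b : 𝔹.I, 𝔹.Y b.1}
    (hw : ∀ e, ContDiff ℝ 1 fun p => w p e) (hΦ : ∀ b, ContDiff ℝ 1 fun p => Φ p b) (b : V) :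
    ContDiff ℝ 1 fun p => 𝔹.forward (w p) (Φ p) b := by
  induction b using 𝔹.acyclic.wf.induction with
  | _ b ih =>
    by_cases hb : b ∈ 𝔹.I
    · have : (fun p => 𝔹.forward (w p) (Φ p) b) = fun p => Φ p ⟨b, hb⟩ := by
        funext p; rw [PerceptronModule.forward_eq, dif_pos hb]
      rw [this]
      exact hΦ _
    · have : (fun p => 𝔹.forward (w p) (Φ p) b) = fun p => 𝔹.vertexMap b hb
          (fun a => w p a.edge) (fun a => 𝔹.forward (w p) (Φ p) a.1) := by
        funext p; rw [PerceptronModule.forward_eq, dif_neg hb]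
      rw [this]
      exact (h𝔹.2 ⟨b, hb⟩).comp (contDiff_pi.2 fun a =>
        (h𝔹.1 a.edge).comp ((hw a.edge).prodMk (ih a.1 a.2)))

theorem PerceptronModule.continuous_vertexMap {𝔹 : PerceptronModule.{u, v} B} (h𝔹 : 𝔹.IsC1)
    (b : V) (hb : b ∉ 𝔹.I) :
    Continuous fun p : (∀ a : Parent B b, 𝔹.W a.edge) × (∀ a : Parent B b, 𝔹.Y a.1) =>
      𝔹.vertexMap b hb p.1 p.2 := by
  refine (h𝔹.2 ⟨b, hb⟩).continuous.comp (continuous_pi fun a => (h𝔹.1 a.edge).continuous.comp ?_)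
  exact ((continuous_apply a).comp continuous_fst).prodMk ((continuous_apply a).comp continuous_snd)

theorem PerceptronModule.IsC1.lift {𝔹 : PerceptronModule.{u, v} B} (h𝔹 : 𝔹.IsC1)
    {V' : Type w} [Fintype V'] {G : Digraph V'} {π : V' → V} (h : IsHom G B π) :
    (𝔹.lift h).IsC1 := by
  refine ⟨fun e => h𝔹.1 _, fun b => (h𝔹.2 _).comp (contDiff_pi.2 fun a =>
    ContDiff.sum fun p _ => ?_)⟩
  by_cases hp : h.parent p = a
  · subst hp
    simp only [dite_true]
    exact contDiff_pi.1 contDiff_id p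
  · simp only [hp, dite_false]
    exact contDiff_const

end Smooth

section Loss

variable {VB : Type u} [Fintype VB] {B : Digraph VB} {𝔹 : PerceptronModule.{u, v} B}
  {n₀ : 𝔹.I → ℕ} (𝔾 : LiftedModule.{u, v, w} 𝔹 n₀) {k : ℕ}

namespace LiftedModule

theorem contDiff_forward (h𝔹 : 𝔹.IsC1) (a : 𝔾.V) :
    ContDiff ℝ 1 fun p : 𝔾.Param × InputSpace 𝔹 n₀ => 𝔾.forward p.1 p.2 a := by
  refine PerceptronModule.contDiff_forward (𝔹 := 𝔾.toModule) (h𝔹.lift 𝔾.hom)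
    (w := fun p : 𝔾.Param × InputSpace 𝔹 n₀ => (p.1 : ∀ e, 𝔾.toModule.W e))
    (Φ := fun p => 𝔾.pullInput p.2) (fun e => ?_) (fun b => ?_) a
  · exact (contDiff_piLp 2).1 contDiff_fst e
  · exact contDiff_pi.1 contDiff_snd _

/-- The output of the lifted module with a linear readout. -/
def output (θ : 𝔾.Theta k) (x : InputSpace 𝔹 n₀) : EuclideanSpace ℝ (Fin k) :=
  𝔾.readout θ.snd (𝔾.forward θ.fst x)

theorem contDiff_output (h𝔹 : 𝔹.IsC1) :
    ContDiff ℝ 1 fun p : 𝔾.Theta k × InputSpace 𝔹 n₀ => 𝔾.output p.1 p.2 := by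
  rw [contDiff_piLp]
  intro i
  refine ContDiff.sum fun b _ => contDiff_const.mul (ContDiff.sum fun p _ => ?_)
  refine ContDiff.inner ℝ ?_ ?_
  · exact (contDiff_piLp 2).1 ((WithLp.sndL 2 ℝ 𝔾.Param (𝔾.Readout k)).contDiff.comp
      contDiff_fst) (i, p.1)
  · exact (𝔾.contDiff_forward h𝔹 p.1.1).comp
      (((WithLp.fstL 2 ℝ 𝔾.Param (𝔾.Readout k)).contDiff.comp contDiff_fst).prodMk contDiff_snd)

end LiftedModule
end Loss

/-! ### Mean square errors: perturbation, differentiability, convexity. -/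

section QuadraticLoss

variable {E F G : Type*} [NormedAddCommGroup E] [InnerProductSpace ℝ E]
  [NormedAddCommGroup F] [MeasurableSpace F] [OpensMeasurableSpace F] [NormedAddCommGroup G]

theorem memLp_sub_of_continuous [SecondCountableTopology G] {X : Set F} (hX : IsCompact X)
    {D : Measure X} [IsProbabilityMeasure D] {H : F → G} (hH : Continuous H)
    {f : X → G} (hf : MemLp f 2 D) : MemLp (fun x : X => H x - f x) 2 D := by
  obtain ⟨C, hC⟩ := hX.exists_bound_of_continuousOn hH.continuousOn
  refine MemLp.sub (MemLp.of_bound ?_ C (Filter.Eventually.of_forall fun x => hC x x.2)) hf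
  exact (hH.comp continuous_subtype_val).aestronglyMeasurable

/-- A pointwise perturbation bound for the mean square error. -/
theorem integral_norm_sq_le_of_norm_sub_le {α : Type*} [MeasurableSpace α] {μ : Measure α}
    [IsProbabilityMeasure μ] {r₀ r₁ : α → G} (h₀ : MemLp r₀ 2 μ) (h₁ : MemLp r₁ 2 μ) {b : ℝ}
    (hb : ∀ x, ‖r₁ x - r₀ x‖ ≤ b) :
    ∫ x, ‖r₁ x‖ ^ 2 ∂μ ≤ (√(∫ x, ‖r₀ x‖ ^ 2 ∂μ) + b) ^ 2 := by
  have i0 := h₀.integrable_norm_pow two_ne_zero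
  have i1 := h₁.integrable_norm_pow two_ne_zero
  have j0 := (h₀.integrable one_le_two).norm
  obtain ⟨x₀⟩ : Nonempty α := by
    by_contra h
    rw [not_nonempty_iff] at h
    have := measure_univ (μ := μ)
    simp [Set.univ_eq_empty_iff.2 h] at this
  have hb0 : 0 ≤ b := (norm_nonneg _).trans (hb x₀)
  set m := ∫ x, ‖r₀ x‖ ∂μ
  set q := ∫ x, ‖r₀ x‖ ^ 2 ∂μ
  have hq : 0 ≤ q := integral_nonneg fun _ => by positivity
  -- Cauchy-Schwarz, from the nonnegativity of the variance of ‖r₀‖. It controls the cross term when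
  -- (‖r₀‖ + b)² is integrated.
  have hm : m ^ 2 ≤ q := by
    have : 0 ≤ ∫ x, (‖r₀ x‖ - m) ^ 2 ∂μ := integral_nonneg fun _ => sq_nonneg _
    have e : ∫ x, (‖r₀ x‖ - m) ^ 2 ∂μ = q - 2 * m * m + m ^ 2 := by
      have : ∀ x, (‖r₀ x‖ - m) ^ 2 = ‖r₀ x‖ ^ 2 - 2 * m * ‖r₀ x‖ + m ^ 2 := fun x => by ring
      simp_rw [this]
      have i2 : Integrable (fun x => ‖r₀ x‖ ^ 2 - 2 * m * ‖r₀ x‖) μ := i0.sub (j0.const_mul _)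
      rw [integral_add i2 (integrable_const _),
        integral_sub i0 (j0.const_mul _), integral_const_mul]
      simp [q, m]
    nlinarith
  have hmq : m ≤ √q := Real.le_sqrt_of_sq_le hm
  have h2 : ∫ x, ‖r₁ x‖ ^ 2 ∂μ ≤ ∫ x, (‖r₀ x‖ ^ 2 + 2 * b * ‖r₀ x‖ + b ^ 2) ∂μ := by
    refine integral_mono i1 ((i0.add (j0.const_mul _)).add (integrable_const _)) fun x => ?_
    have h3 : ‖r₁ x‖ ≤ ‖r₀ x‖ + b := by
      have := norm_le_norm_add_norm_sub' (r₁ x) (r₀ x)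
      linarith [hb x]
    have : ‖r₁ x‖ ^ 2 ≤ (‖r₀ x‖ + b) ^ 2 := by gcongr
    simp only
    nlinarith
  refine h2.trans ?_
  have i2 : Integrable (fun x => ‖r₀ x‖ ^ 2 + 2 * b * ‖r₀ x‖) μ := i0.add (j0.const_mul _)
  rw [integral_add i2 (integrable_const _),
    integral_add i0 (j0.const_mul _), integral_const_mul]
  simp only [integral_const, probReal_univ, smul_eq_mul, one_mul]
  have := Real.sq_sqrt hq
  nlinarith [mul_le_mul_of_nonneg_left hmq hb0]

variable [InnerProductSpace ℝ G]

/-- Differentiation under the integral: H and its derivative are bounded on the compact product of a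
unit ball with X, so the derivative of the integrand is dominated by an affine function of ‖f‖,
which is integrable. -/
theorem differentiable_integral_norm_sq_sub [ProperSpace E] [NormedSpace ℝ F]
    [SecondCountableTopology F] [SecondCountableTopology G] {X : Set F} (hX : IsCompact X)
    {D : Measure X} [IsProbabilityMeasure D] {H : E × F → G} (hH : ContDiff ℝ 1 H) {f : X → G} (hf : MemLp f 2 D) :
    Differentiable ℝ fun θ => ∫ x : X, ‖H (θ, x) - f x‖ ^ 2 ∂D := by
  intro θ₀
  have hK : IsCompact (Metric.closedBall θ₀ 1 ×ˢ X) := (isCompact_closedBall θ₀ 1).prod hX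
  obtain ⟨C, hC⟩ := hK.exists_bound_of_continuousOn hH.continuous.continuousOn
  have hDH : Continuous (fderiv ℝ H) := hH.continuous_fderiv one_ne_zero
  obtain ⟨C', hC'⟩ := hK.exists_bound_of_continuousOn
    (hDH.clm_comp (continuous_const (y := ContinuousLinearMap.inl ℝ E F))).continuousOn
  have hsec : ∀ θ : E, Continuous fun x : F => H (θ, x) := fun θ =>
    hH.continuous.comp (Continuous.prodMk_right θ)
  have hres : ∀ θ : E, MemLp (fun x : X => H (θ, x) - f x) 2 D := fun θ =>
    memLp_sub_of_continuous hX (hsec θ) hf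
  refine (hasFDerivAt_integral_of_dominated_of_fderiv_le (μ := D)
    (F := fun θ (x : X) => ‖H (θ, x) - f x‖ ^ 2)
    (F' := fun θ (x : X) => 2 • (innerSL ℝ (H (θ, x) - f x)).comp
      ((fderiv ℝ H (θ, x)).comp (ContinuousLinearMap.inl ℝ E F)))
    (bound := fun x => 2 * ((C + ‖f x‖) * C'))
    (Metric.closedBall_mem_nhds θ₀ one_pos)
    (Filter.Eventually.of_forall fun θ => ((hres θ).1.norm.pow 2))
    ((hres θ₀).integrable_norm_pow two_ne_zero) ?_ ?_ ?_ ?_).differentiableAt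
  · refine AEStronglyMeasurable.const_smul ?_ 2
    refine (ContinuousLinearMap.compL ℝ E G ℝ).aestronglyMeasurable_comp₂ ?_ ?_
    · exact (innerSL ℝ).continuous.comp_aestronglyMeasurable (hres θ₀).1
    · exact ((hDH.clm_comp (continuous_const (y := ContinuousLinearMap.inl ℝ E F))).comp
        ((Continuous.prodMk_right θ₀).comp continuous_subtype_val)).aestronglyMeasurable
  · refine Filter.Eventually.of_forall fun x θ hθ => ?_
    have h1 : ‖H (θ, x) - f x‖ ≤ C + ‖f x‖ :=
      (norm_sub_le _ _).trans (by gcongr; exact hC (θ, x) ⟨hθ, x.2⟩)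
    have h2 := hC' (θ, x) ⟨hθ, x.2⟩
    rw [← Nat.cast_smul_eq_nsmul ℝ, norm_smul]
    simp only [Nat.cast_ofNat, Real.norm_ofNat]
    gcongr
    refine (ContinuousLinearMap.opNorm_comp_le _ _).trans ?_
    rw [innerSL_apply_norm]
    gcongr
    exact (norm_nonneg _).trans h1
  · exact (((integrable_const C).add (hf.integrable one_le_two).norm).mul_const C').const_mul 2
  · refine Filter.Eventually.of_forall fun x θ _ => ?_
    have h1 : HasFDerivAt (fun θ => H (θ, (x : F)) - f x)
        ((fderiv ℝ H (θ, x)).comp (ContinuousLinearMap.inl ℝ E F)) θ :=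
      (((hH.differentiable one_ne_zero) (θ, (x : F))).hasFDerivAt.comp θ
        (hasFDerivAt_prodMk_left θ (x : F))).sub_const _
    exact h1.norm_sq

/-- The right derivative at 0 along the segment is a limit of slopes bounded by the chord. Convexity
along a single segment from θ suffices, which matters because the loss is not convex in the weights.
-/
theorem inner_gradient_le_of_segment [CompleteSpace E] {L : E → ℝ} (hL : Differentiable ℝ L)
    {θ d : E} {M : ℝ}
    (h : ∀ s : ℝ, 0 < s → s ≤ 1 → L (θ + s • d) ≤ (1 - s) * L θ + s * M) :
    inner ℝ (gradient L θ) d ≤ M - L θ := by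
  have h1 : HasDerivAt (fun s : ℝ => L (θ + s • d)) (inner ℝ (gradient L θ) d) 0 := by
    have h2 : HasDerivAt (fun s : ℝ => θ + s • d) d 0 := by
      simpa using ((hasDerivAt_id (0 : ℝ)).smul_const d).const_add θ
    have h3 : HasFDerivAt L (InnerProductSpace.toDual ℝ E (gradient L θ))
        ((fun s : ℝ => θ + s • d) 0) := by
      simpa using (hL θ).hasGradientAt.hasFDerivAt
    have h4 := h3.comp_hasDerivAt (0 : ℝ) h2
    rwa [InnerProductSpace.toDual_apply_apply] at h4
  refine le_of_tendsto h1.tendsto_slope_zero_right ?_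
  filter_upwards [Ioc_mem_nhdsGT (zero_lt_one (α := ℝ))] with s hs
  simp only [zero_add, zero_smul, add_zero, smul_eq_mul]
  rw [inv_mul_le_iff₀ hs.1]
  have := h s hs.1 hs.2
  linarith

theorem integral_norm_sq_convex_comb_le {α : Type*} [MeasurableSpace α] {μ : Measure α}
    {r₀ r₁ : α → G} (h₀ : MemLp r₀ 2 μ) (h₁ : MemLp r₁ 2 μ) {s : ℝ} (hs : 0 ≤ s) (hs1 : s ≤ 1) :
    ∫ x, ‖(1 - s) • r₀ x + s • r₁ x‖ ^ 2 ∂μ ≤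
      (1 - s) * ∫ x, ‖r₀ x‖ ^ 2 ∂μ + s * ∫ x, ‖r₁ x‖ ^ 2 ∂μ := by
  have i0 := h₀.integrable_norm_pow two_ne_zero
  have i1 := h₁.integrable_norm_pow two_ne_zero
  rw [← integral_const_mul, ← integral_const_mul, ← integral_add (i0.const_mul _) (i1.const_mul _)]
  refine integral_mono
    (((h₀.const_smul (1 - s)).add (h₁.const_smul s)).integrable_norm_pow two_ne_zero)
    ((i0.const_mul _).add (i1.const_mul _)) fun x => ?_
  have h1 : ‖(1 - s) • r₀ x + s • r₁ x‖ ≤ (1 - s) * ‖r₀ x‖ + s * ‖r₁ x‖ := by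
    refine (norm_add_le _ _).trans_eq ?_
    rw [norm_smul, norm_smul, Real.norm_of_nonneg hs, Real.norm_of_nonneg (by linarith)]
  have h2 : ‖(1 - s) • r₀ x + s • r₁ x‖ ^ 2 ≤ ((1 - s) * ‖r₀ x‖ + s * ‖r₁ x‖) ^ 2 := by gcongr
  refine h2.trans ?_
  have : 0 ≤ (1 - s) * s * (‖r₀ x‖ - ‖r₁ x‖) ^ 2 :=
    mul_nonneg (mul_nonneg (by linarith) hs) (sq_nonneg _)
  simp only
  nlinarith

end QuadraticLoss

/-! ### Convexity of the loss in the readout. -/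

section Loss

variable {VB : Type u} [Fintype VB] {B : Digraph VB} {𝔹 : PerceptronModule.{u, v} B}
  {n₀ : 𝔹.I → ℕ} (𝔾 : LiftedModule.{u, v, w} 𝔹 n₀) {k : ℕ}

namespace LiftedModule

variable {𝔾} in
theorem memLp_residual (h𝔹 : 𝔹.IsC1) {X : Set (InputSpace 𝔹 n₀)} (hX : IsCompact X)
    {D : Measure X} [IsProbabilityMeasure D] {f : X → EuclideanSpace ℝ (Fin k)}
    (hf : MemLp f 2 D) (θ : 𝔾.Theta k) :
    MemLp (fun x : X => 𝔾.output θ x.1 - f x) 2 D :=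
  memLp_sub_of_continuous hX
    ((𝔾.contDiff_output h𝔹).continuous.comp (Continuous.prodMk_right θ)) hf

theorem differentiable_loss (h𝔹 : 𝔹.IsC1) {X : Set (InputSpace 𝔹 n₀)} (hX : IsCompact X)
    {D : Measure X} [IsProbabilityMeasure D] {f : X → EuclideanSpace ℝ (Fin k)}
    (hf : MemLp f 2 D) : Differentiable ℝ (𝔾.loss D f) := by
  have : ProperSpace (𝔾.Theta k) := FiniteDimensional.proper ℝ _
  exact differentiable_integral_norm_sq_sub hX (𝔾.contDiff_output h𝔹) hf

theorem output_add_smul (w : 𝔾.Param) (a d : 𝔾.Readout k) (s : ℝ) (x : InputSpace 𝔹 n₀) :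
    𝔾.output (WithLp.toLp 2 (w, a + s • d)) x =
      𝔾.output (WithLp.toLp 2 (w, a)) x + s • 𝔾.output (WithLp.toLp 2 (w, d)) x := by
  ext i
  simp only [output, readout, PiLp.add_apply, PiLp.smul_apply, WithLp.toLp_fst, WithLp.toLp_snd,
    inner_add_left, inner_smul_left, Finset.sum_add_distrib, mul_add, Finset.mul_sum,
    smul_eq_mul, RCLike.conj_to_real]
  congr 1
  refine Finset.sum_congr rfl fun b _ => Finset.sum_congr rfl fun p _ => ?_
  ring

/-- Convexity of the loss in the readout bounds the excess loss by the gradient. -/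
theorem loss_sub_le_norm_gradient_mul (h𝔹 : 𝔹.IsC1) {X : Set (InputSpace 𝔹 n₀)}
    (hX : IsCompact X) {D : Measure X} [IsProbabilityMeasure D]
    {f : X → EuclideanSpace ℝ (Fin k)} (hf : MemLp f 2 D) (θ : 𝔾.Theta k) (a : 𝔾.Readout k) :
    𝔾.loss D f θ - 𝔾.loss D f (WithLp.toLp 2 (θ.fst, a)) ≤
      ‖gradient (𝔾.loss D f) θ‖ * ‖a - θ.snd‖ := by
  -- Only the readout moves in this direction, so by `output_add_smul` the residual at θ + s d is
  -- the convex combination of the residuals at both ends.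
  set d : 𝔾.Theta k := WithLp.toLp 2 (0, a - θ.snd) with hd
  have hθ : θ = WithLp.toLp 2 (θ.fst, θ.snd) := rfl
  have h := inner_gradient_le_of_segment (𝔾.differentiable_loss h𝔹 hX hf) (θ := θ) (d := d)
    (M := 𝔾.loss D f (WithLp.toLp 2 (θ.fst, a))) (fun s hs hs1 => by
      have key := integral_norm_sq_convex_comb_le (memLp_residual h𝔹 hX hf θ)
        (memLp_residual h𝔹 hX hf (WithLp.toLp 2 (θ.fst, a) : 𝔾.Theta k)) hs.le hs1
      refine Eq.trans_le ?_ key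
      refine integral_congr_ae (Filter.Eventually.of_forall fun x => ?_)
      have e1 : θ + s • d = WithLp.toLp 2 (θ.fst, θ.snd + s • (a - θ.snd)) := by
        conv_lhs => rw [hθ]
        rw [hd, ← WithLp.toLp_smul, ← WithLp.toLp_add]
        simp
      have e2 := 𝔾.output_add_smul θ.fst θ.snd (a - θ.snd) s x.1
      have e3 := 𝔾.output_add_smul θ.fst θ.snd (a - θ.snd) 1 x.1
      rw [one_smul, add_sub_cancel, one_smul] at e3
      rw [← hθ] at e2 e3
      show ‖𝔾.output (θ + s • d) x.1 - f x‖ ^ 2 = _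
      simp only [e1, e2, e3]
      congr 2
      module)
  have h2 : ‖d‖ = ‖a - θ.snd‖ := by
    rw [hd, WithLp.prod_norm_eq_of_L2]
    simp
  have h3 := (abs_le.1 (abs_real_inner_le_norm (gradient (𝔾.loss D f) θ) d)).1
  rw [h2] at h3
  linarith

theorem loss_nonneg {X : Set (InputSpace 𝔹 n₀)} (D : Measure X)
    (f : X → EuclideanSpace ℝ (Fin k)) (θ : 𝔾.Theta k) : 0 ≤ 𝔾.loss D f θ :=
  integral_nonneg fun _ => by positivity

theorem loss_of_snd_eq_zero {X : Set (InputSpace 𝔹 n₀)} (D : Measure X)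
    (f : X → EuclideanSpace ℝ (Fin k)) {θ : 𝔾.Theta k} (hθ : θ.snd = 0) :
    𝔾.loss D f θ = normSqD D f := by
  refine integral_congr_ae (Filter.Eventually.of_forall fun x => ?_)
  have : 𝔾.readout θ.snd (𝔾.forward θ.fst x.1) = 0 := by
    ext i
    simp [readout, hθ]
  simp [this]

end LiftedModule
end Loss

/-! ### Positivity of the radius η and of the coverage parameters α. -/

section Deviation

variable {V : Type u} [Fintype V] {B : Digraph V}

/-- Induction along the graph. The reference weights and activations for inputs in K form a compact
set, and a continuous map is uniformly continuous around a compact set: one radius serves all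
reference points, even against points outside of the set. The parents' deviations are below this
radius by induction. -/
theorem PerceptronModule.eventually_deviation_le {𝔹 : PerceptronModule.{u, v} B} (h𝔹 : 𝔹.IsC1)
    (w₀ : ∀ e, 𝔹.W e) {K : Set (∀ b : 𝔹.I, 𝔹.Y b.1)} (hK : IsCompact K) (b : V) :
    ∀ τ : ℝ≥0∞, 0 < τ → ∀ᶠ η in 𝓝[>] (0 : ℝ≥0), ∀ Φ ∈ K, 𝔹.deviation w₀ Φ η b ≤ τ := by
  induction b using 𝔹.acyclic.wf.induction with
  | _ b ih =>
    intro τ hτ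
    by_cases hb : b ∈ 𝔹.I
    · refine Filter.Eventually.of_forall fun η Φ _ => ?_
      rw [PerceptronModule.deviation_eq, dif_pos hb]
      exact bot_le
    · set g := fun p : (∀ a : Parent B b, 𝔹.W a.edge) × (∀ a : Parent B b, 𝔹.Y a.1) =>
        𝔹.vertexMap b hb p.1 p.2
      have hg : Continuous g := PerceptronModule.continuous_vertexMap h𝔹 b hb
      set ref := fun Φ : (∀ b : 𝔹.I, 𝔹.Y b.1) =>
        ((fun a => w₀ a.edge, fun a => 𝔹.forward w₀ Φ a.1) :
          (∀ a : Parent B b, 𝔹.W a.edge) × (∀ a : Parent B b, 𝔹.Y a.1))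
      have href : Continuous ref := by
        refine continuous_const.prodMk (continuous_pi fun a => ?_)
        exact (PerceptronModule.contDiff_forward h𝔹 (w := fun _ => w₀) (Φ := id)
          (fun e => contDiff_const) (fun b => contDiff_pi.1 contDiff_id b) a.1).continuous
      have hC : IsCompact (ref '' K) := hK.image href
      have hu := hC.uniformContinuousAt_of_continuousAt g (fun a _ => hg.continuousAt)
        (mem_uniformity_edist.2 ⟨τ, hτ, fun h => h⟩ : {p : _ × _ | edist p.1 p.2 < τ} ∈ _)
      obtain ⟨ρ, hρ, hρu⟩ := mem_uniformity_edist.1 hu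
      obtain ⟨ρ', hρ', hρρ⟩ := exists_between hρ
      have h1 : ∀ᶠ η in 𝓝[>] (0 : ℝ≥0), ∀ a : Parent B b, ∀ Φ ∈ K,
          𝔹.deviation w₀ Φ η a.1 ≤ ρ' :=
        Filter.eventually_all.2 fun a => ih a.1 a.2 ρ' hρ'
      have h2 : ∀ᶠ η : ℝ≥0 in 𝓝[>] (0 : ℝ≥0), (η : ℝ≥0∞) < ρ' := by
        refine Filter.Eventually.filter_mono nhdsWithin_le_nhds ?_
        have : Filter.Tendsto (fun η : ℝ≥0 => (η : ℝ≥0∞)) (𝓝 0) (𝓝 0) :=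
          ENNReal.continuous_coe.tendsto 0
        exact this.eventually_lt_const hρ'
      filter_upwards [h1, h2] with η h1 h2 Φ hΦ
      rw [PerceptronModule.deviation_eq, dif_neg hb]
      refine iSup_le fun w => iSup_le fun y => iSup_le fun hw => iSup_le fun hy => ?_
      have h3 : edist (ref Φ) (w, y) < ρ := by
        refine lt_of_le_of_lt ?_ hρρ
        rw [Prod.edist_eq]
        refine max_le (edist_pi_le_iff.2 fun a => ?_) (edist_pi_le_iff.2 fun a => ?_)
        · rw [edist_comm, edist_eq_enorm_sub]
          exact (hw a).trans h2.le
        · rw [edist_comm, edist_eq_enorm_sub]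
          exact (hy a).trans (h1 a Φ hΦ)
      have h4 : edist (g (ref Φ)) (g (w, y)) < τ := @hρu _ _ h3 ⟨Φ, hΦ, rfl⟩
      rw [edist_comm, edist_eq_enorm_sub] at h4
      exact h4.le

end Deviation

namespace LiftedModule

variable {VB : Type u} [Fintype VB] {B : Digraph VB} {𝔹 : PerceptronModule.{u, v} B}
  {n₀ : 𝔹.I → ℕ} (𝔾 : LiftedModule.{u, v, w} 𝔹 n₀)
  {k : ℕ} {X : Set (InputSpace 𝔹 n₀)} {D : Measure X}
  {f : X → EuclideanSpace ℝ (Fin k)} {lam : Edge B → ℝ} {N : ∀ e : Edge B, Measure (𝔹.W e)}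
  {ε δ : ℝ} {θ : 𝔾.Theta k}

theorem exists_continuityConstant_le (h𝔹 : 𝔹.IsC1) (hX : IsCompact X)
    (w : ∀ e : Edge 𝔾.G, 𝔹.W (𝔾.hom.edge e)) {τ : ℝ≥0∞} (hτ : 0 < τ) :
    ∃ η : ℝ≥0, 0 < η ∧ 𝔾.continuityConstant w X η ≤ τ := by
  have hc : Continuous 𝔾.pullInput := continuous_pi fun a => continuous_apply _
  have h1 : ∀ᶠ η in 𝓝[>] (0 : ℝ≥0), ∀ b, ∀ Φ ∈ 𝔾.pullInput '' X,
      𝔾.toModule.deviation w Φ η b ≤ τ := Filter.eventually_all.2 fun b =>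
    PerceptronModule.eventually_deviation_le (h𝔹.lift 𝔾.hom) w (hX.image hc) b τ hτ
  obtain ⟨η, h, hη⟩ := (h1.and self_mem_nhdsWithin).exists
  refine ⟨η, hη, iSup_le fun x => iSup_le fun hx => iSup_le fun b => ?_⟩
  exact h b _ ⟨x, hx, rfl⟩

theorem cStar_nonneg : 0 ≤ 𝔾.cStar θ :=
  Finset.sum_nonneg fun _ _ => Finset.sum_nonneg fun _ _ => by positivity

/-- The threshold on L(η) is positive because ε₀ < ε (it is ∞ if C⋆ = 0), and L(η) can be made
arbitrarily small. The intermediate τ turns the bound L(η) ≤ τ into a strict one. -/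
theorem etaStar_pos (h𝔹 : 𝔹.IsC1) (hX : IsCompact X) (hε : 𝔾.loss D f θ < ε) :
    0 < 𝔾.etaStar D f ε θ := by
  have h0 := 𝔾.loss_nonneg D f θ
  have hb : 0 < ENNReal.ofReal (√((ε + 𝔾.loss D f θ) / 2) - √(𝔾.loss D f θ)) /
      ENNReal.ofReal (𝔾.cStar θ) := by
    refine ENNReal.div_pos ?_ ENNReal.ofReal_ne_top
    rw [Ne, ENNReal.ofReal_eq_zero, not_le, sub_pos]
    exact Real.sqrt_lt_sqrt h0 (by linarith)
  obtain ⟨τ, hτ, hτb⟩ := exists_between hb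
  obtain ⟨η, hη, hητ⟩ := 𝔾.exists_continuityConstant_le h𝔹 hX θ.fst hτ
  have h1 : (η : ℝ≥0∞) ≤ 𝔾.etaStar D f ε θ :=
    le_iSup_of_le η (le_iSup_of_le hη (le_iSup_of_le (hητ.trans_lt hτb) le_rfl))
  exact (ENNReal.coe_pos.2 hη).trans_le h1

theorem fiberCard_pos (b : 𝔾.V) : 0 < 𝔾.fiberCard (𝔾.π b) := by
  have : Nonempty {a : 𝔾.V // 𝔾.π a = 𝔾.π b} := ⟨⟨b, rfl⟩⟩
  exact Nat.card_pos

variable {w : ∀ e : Edge 𝔾.G, 𝔹.W (𝔾.hom.edge e)} {η : ℝ≥0∞}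

theorem alpha_pos (hlam : ∀ e, 0 < lam e) (hN : ∀ e, (N e).IsOpenPosMeasure) (hη : 0 < η)
    (b : 𝔾.V) : 0 < 𝔾.alpha lam N w η b := by
  induction b using (𝔾.hom.isAcyclic 𝔹.acyclic).wf.induction with
  | _ b ih =>
    rw [alpha_eq]
    split_ifs with hb
    · simp
    · rw [pos_iff_ne_zero]
      refine mul_ne_zero (mul_ne_zero ?_ ?_) ?_
      · rw [one_div]
        exact ENNReal.inv_ne_zero.2 (ENNReal.natCast_ne_top _)
      · refine Finset.prod_ne_zero_iff.2 fun a _ => ?_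
        have := hlam a.edge
        simp only [Ne, ENNReal.ofReal_eq_zero, not_le]
        positivity
      · refine Finset.prod_ne_zero_iff.2 fun p _ => mul_ne_zero ?_ (ih p.1 p.2).ne'
        have := hN (𝔾.hom.edge p.edge)
        refine (lt_of_lt_of_le (Metric.isOpen_eball.measure_pos _ ?_)
          (measure_mono Metric.eball_subset_closedEBall)).ne'
        exact ⟨w p.edge, Metric.mem_eball_self hη⟩

theorem alpha_le_one (hlam : ∀ e, 0 < lam e) [∀ e, IsProbabilityMeasure (N e)]
    (b : 𝔾.V) : 𝔾.alpha lam N w η b ≤ 1 := by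
  induction b using (𝔾.hom.isAcyclic 𝔹.acyclic).wf.induction with
  | _ b ih =>
    rw [alpha_eq]
    split_ifs with hb
    -- The block of this type is nonempty, since `c` sends the vertex into it.
    · have : 1 ≤ n₀ ⟨𝔾.π b, hb⟩ := (Nat.zero_le _).trans_lt (𝔾.c ⟨b, hb⟩).2
      simpa using this
    · refine mul_le_one' (mul_le_one' ?_ ?_) ?_
      · rw [one_div, ENNReal.inv_le_one]
        exact_mod_cast Nat.mul_pos (by positivity) (𝔾.fiberCard_pos b)
      · refine Finset.prod_le_one' fun a _ => ?_
        have := hlam a.edge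
        rw [ENNReal.ofReal_le_one, mul_div_assoc]
        refine (mul_le_mul_of_nonneg_left (Real.pow_div_factorial_le_exp _ this.le _)
          (Real.exp_pos _).le).trans_eq ?_
        rw [← Real.exp_add]; simp
      · exact Finset.prod_le_one' fun p _ => mul_le_one' prob_le_one (ih p.1 p.2)

end LiftedModule

/-! ### Copies of a reference network inside a sparse lift. -/

namespace LiftedModule

variable {VB : Type u} [Fintype VB] {B : Digraph VB} {𝔹 : PerceptronModule.{u, v} B}
  {n₀ : 𝔹.I → ℕ} (𝔾 : LiftedModule.{u, v, w} 𝔹 n₀) {n : VB → ℕ}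

/-- The lift `(π u, i) → (π v, j)` of an edge `u → v`. -/
abbrev liftEdge {u v : 𝔾.V} (h : 𝔾.G.Adj u v) (i : Fin (n (𝔾.π u))) (j : Fin (n (𝔾.π v))) :
    Edge (fullLift B n) :=
  ⟨(⟨𝔾.π u, i⟩, ⟨𝔾.π v, j⟩), 𝔾.hom h⟩

/-- The weight of a lifted edge, seen as a weight of the original edge. -/
abbrev liftWeight (w : ∀ e : Edge (fullLift B n), 𝔹.W ((fullLift_isHom n).edge e))
    {u v : 𝔾.V} (h : 𝔾.G.Adj u v) (i : Fin (n (𝔾.π u))) (j : Fin (n (𝔾.π v))) :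
    𝔹.W (𝔾.hom.edge ⟨(u, v), h⟩) :=
  w (𝔾.liftEdge h i j)

/-- `(π v, j)` is a copy of the vertex `v` in the sparse lift with mask `m` and weights `w`: its
parents are exactly one copy of each parent of `v`, with weights `ρ`-close to the reference
weights. Only indices `j` with label `v` (the set `J v`) are considered. -/
inductive IsCopy (hn : ∀ b : 𝔹.I, n b.1 = n₀ b) (J : ∀ v : 𝔾.V, Set (Fin (n (𝔾.π v))))
    (w₀ : ∀ e : Edge 𝔾.G, 𝔹.W (𝔾.hom.edge e)) (ρ : ℝ≥0∞) (m : Edge (fullLift B n) → Bool)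
    (w : ∀ e : Edge (fullLift B n), 𝔹.W ((fullLift_isHom n).edge e)) :
    ∀ v : 𝔾.V, Fin (n (𝔾.π v)) → Prop
  | init (v : 𝔾.V) (hv : 𝔾.π v ∈ 𝔹.I) :
      IsCopy hn J w₀ ρ m w v (Fin.cast (hn ⟨𝔾.π v, hv⟩).symm (𝔾.c ⟨v, hv⟩))
  | step (v : 𝔾.V) (hv : 𝔾.π v ∉ 𝔹.I) (j : Fin (n (𝔾.π v))) (hj : j ∈ J v)
      (i : ∀ u : Parent 𝔾.G v, Fin (n (𝔾.π u.1)))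
      (hi : ∀ u : Parent 𝔾.G v, IsCopy hn J w₀ ρ m w u.1 (i u))
      (hm : ∀ (q : Σ b : VB, Fin (n b)) (hq : (fullLift B n).Adj q ⟨𝔾.π v, j⟩),
        m ⟨(q, ⟨𝔾.π v, j⟩), hq⟩ = true ↔ ∃ u : Parent 𝔾.G v, q = ⟨𝔾.π u.1, i u⟩)
      (hw : ∀ u : Parent 𝔾.G v, ‖𝔾.liftWeight w u.2 (i u) j - w₀ u.edge‖ₑ ≤ ρ) :
      IsCopy hn J w₀ ρ m w v j

/-- Labels are disjoint. -/
def IsLabelling (J : ∀ v : 𝔾.V, Set (Fin (n (𝔾.π v)))) : Prop :=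
  ∀ v v' : 𝔾.V, ∀ j ∈ J v, ∀ j' ∈ J v',
    (⟨𝔾.π v, j⟩ : Σ b : VB, Fin (n b)) = ⟨𝔾.π v', j'⟩ → v = v'

variable {hn : ∀ b : 𝔹.I, n b.1 = n₀ b} {J : ∀ v : 𝔾.V, Set (Fin (n (𝔾.π v)))}
  {w₀ : ∀ e : Edge 𝔾.G, 𝔹.W (𝔾.hom.edge e)} {ρ : ℝ≥0∞} {m : Edge (fullLift B n) → Bool}
  {w : ∀ e : Edge (fullLift B n), 𝔹.W ((fullLift_isHom n).edge e)}

theorem isCopy_iff_of_mem {v : 𝔾.V} (hv : 𝔾.π v ∈ 𝔹.I) {j : Fin (n (𝔾.π v))} :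
    𝔾.IsCopy hn J w₀ ρ m w v j ↔ j = Fin.cast (hn ⟨𝔾.π v, hv⟩).symm (𝔾.c ⟨v, hv⟩) := by
  constructor
  · intro h
    cases h with
    | init _ => rfl
    | step => contradiction
  · rintro rfl
    exact IsCopy.init v hv

theorem isCopy_iff_of_notMem {v : 𝔾.V} (hv : 𝔾.π v ∉ 𝔹.I) {j : Fin (n (𝔾.π v))} :
    𝔾.IsCopy hn J w₀ ρ m w v j ↔ j ∈ J v ∧ ∃ i : ∀ u : Parent 𝔾.G v, Fin (n (𝔾.π u.1)),
      (∀ u : Parent 𝔾.G v, 𝔾.IsCopy hn J w₀ ρ m w u.1 (i u)) ∧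
      (∀ (q : Σ b : VB, Fin (n b)) (hq : (fullLift B n).Adj q ⟨𝔾.π v, j⟩),
        m ⟨(q, ⟨𝔾.π v, j⟩), hq⟩ = true ↔ ∃ u : Parent 𝔾.G v, q = ⟨𝔾.π u.1, i u⟩) ∧
      ∀ u : Parent 𝔾.G v, ‖𝔾.liftWeight w u.2 (i u) j - w₀ u.edge‖ₑ ≤ ρ := by
  constructor
  · intro h
    cases h with
    | init => contradiction
    | step =>
      rename_i i hi hj hm hw
      exact ⟨hj, i, hi, hm, hw⟩
  · rintro ⟨hj, i, hi, hm, hw⟩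
    exact IsCopy.step v hv j hj i hi hm hw

variable {𝔾} in
-- At inputs by injectivity of `c`, elsewhere by disjointness of labels. This is the purpose of
-- labels: copies of distinct parents are distinct vertices, and readouts assigned to copies of
-- distinct vertices do not collide.
theorem IsCopy.unique (hJ : 𝔾.IsLabelling J) {v v' : 𝔾.V} {j : Fin (n (𝔾.π v))}
    {j' : Fin (n (𝔾.π v'))} (h : 𝔾.IsCopy hn J w₀ ρ m w v j)
    (h' : 𝔾.IsCopy hn J w₀ ρ m w v' j')
    (he : (⟨𝔾.π v, j⟩ : Σ b : VB, Fin (n b)) = ⟨𝔾.π v', j'⟩) : v = v' := by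
  have hπ : 𝔾.π v = 𝔾.π v' := congrArg Sigma.fst he
  by_cases hv : 𝔾.π v ∈ 𝔹.I
  · have hv' : 𝔾.π v' ∈ 𝔹.I := hπ ▸ hv
    rw [isCopy_iff_of_mem 𝔾 hv] at h
    rw [isCopy_iff_of_mem 𝔾 hv'] at h'
    subst h h'
    -- The types are generalised to variables, so that their equality can be substituted away.
    have key : ∀ (b b' : VB) (hb : b ∈ 𝔹.I) (hb' : b' ∈ 𝔹.I) (i : Fin (n₀ ⟨b, hb⟩))
        (i' : Fin (n₀ ⟨b', hb'⟩)),
        (⟨b, Fin.cast (hn ⟨b, hb⟩).symm i⟩ : Σ b : VB, Fin (n b)) =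
          ⟨b', Fin.cast (hn ⟨b', hb'⟩).symm i'⟩ →
        (⟨⟨b, hb⟩, i⟩ : InputName 𝔹 n₀) = ⟨⟨b', hb'⟩, i'⟩ := by
      intro b b' hb hb' i i' h
      obtain rfl : b = b' := congrArg Sigma.fst h
      simp only [Sigma.mk.injEq, heq_eq_eq, true_and, Fin.cast_inj] at h
      rw [h]
    have := 𝔾.c_injective (a₁ := ⟨v, hv⟩) (a₂ := ⟨v', hv'⟩) (key _ _ hv hv' _ _ he)
    exact congrArg Subtype.val this
  · have hv' : 𝔾.π v' ∉ 𝔹.I := hπ ▸ hv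
    rw [isCopy_iff_of_notMem 𝔾 hv] at h
    rw [isCopy_iff_of_notMem 𝔾 hv'] at h'
    exact hJ v v' j h.1 j' h'.1 he

end LiftedModule

/-! ### Activations of copies beyond the reach of bad edges. -/

section SparseForward

variable {VB : Type u} [Fintype VB] {B : Digraph VB} {𝔹 : PerceptronModule.{u, v} B}
  {n₀ : 𝔹.I → ℕ} {n : VB → ℕ} {hn : ∀ b : 𝔹.I, n b.1 = n₀ b} {m : Edge (fullLift B n) → Bool}

/-- The weight of an edge which is present in the sparse lift. -/
def sparseWeight (w : (sparseLift (n₀ := n₀) n hn m).Param) (e : Edge (fullLift B n))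
    (he : m e = true) : 𝔹.W ((fullLift_isHom n).edge e) :=
  w ⟨e.1, e.2, he⟩

/-- The activation of the vertex `(b, i)` of the sparse lift. -/
def sparseForward (w : (sparseLift (n₀ := n₀) n hn m).Param) (x : InputSpace 𝔹 n₀) (b : VB)
    (i : Fin (n b)) : 𝔹.Y b :=
  (sparseLift (n₀ := n₀) n hn m).forward w x (⟨b, i⟩ : Σ b : VB, Fin (n b))

theorem sparseForward_of_mem (w : (sparseLift (n₀ := n₀) n hn m).Param) (x : InputSpace 𝔹 n₀)
    {b : VB} (hb : b ∈ 𝔹.I) (i : Fin (n b)) :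
    sparseForward w x b i = x ⟨⟨b, hb⟩, Fin.cast (hn ⟨b, hb⟩) i⟩ :=
  (PerceptronModule.forward_eq _ _ _ _).trans (dif_pos hb)

theorem sparseForward_of_notMem (w : (sparseLift (n₀ := n₀) n hn m).Param)
    (x : InputSpace 𝔹 n₀) {b : VB} (hb : b ∉ 𝔹.I) (i : Fin (n b)) :
    sparseForward w x b i = 𝔹.σ ⟨b, hb⟩ fun a => ∑ p : Parent (sparseGraph n m) ⟨b, i⟩,
      if hp : (sparseGraph_isHom n m).parent p = a then
        hp ▸ 𝔹.M ⟨(p.1.1, b), p.2.1⟩ (sparseWeight w ⟨(p.1, ⟨b, i⟩), p.2.1⟩ p.2.2,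
          sparseForward w x p.1.1 p.1.2)
      else 0 :=
  (PerceptronModule.forward_eq _ _ _ _).trans (dif_neg hb)

end SparseForward

section Dead

variable {VB : Type u} {B : Digraph VB} {n : VB → ℕ}

/-- The vertices reachable in the sparse graph from the head of a bad edge. -/
inductive Dead (m bad : Edge (fullLift B n) → Prop) : (Σ b : VB, Fin (n b)) → Prop
  | bad (e : Edge (fullLift B n)) (hm : m e) (he : bad e) : Dead m bad e.1.2
  | step (e : Edge (fullLift B n)) (hm : m e) (he : Dead m bad e.1.1) : Dead m bad e.1.2

end Dead

namespace LiftedModule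

variable {VB : Type u} [Fintype VB] {B : Digraph VB} {𝔹 : PerceptronModule.{u, v} B}
  {n₀ : 𝔹.I → ℕ} {𝔾 : LiftedModule.{u, v, w} 𝔹 n₀} {n : VB → ℕ}
  {hn : ∀ b : 𝔹.I, n b.1 = n₀ b} {J : ∀ v : 𝔾.V, Set (Fin (n (𝔾.π v)))}
  {w₀ : ∀ e : Edge 𝔾.G, 𝔹.W (𝔾.hom.edge e)} {ρ : ℝ≥0∞} {m : Edge (fullLift B n) → Bool}
  {w : ∀ e : Edge (fullLift B n), 𝔹.W ((fullLift_isHom n).edge e)}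

theorem forward_of_mem (x : InputSpace 𝔹 n₀) {v : 𝔾.V} (hv : 𝔾.π v ∈ 𝔹.I) :
    𝔾.forward w₀ x v = x ⟨⟨𝔾.π v, hv⟩, 𝔾.c ⟨v, hv⟩⟩ :=
  (PerceptronModule.forward_eq _ _ _ _).trans (dif_pos hv)

theorem forward_of_notMem (x : InputSpace 𝔹 n₀) {v : 𝔾.V} (hv : v ∉ 𝔾.toModule.I) :
    𝔾.forward w₀ x v = 𝔾.toModule.vertexMap v hv (fun a => w₀ a.edge)
        (fun a => 𝔾.forward w₀ x a.1) :=
  (PerceptronModule.forward_eq _ _ _ _).trans (dif_neg hv)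

/-- The weight of a lifted edge which is present in the sparse lift, seen as a weight of the
original edge. -/
abbrev sparseLiftWeight (w' : (sparseLift (n₀ := n₀) n hn m).Param) {u v : 𝔾.V}
    (h : 𝔾.G.Adj u v) (i : Fin (n (𝔾.π u))) (j : Fin (n (𝔾.π v)))
    (hm : m (𝔾.liftEdge h i j) = true) : 𝔹.W (𝔾.hom.edge ⟨(u, v), h⟩) :=
  sparseWeight w' (𝔾.liftEdge h i j) hm

/-- The activation of a copy which is not dead deviates little from that of the reference. -/
theorem IsCopy.enorm_forward_sub_le (hJ : 𝔾.IsLabelling J)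
    {bad : Edge (fullLift B n) → Prop} (w' : (sparseLift (n₀ := n₀) n hn m).Param) {η : ℝ≥0}
    (hη : ∀ {u v : 𝔾.V} (h : 𝔾.G.Adj u v) (i : Fin (n (𝔾.π u))) (j : Fin (n (𝔾.π v)))
      (hm : m (𝔾.liftEdge h i j) = true), ¬ bad (𝔾.liftEdge h i j) →
      ‖𝔾.liftWeight w h i j - w₀ ⟨(u, v), h⟩‖ₑ ≤ ρ →
      ‖sparseLiftWeight w' h i j hm - w₀ ⟨(u, v), h⟩‖ₑ ≤ η)
    (x : InputSpace 𝔹 n₀) {v : 𝔾.V} {j : Fin (n (𝔾.π v))}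
    (hc : 𝔾.IsCopy hn J w₀ ρ m w v j) (hd : ¬ Dead (m · = true) bad ⟨𝔾.π v, j⟩) :
    ‖sparseForward w' x (𝔾.π v) j - 𝔾.forward w₀ x v‖ₑ ≤
      𝔾.toModule.deviation w₀ (𝔾.pullInput x) η v := by
  induction hc with
  | init v hv =>
    rw [forward_of_mem x hv, sparseForward_of_mem w' x hv]
    simp
  | step v hv j hj i hi hm hw ih =>
    have hv1 : v ∉ 𝔾.toModule.I := hv
    have hmu : ∀ u : Parent 𝔾.G v, m (𝔾.liftEdge u.2 (i u) j) = true := fun u =>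
      (hm ⟨𝔾.π u.1, i u⟩ (𝔾.hom u.2)).2 ⟨u, rfl⟩
    -- Death propagates along present edges, so a living copy has only living parents and good
    -- incoming edges.
    have hdu : ∀ u : Parent 𝔾.G v, ¬ Dead (m · = true) bad ⟨𝔾.π u.1, i u⟩ := fun u h =>
      hd (Dead.step (𝔾.liftEdge u.2 (i u) j) (hmu u) h)
    have hbu : ∀ u : Parent 𝔾.G v, ¬ bad (𝔾.liftEdge u.2 (i u) j) := fun u h =>
      hd (Dead.bad (𝔾.liftEdge u.2 (i u) j) (hmu u) h)
    set W : ∀ u : Parent 𝔾.G v, 𝔾.toModule.W u.edge := fun u =>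
      sparseLiftWeight w' u.2 (i u) j (hmu u)
    set g : ∀ u : Parent 𝔾.G v, 𝔾.toModule.Y u.1 := fun u =>
      sparseForward w' x (𝔾.π u.1) (i u)
    have e2 : sparseForward w' x (𝔾.π v) j = 𝔾.toModule.vertexMap v hv1 W g := by
      rw [sparseForward_of_notMem w' x hv]
      refine congrArg (𝔹.σ ⟨𝔾.π v, hv⟩) (funext fun a => ?_)
      symm
      -- u ↦ (π u, i u) is a bijection from the parents of v to the parents of its copy: injective
      -- by uniqueness of copies, surjective because a copy has no further parents. The sums of
      -- pre-activations therefore agree, and the activation of the copy is the reference vertex map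
      -- at (W, g), a competitor in the supremum defining the deviation.
      refine Fintype.sum_bijective
        (fun u : Parent 𝔾.G v => (⟨⟨𝔾.π u.1, i u⟩, 𝔾.hom u.2, hmu u⟩ :
          Parent (sparseGraph n m) ⟨𝔾.π v, j⟩)) ⟨?_, ?_⟩ _ _ ?_
      · intro u u' h
        exact Subtype.ext (IsCopy.unique hJ (hi u) (hi u') (congrArg Subtype.val h))
      · rintro ⟨q, hq, hq'⟩
        obtain ⟨u, rfl⟩ := (hm q hq).1 hq'
        exact ⟨u, rfl⟩
      · intro u
        rfl
    rw [forward_of_notMem x hv1, e2, PerceptronModule.deviation_eq, dif_neg hv1]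
    exact le_iSup_of_le W (le_iSup_of_le g (le_iSup_of_le
      (fun u => hη u.2 (i u) j (hmu u) (hbu u) (hw u))
      (le_iSup_of_le (fun u => ih u (hdu u)) le_rfl)))

end LiftedModule

/-! ### Proportion of vertices reached from bad edges. -/

section Dead

variable {VB : Type u} [Fintype VB] {B : Digraph VB} {n : VB → ℕ}

/-- The number of proper ancestors of a vertex. -/
def rank (B : Digraph VB) (b : VB) : ℕ := (Finset.univ.filter fun a => Relation.TransGen B.Adj a b).card

theorem rank_lt_rank (hB : IsAcyclic B) {a b : VB} (h : B.Adj a b) : rank B a < rank B b := by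
  refine Finset.card_lt_card (Finset.ssubset_iff_of_subset ?_ |>.2 ⟨a, ?_, ?_⟩)
  · intro c hc
    simp only [Finset.mem_filter, Finset.mem_univ, true_and] at hc ⊢
    exact hc.tail h
  · simpa using Relation.TransGen.single h
  · simpa using hB a

theorem rank_lt_card (hB : IsAcyclic B) (b : VB) : rank B b < Fintype.card VB := by
  refine Finset.card_lt_card (Finset.ssubset_iff_of_subset (Finset.subset_univ _) |>.2
    ⟨b, Finset.mem_univ _, ?_⟩)
  simpa using hB b

/-- The dead vertices of a given type. -/
def deadSet (m bad : Edge (fullLift B n) → Prop) (b : VB) : Finset (Fin (n b)) :=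
  Finset.univ.filter fun i => Dead m bad ⟨b, i⟩

/-- The out-neighbours in the fibre of `b` of a vertex of the sparse graph. -/
def outSet (m : Edge (fullLift B n) → Prop) (e : Edge B) (i : Fin (n e.1.1)) :
    Finset (Fin (n e.1.2)) :=
  Finset.univ.filter fun j => m ⟨(⟨e.1.1, i⟩, ⟨e.1.2, j⟩), e.2⟩

theorem deadSet_eq_empty (m bad : Edge (fullLift B n) → Prop) {b : VB}
    (hb : ∀ a, ¬ B.Adj a b) : deadSet m bad b = ∅ := by
  refine Finset.filter_eq_empty_iff.2 fun i _ h => ?_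
  have : ∀ p, Dead m bad p → p.1 ≠ b := by
    rintro p (⟨e, _, _⟩ | ⟨e, _, _⟩) rfl
    · exact hb _ e.2
    · exact hb _ e.2
  exact this _ h rfl

theorem deadSet_subset (m bad : Edge (fullLift B n) → Prop) (b : VB) :
    deadSet m bad b ⊆
      (Finset.univ.filter bad).biUnion
        (fun e => Finset.univ.filter fun j => e.1.2 = ⟨b, j⟩) ∪
      (Finset.univ : Finset (Parent B b)).biUnion fun a =>
        (deadSet m bad a.1).biUnion fun i => outSet m a.edge i := by
  intro j hj
  have hj' : Dead m bad ⟨b, j⟩ := (Finset.mem_filter.1 hj).2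
  rw [Finset.mem_union]
  generalize hp : (⟨b, j⟩ : Σ b : VB, Fin (n b)) = p at hj'
  cases hj' with
  | bad e hm he =>
    left
    simp only [Finset.mem_biUnion, Finset.mem_filter, Finset.mem_univ,
      true_and]
    exact ⟨e, he, hp.symm⟩
  | step e hm he =>
    right
    obtain ⟨⟨⟨a, i⟩, q⟩, hq⟩ := e
    simp only at hp
    subst hp
    simp only [Finset.mem_biUnion, Finset.mem_univ, true_and]
    exact ⟨⟨a, hq⟩, i, Finset.mem_filter.2 ⟨Finset.mem_univ _, he⟩,
      Finset.mem_filter.2 ⟨Finset.mem_univ _, hm⟩⟩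

theorem card_deadSet_le_add (m bad : Edge (fullLift B n) → Prop) (b : VB) :
    (deadSet m bad b).card ≤ (Finset.univ.filter bad).card +
      ∑ a : Parent B b, ∑ i ∈ deadSet m bad a.1, (outSet m a.edge i).card := by
  refine (Finset.card_le_card (deadSet_subset m bad b)).trans ((Finset.card_union_le _ _).trans
    (Nat.add_le_add ?_ ?_))
  · refine (Finset.card_biUnion_le).trans ?_
    have : ∀ e : Edge (fullLift B n),
        (Finset.univ.filter fun j : Fin (n b) => e.1.2 = ⟨b, j⟩).card ≤ 1 := by
      intro e
      refine Finset.card_le_one.2 fun i hi j hj => ?_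
      have h1 := (Finset.mem_filter.1 hi).2.symm.trans (Finset.mem_filter.1 hj).2
      simpa using h1
    refine (Finset.sum_le_card_nsmul _ _ 1 fun e _ => this e).trans ?_
    simp
  · exact (Finset.card_biUnion_le).trans (Finset.sum_le_sum fun a _ => Finset.card_biUnion_le)

/-- The proportion of dead vertices grows at most geometrically with the rank. -/
theorem card_deadSet_le (hB : IsAcyclic B) {I : Set VB} (hI : ∀ b ∈ I, ∀ a, ¬ B.Adj a b)
    (m bad : Edge (fullLift B n) → Prop) {K S : ℝ} (hK : ((Finset.univ.filter bad).card : ℝ) ≤ K)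
    (hS : 0 < S) (hn : ∀ b, b ∉ I → S ≤ n b) {Λ : Edge B → ℝ} (hΛ : ∀ e, 0 ≤ Λ e)
    (hdeg : ∀ e : Edge B, e.1.1 ∉ I → ∀ i, ((outSet m e i).card : ℝ) ≤ Λ e * (n e.1.2 / n e.1.1))
    (b : VB) :
    ((deadSet m bad b).card : ℝ) ≤ n b * (K / S * (1 + ∑ e, Λ e) ^ rank B b) := by
  have hK0 : 0 ≤ K := (Nat.cast_nonneg _).trans hK
  have hΛs : 0 ≤ ∑ e, Λ e := Finset.sum_nonneg fun e _ => hΛ e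
  induction b using hB.wf.induction with
  | _ b ih =>
    by_cases hb : ∀ a, ¬ B.Adj a b
    · rw [deadSet_eq_empty m bad hb]
      simp only [Finset.card_empty, Nat.cast_zero]
      positivity
    push Not at hb
    obtain ⟨a₀, ha₀⟩ := hb
    have hbI : b ∉ I := fun h => hI b h a₀ ha₀
    obtain ⟨r, hr⟩ : ∃ r, rank B b = r + 1 :=
      Nat.exists_eq_succ_of_ne_zero ((Nat.zero_le _).trans_lt (rank_lt_rank hB ha₀)).ne'
    have h1 : ((deadSet m bad b).card : ℝ) ≤ (Finset.univ.filter bad).card +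
      ∑ a : Parent B b, ∑ i ∈ deadSet m bad a.1, ((outSet m a.edge i).card : ℝ) := by
      exact_mod_cast card_deadSet_le_add m bad b
    -- An out-degree of Λ n_b/n_a turns a proportion of dead vertices over a into Λ times that
    -- proportion over b. Out-degrees of inputs are not controlled, but inputs have no parents and
    -- are never dead.
    have h2 : ∀ a : Parent B b, ∑ i ∈ deadSet m bad a.1, ((outSet m a.edge i).card : ℝ) ≤
        Λ a.edge * (n b * (K / S * (1 + ∑ e, Λ e) ^ r)) := by
      intro a
      by_cases ha : a.1 ∈ I
      · rw [deadSet_eq_empty m bad (hI a.1 ha), Finset.sum_empty]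
        have := hΛ a.edge
        positivity
      · have hna : 0 < (n a.1 : ℝ) := hS.trans_le (hn _ ha)
        refine (Finset.sum_le_card_nsmul _ _ _ fun i _ => hdeg a.edge ha i).trans ?_
        rw [nsmul_eq_mul]
        have h3 : (1 + ∑ e, Λ e) ^ rank B a.1 ≤ (1 + ∑ e, Λ e) ^ r :=
          pow_le_pow_right₀ (by linarith) (by have := rank_lt_rank hB a.2; omega)
        have h4 : ((deadSet m bad a.1).card : ℝ) ≤
            n a.1 * (K / S * (1 + ∑ e, Λ e) ^ r) := by
          refine (ih a.1 a.2).trans ?_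
          gcongr
        have h5 : 0 ≤ Λ a.edge * (n b / n a.1) := mul_nonneg (hΛ _) (by positivity)
        refine (mul_le_mul_of_nonneg_right h4 h5).trans_eq ?_
        field_simp
    have h3 : ∑ a : Parent B b, Λ a.edge ≤ ∑ e, Λ e := by
      have : Function.Injective fun a : Parent B b => a.edge := by
        intro a a' h
        exact Subtype.ext (congrArg (fun e : Edge B => e.1.1) h)
      rw [← Finset.sum_image (f := Λ) (g := fun a : Parent B b => a.edge)
        (s := Finset.univ) (fun _ _ _ _ h => this h)]
      exact Finset.sum_le_sum_of_subset_of_nonneg (Finset.subset_univ _) fun e _ _ => hΛ e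
    -- The heads of bad edges, at most K, are a proportion at most K/S of the layer since n_b ≥ S.
    have h4 : K ≤ n b * (K / S * (1 + ∑ e, Λ e) ^ r) := by
      have h5 : 1 ≤ (1 + ∑ e, Λ e) ^ r := one_le_pow₀ (by linarith)
      calc K = S * (K / S * 1) := by field_simp
        _ ≤ n b * (K / S * (1 + ∑ e, Λ e) ^ r) := by
          have := hn b hbI
          gcongr
    rw [hr, pow_succ]
    calc ((deadSet m bad b).card : ℝ) ≤ K + ∑ a : Parent B b,
          Λ a.edge * (n b * (K / S * (1 + ∑ e, Λ e) ^ r)) :=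
          h1.trans (add_le_add hK (Finset.sum_le_sum fun a _ => h2 a))
      _ ≤ n b * (K / S * (1 + ∑ e, Λ e) ^ r) +
          (∑ e, Λ e) * (n b * (K / S * (1 + ∑ e, Λ e) ^ r)) := by
          rw [← Finset.sum_mul]
          gcongr
      _ = _ := by ring

end Dead

/-- A dependent function may be prescribed along an injective map. -/
theorem exists_dependent_extension {ι κ : Type*} {β : ι → Type*} {g : κ → ι}
    (hg : Function.Injective g) (s : ∀ k, β (g k)) (d : ∀ i, β i) :
    ∃ A : ∀ i, β i, (∀ k, A (g k) = s k) ∧ ∀ i, i ∉ Set.range g → A i = d i := by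
  refine ⟨fun i => if h : ∃ k, g k = i then h.choose_spec ▸ s h.choose else d i, fun k => ?_,
    fun i hi => dif_neg hi⟩
  have h : ∃ k', g k' = g k := ⟨k, rfl⟩
  refine (dif_pos h).trans ?_
  have key : ∀ k' (e : g k' = g k), e ▸ s k' = s k := by
    intro k' e
    obtain rfl := hg e
    rfl
  exact key _ _

/-! ### Readouts averaging over copies. -/

namespace LiftedModule

variable {VB : Type u} [Fintype VB] {B : Digraph VB} {𝔹 : PerceptronModule.{u, v} B}
  {n₀ : 𝔹.I → ℕ} (𝔾 : LiftedModule.{u, v, w} 𝔹 n₀) {k : ℕ}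

/-- Every terminal vertex has exactly one type, so the double sum over types and fibres is a single
sum. -/
theorem readout_apply (a : 𝔾.Readout k) (y : ∀ p : 𝔾.V, 𝔹.Y (𝔾.π p)) (i : Fin k) :
    𝔾.readout a y i = ∑ p : 𝔾.Terminal, √(1 / (𝔾.fiberCard (𝔾.π p.1) : ℝ)) *
      inner ℝ (a (i, p)) (y p.1) := by
  have e := (Equiv.sigmaFiberEquiv fun p : 𝔾.Terminal => (⟨𝔾.π p.1, p.2⟩ : 𝔹.T)).sum_comp
    fun p : 𝔾.Terminal => √(1 / (𝔾.fiberCard (𝔾.π p.1) : ℝ)) * inner ℝ (a (i, p)) (y p.1)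
  rw [← e, Fintype.sum_sigma]
  show ∑ b : 𝔹.T, √(1 / (𝔾.fiberCard b.1 : ℝ)) *
    ∑ p : {p : 𝔾.Terminal // 𝔾.π p.1 = b.1}, inner ℝ (a (i, p.1)) (y p.1.1) = _
  refine Finset.sum_congr rfl fun b _ => ?_
  rw [Finset.mul_sum]
  refine Fintype.sum_equiv (Equiv.subtypeEquivRight fun p => ?_) _ _ fun p => ?_
  · exact ⟨fun h => Subtype.ext h, congrArg Subtype.val⟩
  · obtain ⟨p, hp⟩ := p
    obtain ⟨b, hb⟩ := b
    simp only at hp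
    subst hp
    rfl

theorem output_apply (θ : 𝔾.Theta k) (x : InputSpace 𝔹 n₀) (i : Fin k) :
    𝔾.output θ x i = ∑ p : 𝔾.Terminal, √(1 / (𝔾.fiberCard (𝔾.π p.1) : ℝ)) *
      inner ℝ (θ.snd (i, p)) (𝔾.forward θ.fst x p.1) :=
  𝔾.readout_apply _ _ _

variable {n : VB → ℕ} {hn : ∀ b : 𝔹.I, n b.1 = n₀ b} {m : Edge (fullLift B n) → Bool}

theorem sparseLift_fiberCard (b : VB) : (sparseLift (n₀ := n₀) n hn m).fiberCard b = n b := by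
  have : {a : Σ b : VB, Fin (n b) // a.1 = b} ≃ Fin (n b) := Equiv.sigmaSubtype b
  exact (Nat.card_congr this).trans (by simp)

/-- The readout of the sparse lift which averages over sets of copies. -/
theorem exists_averaged_readout {θ : 𝔾.Theta k}
    (A : ∀ v : 𝔾.V, Finset (Fin (n (𝔾.π v)))) (hA : ∀ v, (A v).Nonempty)
    (hinj : ∀ v v' : 𝔾.V, ∀ j ∈ A v, ∀ j' ∈ A v',
      (⟨𝔾.π v, j⟩ : Σ b : VB, Fin (n b)) = ⟨𝔾.π v', j'⟩ → v = v') :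
    ∃ a : (sparseLift (n₀ := n₀) n hn m).Readout k,
      ‖a‖ ^ 2 = ∑ i : Fin k, ∑ p : 𝔾.Terminal, ‖θ.snd (i, p)‖ ^ 2 * n (𝔾.π p.1) /
        ((A p.1).card * 𝔾.fiberCard (𝔾.π p.1)) ∧
      ∀ (w' : (sparseLift (n₀ := n₀) n hn m).Param) (x : InputSpace 𝔹 n₀) (ℓ : ℝ),
        (∀ v, ∀ j ∈ A v, ‖sparseForward w' x (𝔾.π v) j - 𝔾.forward θ.fst x v‖ ≤ ℓ) →
        ‖(sparseLift (n₀ := n₀) n hn m).output (WithLp.toLp 2 (w', a)) x - 𝔾.output θ x‖ ≤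
          𝔾.cStar θ * ℓ := by
  set κ := Fin k × (Σ p : 𝔾.Terminal, A p.1)
  set g : κ → Fin k × (sparseLift (n₀ := n₀) n hn m).Terminal := fun q =>
    (q.1, ⟨(⟨𝔾.π q.2.1.1, q.2.2.1⟩ : Σ b : VB, Fin (n b)), q.2.1.2⟩) with hgdef
  have hg : Function.Injective g := by
    rintro ⟨i, ⟨⟨v, hv⟩, ⟨j, hj⟩⟩⟩ ⟨i', ⟨⟨v', hv'⟩, ⟨j', hj'⟩⟩⟩ h
    obtain rfl : i = i' := congrArg Prod.fst h
    have h2 : (⟨𝔾.π v, j⟩ : Σ b : VB, Fin (n b)) = ⟨𝔾.π v', j'⟩ :=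
      congrArg (fun q => q.2.1) h
    obtain rfl := hinj v v' j hj j' hj' h2
    simp only [Sigma.mk.injEq, heq_eq_eq, true_and] at h2
    subst h2
    rfl
  -- The factor 1/#A averages over the copies, and √n/√#π⁻¹ converts the normalisation of the sparse
  -- lift into that of the reference. Squared and summed over the #A copies, this gives the factor
  -- n/(#A #π⁻¹) in the norm.
  set coef : 𝔾.Terminal → ℝ := fun p =>
    √(n (𝔾.π p.1)) / ((A p.1).card * √(𝔾.fiberCard (𝔾.π p.1))) with hcoef
  obtain ⟨a, ha, ha0⟩ := exists_dependent_extension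
    (β := fun p : Fin k × (sparseLift (n₀ := n₀) n hn m).Terminal =>
      𝔹.Y ((sparseLift (n₀ := n₀) n hn m).π p.2.1)) hg
    (fun q => (coef q.2.1 • θ.snd (q.1, q.2.1) : 𝔹.Y (𝔾.π q.2.1.1))) (fun _ => 0)
  have hcard : ∀ v, (0 : ℝ) < (A v).card := fun v => by
    exact_mod_cast (hA v).card_pos
  have hnpos : ∀ v : 𝔾.V, (0 : ℝ) < n (𝔾.π v) := fun v => by
    obtain ⟨j, _⟩ := hA v
    exact_mod_cast (Nat.zero_le _).trans_lt j.2
  have hfc : ∀ v : 𝔾.V, (0 : ℝ) < 𝔾.fiberCard (𝔾.π v) := fun v => by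
    exact_mod_cast 𝔾.fiberCard_pos v
  refine ⟨WithLp.toLp 2 a, ?_, ?_⟩
  · rw [PiLp.norm_sq_eq_of_L2]
    rw [← Fintype.sum_of_injective g hg (fun q => coef q.2.1 ^ 2 * ‖θ.snd (q.1, q.2.1)‖ ^ 2) _
      (fun p hp => by
        show ‖a p‖ ^ 2 = 0
        rw [ha0 p hp]
        simp) (fun q => by
        show _ = ‖a (g q)‖ ^ 2
        rw [ha q]
        have : ‖coef q.2.1 • θ.snd (q.1, q.2.1)‖ ^ 2 =
          coef q.2.1 ^ 2 * ‖θ.snd (q.1, q.2.1)‖ ^ 2 := by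
          rw [norm_smul, mul_pow, Real.norm_eq_abs, sq_abs]
        exact this.symm)]
    rw [Fintype.sum_prod_type]
    refine Finset.sum_congr rfl fun i _ => ?_
    rw [Fintype.sum_sigma]
    refine Finset.sum_congr rfl fun p _ => ?_
    show ∑ _j : A p.1, coef p ^ 2 * ‖θ.snd (i, p)‖ ^ 2 = _
    rw [Finset.sum_const, Finset.card_univ, Fintype.card_coe, nsmul_eq_mul]
    have h1 := hcard p.1
    have h2 := hfc p.1
    simp only [hcoef]
    rw [div_pow, mul_pow, Real.sq_sqrt (hnpos p.1).le, Real.sq_sqrt h2.le]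
    field_simp
  · intro w' x ℓ hℓ
    have hi : ∀ i, |((sparseLift (n₀ := n₀) n hn m).output
        (WithLp.toLp 2 (w', WithLp.toLp 2 a)) x - 𝔾.output θ x) i| ≤
          ∑ p : 𝔾.Terminal, ‖θ.snd (i, p)‖ / √(𝔾.fiberCard (𝔾.π p.1) : ℝ) * ℓ := by
      intro i
      have e1 : (sparseLift (n₀ := n₀) n hn m).output (WithLp.toLp 2 (w', WithLp.toLp 2 a)) x i =
          ∑ p : 𝔾.Terminal, ∑ j : A p.1, √(1 / (𝔾.fiberCard (𝔾.π p.1) : ℝ)) *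
            ((1 / ((A p.1).card : ℝ)) *
              inner ℝ (θ.snd (i, p)) (sparseForward w' x (𝔾.π p.1) j.1)) := by
        rw [output_apply, ← Fintype.sum_sigma']
        symm
        refine Fintype.sum_of_injective (fun q : Σ p : 𝔾.Terminal, A p.1 => (g (i, q)).2)
          (fun q q' h => ?_) _ _ (fun p hp => ?_) fun q => ?_
        · exact congrArg Prod.snd (hg (Prod.ext rfl h : g (i, q) = g (i, q')))
        · have : a (i, p) = 0 := ha0 (i, p) (by
            rintro ⟨⟨i', q⟩, hq⟩
            exact hp ⟨q, congrArg Prod.snd hq⟩)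
          simp [this]
        · have h1 : a (i, (g (i, q)).2) = (coef q.1 • θ.snd (i, q.1) : 𝔹.Y (𝔾.π q.1.1)) :=
            ha (i, q)
          have h2 : (sparseLift (n₀ := n₀) n hn m).fiberCard
              ((sparseLift (n₀ := n₀) n hn m).π (g (i, q)).2.1) = n (𝔾.π q.1.1) :=
            sparseLift_fiberCard _
          rw [h2]
          show _ = √(1 / (n (𝔾.π q.1.1) : ℝ)) * inner ℝ (a (i, (g (i, q)).2))
            (sparseForward w' x (𝔾.π q.1.1) q.2.1)
          rw [h1]
          have h3 : inner ℝ (coef q.1 • θ.snd (i, q.1)) (sparseForward w' x (𝔾.π q.1.1) q.2.1) =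
            coef q.1 * inner ℝ (θ.snd (i, q.1)) (sparseForward w' x (𝔾.π q.1.1) q.2.1) :=
              real_inner_smul_left _ _ _
          refine Eq.trans ?_ (congrArg _ h3).symm
          simp only [hcoef]
          have h4 := Real.sqrt_pos.2 (hnpos q.1.1)
          have h5 := Real.sqrt_pos.2 (hfc q.1.1)
          have h6 := hcard q.1.1
          rw [Real.sqrt_div zero_le_one, Real.sqrt_div zero_le_one, Real.sqrt_one]
          field_simp
      rw [PiLp.sub_apply, e1, output_apply, ← Finset.sum_sub_distrib]
      refine (Finset.abs_sum_le_sum_abs _ _).trans (Finset.sum_le_sum fun p _ => ?_)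
      have h1 := hcard p.1
      have h5 := Real.sqrt_pos.2 (hfc p.1)
      have e2 : ∑ j : A p.1, √(1 / (𝔾.fiberCard (𝔾.π p.1) : ℝ)) *
            ((1 / ((A p.1).card : ℝ)) *
              inner ℝ (θ.snd (i, p)) (sparseForward w' x (𝔾.π p.1) j.1)) -
            √(1 / (𝔾.fiberCard (𝔾.π p.1) : ℝ)) *
              inner ℝ (θ.snd (i, p)) (𝔾.forward θ.fst x p.1) =
          ∑ j : A p.1, √(1 / (𝔾.fiberCard (𝔾.π p.1) : ℝ)) * ((1 / ((A p.1).card : ℝ)) *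
            inner ℝ (θ.snd (i, p))
              (sparseForward w' x (𝔾.π p.1) j.1 - 𝔾.forward θ.fst x p.1)) := by
        simp only [inner_sub_right, mul_sub, Finset.sum_sub_distrib, Finset.sum_const,
          Finset.card_univ, Fintype.card_coe, nsmul_eq_mul]
        field_simp
      rw [e2]
      refine (Finset.abs_sum_le_sum_abs _ _).trans ?_
      refine (Finset.sum_le_card_nsmul _ _ (√(1 / (𝔾.fiberCard (𝔾.π p.1) : ℝ)) *
        ((1 / ((A p.1).card : ℝ)) * (‖θ.snd (i, p)‖ * ℓ))) fun j _ => ?_).trans_eq ?_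
      · rw [abs_mul, abs_mul, abs_of_nonneg (Real.sqrt_nonneg _), abs_of_pos (one_div_pos.2 h1)]
        gcongr
        refine (abs_real_inner_le_norm _ _).trans ?_
        gcongr
        exact hℓ p.1 j.1 j.2
      · rw [Finset.card_univ, Fintype.card_coe, nsmul_eq_mul, Real.sqrt_div zero_le_one,
          Real.sqrt_one]
        field_simp
    set r := (sparseLift (n₀ := n₀) n hn m).output
        (WithLp.toLp 2 (w', WithLp.toLp 2 a)) x - 𝔾.output θ x
    -- The Euclidean norm is bounded by the sum of coordinates because C⋆ is a sum over outputs.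
    have h1 : ‖r‖ ≤ ∑ i, |r i| := by
      rw [EuclideanSpace.norm_eq]
      refine Real.sqrt_le_iff.2 ⟨Finset.sum_nonneg fun _ _ => abs_nonneg _, ?_⟩
      simp only [Real.norm_eq_abs]
      exact Finset.sum_sq_le_sq_sum_of_nonneg fun _ _ => abs_nonneg _
    refine h1.trans ((Finset.sum_le_sum fun i _ => hi i).trans_eq ?_)
    rw [cStar, Finset.sum_mul]
    exact Finset.sum_congr rfl fun i _ => (Finset.sum_mul _ _ _).symm

end LiftedModule

/-! ### Few edges can move far. -/

section Bad

variable {VB : Type u} [Fintype VB] {B : Digraph VB} {𝔹 : PerceptronModule.{u, v} B}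
  {n₀ : 𝔹.I → ℕ} {n : VB → ℕ} {hn : ∀ b : 𝔹.I, n b.1 = n₀ b} {m : Edge (fullLift B n) → Bool}
  {w : ∀ e : Edge (fullLift B n), 𝔹.W ((fullLift_isHom n).edge e)}

/-- The edges of the sparse lift whose weight moved by at least `ρ`. -/
def IsMoved (w : ∀ e : Edge (fullLift B n), 𝔹.W ((fullLift_isHom n).edge e))
    (w' : (sparseLift (n₀ := n₀) n hn m).Param) (ρ : ℝ≥0∞) (e : Edge (fullLift B n)) : Prop :=
  ∃ h : m e = true, ρ ≤ ‖sparseWeight w' e h - w e‖ₑ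

/-- A Chebyshev bound: each moved edge contributes at least ρ² to the squared distance between the
parameters. Working in [0, ∞] includes ρ = ∞, which forces the count to be zero. -/
theorem card_isMoved_mul_le {k : ℕ} (p : (sparseLift (n₀ := n₀) n hn m).Theta k) (ρ : ℝ≥0∞) :
    ((Finset.univ.filter (IsMoved w p.fst ρ)).card : ℝ≥0∞) * ρ ^ 2 ≤
      ENNReal.ofReal (‖p - sparseInit k n hn m w‖ ^ 2) := by
  set d := (p - sparseInit k n hn m w).fst with hd
  have h1 : ‖d‖ ^ 2 ≤ ‖p - sparseInit k n hn m w‖ ^ 2 := by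
    gcongr; exact WithLp.norm_fst_le _ _
  refine le_trans ?_ (ENNReal.ofReal_le_ofReal h1)
  rw [PiLp.norm_sq_eq_of_L2, ENNReal.ofReal_sum_of_nonneg fun _ _ => by positivity]
  have h2 : ∀ e, ENNReal.ofReal (‖d e‖ ^ 2) = ‖d e‖ₑ ^ 2 := fun e => by
    rw [ENNReal.ofReal_pow (norm_nonneg _), ofReal_norm]
  simp_rw [h2]
  set term : Edge (fullLift B n) → ℝ≥0∞ := fun e =>
    if h : m e = true then ‖sparseWeight p.fst e h - w e‖ₑ ^ 2 else 0 with hterm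
  have h3 : ∑ e : Edge (sparseLift (n₀ := n₀) n hn m).G, ‖d e‖ₑ ^ 2 = ∑ e, term e := by
    refine Fintype.sum_of_injective (fun e : Edge (sparseGraph n m) =>
      (⟨e.1, e.2.1⟩ : Edge (fullLift B n))) ?_ _ _ ?_ ?_
    · intro e e' h
      exact Subtype.ext (congrArg (fun e : Edge (fullLift B n) => e.1) h)
    · intro e he
      refine dif_neg fun h => he ⟨⟨e.1, e.2, h⟩, rfl⟩
    · intro e
      have h5 : m ⟨e.1, e.2.1⟩ = true := e.2.2
      rw [hterm]
      simp only [h5, dite_true]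
      rfl
  rw [h3, ← nsmul_eq_mul]
  refine (Finset.card_nsmul_le_sum (Finset.univ.filter (IsMoved w p.fst ρ)) term _
    fun e he => ?_).trans (Finset.sum_le_sum_of_subset (Finset.subset_univ _))
  obtain ⟨h, hρ⟩ := (Finset.mem_filter.1 he).2
  rw [hterm]
  simp only [h, dite_true]
  gcongr

end Bad

/-! ### From numerous copies to gradient domination. -/

namespace LiftedModule

variable {VB : Type u} [Fintype VB] {B : Digraph VB} {𝔹 : PerceptronModule.{u, v} B}
  {n₀ : 𝔹.I → ℕ} {𝔾 : LiftedModule.{u, v, w} 𝔹 n₀} {n : VB → ℕ}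
  {hn : ∀ b : 𝔹.I, n b.1 = n₀ b} {J : ∀ v : 𝔾.V, Set (Fin (n (𝔾.π v)))}
  {m : Edge (fullLift B n) → Bool}
  {w : ∀ e : Edge (fullLift B n), 𝔹.W ((fullLift_isHom n).edge e)}
  {k : ℕ} {X : Set (InputSpace 𝔹 n₀)} {D : Measure X} [IsProbabilityMeasure D]
  {f : X → EuclideanSpace ℝ (Fin k)} {ε : ℝ} {θ : 𝔾.Theta k}

/-- Below the threshold `η`, there is a radius which controls all the weights of surviving copies
and for which the continuity constant is small. -/
theorem exists_radius (hη0 : 0 < 𝔾.etaStar D f ε θ)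
    (w' : (sparseLift (n₀ := n₀) n hn m).Param) :
    ∃ η : ℝ≥0, 𝔾.continuityConstant θ.fst X η <
      ENNReal.ofReal (√((ε + 𝔾.loss D f θ) / 2) - √(𝔾.loss D f θ)) /
        ENNReal.ofReal (𝔾.cStar θ) ∧
      ∀ {u v : 𝔾.V} (h : 𝔾.G.Adj u v) (i : Fin (n (𝔾.π u))) (j : Fin (n (𝔾.π v)))
      (hm : m (𝔾.liftEdge h i j) = true),
        ¬ IsMoved w w' (𝔾.etaStar D f ε θ / 2) (𝔾.liftEdge h i j) →
      ‖𝔾.liftWeight w h i j - θ.fst ⟨(u, v), h⟩‖ₑ ≤ 𝔾.etaStar D f ε θ / 2 →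
      ‖sparseLiftWeight w' h i j hm - θ.fst ⟨(u, v), h⟩‖ₑ ≤ η := by
  set η₀ := 𝔾.etaStar D f ε θ with hη₀
  -- The supremum defining η need not be attained. The finitely many deviations strictly below it
  -- have a maximum still strictly below, hence below an admissible radius; the others are replaced
  -- by 0 and ruled out for unmoved edges by `h2`.
  set val : (Σ e : Edge 𝔾.G, Fin (n (𝔾.π e.1.1)) × Fin (n (𝔾.π e.1.2))) → ℝ≥0∞ := fun q =>
    if hm : m (𝔾.liftEdge q.1.2 q.2.1 q.2.2) = true then
      if ‖sparseLiftWeight w' q.1.2 q.2.1 q.2.2 hm - θ.fst q.1‖ₑ < η₀ then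
        ‖sparseLiftWeight w' q.1.2 q.2.1 q.2.2 hm - θ.fst q.1‖ₑ else 0
    else 0 with hval
  have h1 : Finset.univ.sup val < η₀ := by
    rw [Finset.sup_lt_iff hη0]
    intro q _
    simp only [hval]
    split_ifs <;> assumption
  rw [hη₀, etaStar, lt_iSup_iff] at h1
  obtain ⟨η, h1⟩ := h1
  rw [lt_iSup_iff] at h1
  obtain ⟨_, h1⟩ := h1
  rw [lt_iSup_iff] at h1
  obtain ⟨hL, h1⟩ := h1
  refine ⟨η, hL, fun {u v} h i j hm hmv hw => ?_⟩
  refine le_trans ?_ h1.le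
  refine le_trans ?_ (Finset.le_sup (f := val) (Finset.mem_univ ⟨⟨(u, v), h⟩, (i, j)⟩))
  have h2 : ‖sparseLiftWeight w' h i j hm - θ.fst ⟨(u, v), h⟩‖ₑ < η₀ := by
    have h3 : ‖sparseLiftWeight w' h i j hm - 𝔾.liftWeight w h i j‖ₑ < η₀ / 2 := by
      by_contra hcon
      exact hmv ⟨hm, not_lt.1 hcon⟩
    have h4 : ‖sparseLiftWeight w' h i j hm - θ.fst ⟨(u, v), h⟩‖ₑ ≤
        ‖sparseLiftWeight w' h i j hm - 𝔾.liftWeight w h i j‖ₑ +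
          ‖𝔾.liftWeight w h i j - θ.fst ⟨(u, v), h⟩‖ₑ := by
      rw [← sub_add_sub_cancel _ (𝔾.liftWeight w h i j) _]
      exact enorm_add_le _ _
    refine h4.trans_lt ((ENNReal.add_lt_add_of_lt_of_le (by simp) h3 hw).trans_eq
      (ENNReal.add_halves _))
  simp only [hval, hm, h2, dite_true, if_true]
  exact le_rfl

/-- If the copies of all vertices are numerous enough to survive any small perturbation of the
weights, then the convergence criterion holds. -/
theorem convergenceCriterion_of_copies (h𝔹 : 𝔹.IsC1) (hX : IsCompact X) (hf : MemLp f 2 D)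
    (hε : 𝔾.loss D f θ < ε) (hεL : ε < normSqD D f) (hJ : 𝔾.IsLabelling J)
    {α : 𝔾.V → ℝ} (hα : ∀ v, 0 < α v) (hnpos : ∀ v, 0 < n (𝔾.π v))
    (hcopies : ∀ v, α v * n (𝔾.π v) ≤ ((Finset.univ.filter fun j =>
      𝔾.IsCopy hn J θ.fst (𝔾.etaStar D f ε θ / 2) m w v j).card : ℝ))
    {c K : ℝ} (hc : 0 < c)
    (hc2 : ∑ i : Fin k, ∑ p : 𝔾.Terminal, 2 * ‖θ.snd (i, p)‖ ^ 2 /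
      (α p.1 * 𝔾.fiberCard (𝔾.π p.1)) ≤ c ^ 2)
    (hK : ∀ q : ℕ, (q : ℝ≥0∞) * (𝔾.etaStar D f ε θ / 2) ^ 2 ≤
      ENNReal.ofReal ((2 * c * normSqD D f / (ε - 𝔾.loss D f θ)) ^ 2) → (q : ℝ) ≤ K)
    (hdead : ∀ bad : Edge (fullLift B n) → Prop, ((Finset.univ.filter bad).card : ℝ) ≤ K →
      ∀ v, ((deadSet (m · = true) bad (𝔾.π v)).card : ℝ) ≤ n (𝔾.π v) * (α v / 2)) :
    ConvergenceCriterion ((sparseLift n hn m).loss D f) (sparseInit k n hn m w) ε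
      (ENNReal.ofReal (3 / (c ^ 2 * normSqD D f ^ 2))) := by
  set ε₀ := 𝔾.loss D f θ with hε₀
  have hε₀0 : 0 ≤ ε₀ := 𝔾.loss_nonneg D f θ
  have hL0 : (sparseLift n hn m).loss D f (sparseInit k n hn m w) = normSqD D f :=
    loss_of_snd_eq_zero _ D f rfl
  have hη0 : 0 < 𝔾.etaStar D f ε θ := 𝔾.etaStar_pos h𝔹 hX hε
  rw [← hL0]
  -- The midpoint ε' of ε₀ and ε leaves half of the gap to the averaging error and half to the flow,
  -- whence the radius 2c‖f⋆‖²/(ε - ε₀).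
  refine convergenceCriterion_of_gradient_domination (ε' := (ε + ε₀) / 2)
    ((sparseLift n hn m).differentiable_loss h𝔹 hX hf) (by linarith) (by linarith) hc
    (by linarith) fun p hp => ?_
  rw [hL0] at hp
  have hR : c * normSqD D f / (ε - (ε + ε₀) / 2) = 2 * c * normSqD D f / (ε - ε₀) := by
    have : ε - (ε + ε₀) / 2 = (ε - ε₀) / 2 := by ring
    rw [this]
    field_simp
  rw [hR] at hp
  set bad := IsMoved w p.fst (𝔾.etaStar D f ε θ / 2) with hbad
  have hbadK : ((Finset.univ.filter bad).card : ℝ) ≤ K := by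
    refine hK _ ((card_isMoved_mul_le p _).trans (ENNReal.ofReal_le_ofReal ?_))
    gcongr
  obtain ⟨η, hL, hη⟩ := exists_radius (𝔾 := 𝔾) (w := w) hη0 p.fst
  set A : ∀ v : 𝔾.V, Finset (Fin (n (𝔾.π v))) := fun v => Finset.univ.filter fun j =>
    𝔾.IsCopy hn J θ.fst (𝔾.etaStar D f ε θ / 2) m w v j ∧
      ¬ Dead (m · = true) bad ⟨𝔾.π v, j⟩ with hA
  have hAcard : ∀ v, α v * n (𝔾.π v) / 2 ≤ (A v).card := by
    intro v
    have h1 : (Finset.univ.filter fun j =>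
      𝔾.IsCopy hn J θ.fst (𝔾.etaStar D f ε θ / 2) m w v j) ⊆
        A v ∪ deadSet (m · = true) bad (𝔾.π v) := by
      intro j hj
      simp only [hA, deadSet, Finset.mem_union, Finset.mem_filter, Finset.mem_univ,
        true_and] at hj ⊢
      tauto
    have h2 := (Finset.card_le_card h1).trans (Finset.card_union_le _ _)
    have h3 : ((Finset.univ.filter fun j =>
      𝔾.IsCopy hn J θ.fst (𝔾.etaStar D f ε θ / 2) m w v j).card : ℝ) ≤
        (A v).card + (deadSet (m · = true) bad (𝔾.π v)).card := by exact_mod_cast h2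
    have h4 := hcopies v
    have h5 := hdead bad hbadK v
    linarith
  have hApos : ∀ v, (0 : ℝ) < (A v).card := fun v => by
    refine lt_of_lt_of_le ?_ (hAcard v)
    have := hα v
    have : (0 : ℝ) < n (𝔾.π v) := by exact_mod_cast hnpos v
    positivity
  obtain ⟨a, ha, hout⟩ := 𝔾.exists_averaged_readout (hn := hn) (m := m) (θ := θ) A
    (fun v => Finset.card_pos.1 (by exact_mod_cast hApos v))
    (fun v v' j hj j' hj' h => IsCopy.unique hJ (Finset.mem_filter.1 hj).2.1
      (Finset.mem_filter.1 hj').2.1 h)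
  -- The factor 2 in c² pays for the loss of at most half of the α n copies.
  have hac : ‖a‖ ≤ c := by
    refine abs_le_of_sq_le_sq' ?_ hc.le |>.2
    rw [ha]
    refine le_trans (Finset.sum_le_sum fun i _ => Finset.sum_le_sum fun q _ => ?_) hc2
    have h1 := hApos q.1
    have h2 := hα q.1
    have h3 : (0 : ℝ) < 𝔾.fiberCard (𝔾.π q.1) := by exact_mod_cast 𝔾.fiberCard_pos q.1
    have h4 := hAcard q.1
    rw [div_le_div_iff₀ (by positivity) (by positivity)]
    have h5 : n (𝔾.π q.1) * α q.1 ≤ 2 * (A q.1).card := by linarith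
    have h6 : 0 ≤ ‖θ.snd (i, q)‖ ^ 2 * 𝔾.fiberCard (𝔾.π q.1) := by positivity
    nlinarith [mul_le_mul_of_nonneg_left h5 h6]
  have hloss : (sparseLift n hn m).loss D f (WithLp.toLp 2 (p.fst, a)) ≤ (ε + ε₀) / 2 := by
    set gap := √((ε + ε₀) / 2) - √ε₀ with hgap
    have hgap0 : 0 < gap := sub_pos.2 (Real.sqrt_lt_sqrt hε₀0 (by linarith))
    have hLtop : 𝔾.continuityConstant θ.fst X η ≠ ⊤ := (hL.trans_le le_top).ne
    set ℓ := (𝔾.continuityConstant θ.fst X η).toReal with hℓ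
    have hcs : 𝔾.cStar θ * ℓ ≤ gap := by
      -- If C⋆ = 0 the threshold on L(η) is ∞ and only says that L(η) is finite, but then the
      -- product vanishes.
      rcases (𝔾.cStar_nonneg (θ := θ)).eq_or_lt with h0 | h0
      · rw [← h0, zero_mul]; exact hgap0.le
      · rw [← ENNReal.ofReal_div_of_pos h0] at hL
        have h1 := ENNReal.toReal_mono ENNReal.ofReal_ne_top hL.le
        rw [ENNReal.toReal_ofReal (by positivity)] at h1
        rw [mul_comm]
        exact (le_div_iff₀ h0).1 h1
    have h1 := integral_norm_sq_le_of_norm_sub_le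
      (memLp_residual h𝔹 hX hf θ)
      (memLp_residual h𝔹 hX hf
        (WithLp.toLp 2 (p.fst, a) : (sparseLift (n₀ := n₀) n hn m).Theta k)) (b := gap)
      (fun x => by
        rw [sub_sub_sub_cancel_right]
        refine (hout p.fst x.1 ℓ fun v j hj => ?_).trans hcs
        have h2 := (Finset.mem_filter.1 hj).2
        have h3 := h2.1.enorm_forward_sub_le hJ p.fst (bad := bad) hη x.1 h2.2
        have h4 : 𝔾.toModule.deviation θ.fst (𝔾.pullInput x.1) η v ≤
            𝔾.continuityConstant θ.fst X η :=
          le_iSup_of_le x.1 (le_iSup_of_le x.2 (le_iSup_of_le v le_rfl))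
        have h5 := ENNReal.toReal_mono hLtop (h3.trans h4)
        rwa [toReal_enorm] at h5)
    refine h1.trans_eq ?_
    show (√ε₀ + gap) ^ 2 = _
    rw [hgap, add_sub_cancel, Real.sq_sqrt (by linarith)]
  have hconv := (sparseLift n hn m).loss_sub_le_norm_gradient_mul h𝔹 hX hf p a
  have hnorm : ‖a - p.snd‖ ≤ ‖p - sparseInit k n hn m w‖ + c := by
    have h1 : ‖p.snd‖ ≤ ‖p - sparseInit k n hn m w‖ := by
      have h2 := WithLp.norm_snd_le _ (p - sparseInit k n hn m w)
      rwa [show (p - sparseInit k n hn m w).snd = p.snd from sub_zero p.snd] at h2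
    linarith [norm_sub_le a p.snd]
  have := mul_le_mul_of_nonneg_left hnorm
    (norm_nonneg (gradient ((sparseLift n hn m).loss D f) p))
  linarith

end LiftedModule

/-! ### Chernoff bounds for conditionally independent blocks. -/

section ProductMeasure

variable {ι : Type*} [Fintype ι]

/-- A product of two product measures is a product of product measures. -/
theorem measurePreserving_zip {Ω Ω' : ι → Type*} [∀ i, MeasurableSpace (Ω i)]
    [∀ i, MeasurableSpace (Ω' i)] (μ : ∀ i, Measure (Ω i)) (ν : ∀ i, Measure (Ω' i))
    [∀ i, IsProbabilityMeasure (μ i)] [∀ i, IsProbabilityMeasure (ν i)] :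
    MeasurePreserving (fun (p : (∀ i, Ω i) × (∀ i, Ω' i)) i => (p.1 i, p.2 i))
      ((Measure.pi μ).prod (Measure.pi ν)) (Measure.pi fun i => (μ i).prod (ν i)) := by
  have hm : Measurable (fun (p : (∀ i, Ω i) × (∀ i, Ω' i)) i => (p.1 i, p.2 i)) := by
    fun_prop
  refine ⟨hm, ?_⟩
  symm
  refine Measure.pi_eq_generateFrom
    (C := fun i => Set.image2 (· ×ˢ ·) {s : Set (Ω i) | MeasurableSet s}
      {t : Set (Ω' i) | MeasurableSet t})
    (fun i => generateFrom_prod) (fun i => isPiSystem_prod) (fun i => ?_) fun s hs => ?_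
  · refine ⟨fun _ => Set.univ, fun _ => ⟨Set.univ, MeasurableSet.univ, Set.univ,
      MeasurableSet.univ, Set.univ_prod_univ⟩, fun _ => measure_lt_top _ _, Set.iUnion_const _⟩
  · choose a ha b hb hab using hs
    have h1 : MeasurableSet (Set.univ.pi s) := MeasurableSet.univ_pi fun i => by
      rw [← hab i]; exact (ha i).prod (hb i)
    rw [Measure.map_apply hm h1]
    have h2 : (fun (p : (∀ i, Ω i) × (∀ i, Ω' i)) i => (p.1 i, p.2 i)) ⁻¹' Set.univ.pi s =
        Set.univ.pi a ×ˢ Set.univ.pi b := by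
      ext p
      simp only [Set.mem_preimage, Set.mem_pi, Set.mem_univ, true_implies, Set.mem_prod,
        ← hab, ← forall_and]
    rw [h2, Measure.prod_prod, Measure.pi_pi, Measure.pi_pi, ← Finset.prod_mul_distrib]
    refine Finset.prod_congr rfl fun i _ => ?_
    rw [← hab i, Measure.prod_prod]

variable [DecidableEq ι] {Ω : ι → Type*} [∀ i, MeasurableSpace (Ω i)] (μ : ∀ i, Measure (Ω i))
  [∀ i, IsProbabilityMeasure (μ i)] {κ : Type*}

/-- A product of functions, each depending on its own block of coordinates given the others, has
small integral if each function has small integral over its block. -/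
theorem lintegral_mul_prod_le (T : Finset κ) {E : κ → Finset ι} {g : κ → (∀ i, Ω i) → ℝ≥0∞}
    {h : (∀ i, Ω i) → ℝ≥0∞} (hg : ∀ j, Measurable (g j)) (hh : Measurable h) {q : ℝ≥0∞}
    (hdep : ∀ j ∈ T, ∀ i ∈ T, i ≠ j → ∀ x (y : ∀ i : E j, Ω i),
      g i (Function.updateFinset x (E j) y) = g i x)
    (hhdep : ∀ j ∈ T, ∀ x (y : ∀ i : E j, Ω i), h (Function.updateFinset x (E j) y) = h x)
    (hq : ∀ j ∈ T, ∀ x, h x ≠ 0 → ∫⁻ y : ∀ i : E j, Ω i, g j (Function.updateFinset x (E j) y)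
      ∂Measure.pi (fun i : E j => μ i) ≤ q) :
    ∫⁻ x, h x * ∏ j ∈ T, g j x ∂Measure.pi μ ≤ q ^ T.card * ∫⁻ x, h x ∂Measure.pi μ := by
  induction T using Finset.induction_on with
  | empty => simp
  | insert j T hj ih =>
    have ih' := ih
      (fun a ha b hb => hdep a (Finset.mem_insert_of_mem ha) b (Finset.mem_insert_of_mem hb))
      (fun a ha => hhdep a (Finset.mem_insert_of_mem ha))
      (fun a ha => hq a (Finset.mem_insert_of_mem ha))
    have hm : Measurable fun x => ∏ i ∈ T, g i x := Finset.measurable_fun_prod T fun i _ => hg i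
    rw [Finset.card_insert_of_notMem hj, pow_succ', mul_assoc]
    refine le_trans ?_ (mul_le_mul_right ih' q)
    have hhm : Measurable fun x => h x * ∏ i ∈ T, g i x := hh.mul hm
    rw [← lintegral_const_mul q hhm]
    simp only [Finset.prod_insert hj]
    -- The block of j is integrated first. The other factors do not depend on it, so g_j is replaced
    -- by q; where h vanishes no bound on g_j is needed.
    refine lintegral_le_of_lmarginal_le (E j) (hh.mul ((hg j).mul hm))
      (hhm.const_mul q) fun x => ?_
    have hj' := Finset.mem_insert_self j T
    have h1 : ∀ y : ∀ i : E j, Ω i, ∏ i ∈ T, g i (Function.updateFinset x (E j) y) =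
        ∏ i ∈ T, g i x := fun y => Finset.prod_congr rfl fun i hi =>
      hdep j hj' i (Finset.mem_insert_of_mem hi) (fun e => hj (e ▸ hi)) x y
    simp only [lmarginal, h1, hhdep j hj']
    rcases eq_or_ne (h x) 0 with h0 | h0
    · simp [h0]
    have h2 : ∀ y : ∀ i : E j, Ω i, h x * (g j (Function.updateFinset x (E j) y) *
        ∏ i ∈ T, g i x) = (h x * ∏ i ∈ T, g i x) * g j (Function.updateFinset x (E j) y) :=
      fun y => by ring
    simp only [h2]
    have h3 : Measurable fun y : ∀ i : E j, Ω i => g j (Function.updateFinset x (E j) y) :=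
      (hg j).comp measurable_updateFinset
    rw [lintegral_const_mul _ h3, lintegral_const,
      measure_univ, mul_one, mul_comm q]
    exact mul_le_mul_right (hq j hj' x h0) _

/-- A Chernoff bound for a number of events, each depending on its own block of coordinates. -/
theorem measure_le_exp_of_blocks (T : Finset κ) {E : κ → Finset ι} {A : κ → Set (∀ i, Ω i)}
    {H : Set (∀ i, Ω i)} (hA : ∀ j, MeasurableSet (A j)) (hH : MeasurableSet H) {s a t : ℝ}
    (hdep : ∀ j ∈ T, ∀ i ∈ T, i ≠ j → ∀ x (y : ∀ i : E j, Ω i),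
      Function.updateFinset x (E j) y ∈ A i ↔ x ∈ A i)
    (hHdep : ∀ j ∈ T, ∀ x (y : ∀ i : E j, Ω i), Function.updateFinset x (E j) y ∈ H ↔ x ∈ H)
    (ha : ∀ j ∈ T, ∀ x ∈ H, (Real.exp s - 1) * (Measure.pi (fun i : E j => μ i)).real
      {y : ∀ i : E j, Ω i | Function.updateFinset x (E j) y ∈ A j} ≤ a) :
    Measure.pi μ {x | x ∈ H ∧ t ≤ s * (T.filter fun j => x ∈ A j).card} ≤
      ENNReal.ofReal (Real.exp (a * T.card - t)) := by
  set g : κ → (∀ i, Ω i) → ℝ≥0∞ := fun j x =>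
    if x ∈ A j then ENNReal.ofReal (Real.exp s) else 1 with hgdef
  have hg : ∀ j, Measurable (g j) := fun j =>
    Measurable.ite (hA j) measurable_const measurable_const
  set h : (∀ i, Ω i) → ℝ≥0∞ := H.indicator (fun _ => 1) with hhdef
  have hh : Measurable h := measurable_const.indicator hH
  have key := lintegral_mul_prod_le μ T (E := E) hg hh (q := ENNReal.ofReal (Real.exp a))
    (fun j hj i hi hij x y => by simp only [hgdef, hdep j hj i hi hij x y])
    (fun j hj x y => by simp only [hhdef, Set.indicator, hHdep j hj x y])
    (fun j hj x hx => by
      have hxH : x ∈ H := by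
        by_contra hcon
        exact hx (Set.indicator_of_notMem hcon _)
      set S := {y : ∀ i : E j, Ω i | Function.updateFinset x (E j) y ∈ A j} with hS
      have hSm : MeasurableSet S := measurable_updateFinset (hA j)
      set P := Measure.pi (fun i : E j => μ i) with hP
      -- On H, the conditional expectation of exp(s 1_A) is 1 + (exp s - 1) P(A) ≤ 1 + a ≤ exp a.
      -- The sign of s is free: s = 1 bounds out-degrees from above, s = -1 bounds numbers of copies
      -- from below.
      have e1 : ∀ y, g j (Function.updateFinset x (E j) y) =
          S.indicator (fun _ => ENNReal.ofReal (Real.exp s)) y + Sᶜ.indicator (fun _ => 1) y := by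
        intro y
        by_cases hy : y ∈ S
        · have : Function.updateFinset x (E j) y ∈ A j := hy
          simp [hgdef, this, hy]
        · have : Function.updateFinset x (E j) y ∉ A j := hy
          simp [hgdef, this, hy]
      simp only [e1]
      rw [lintegral_add_left (measurable_const.indicator hSm), lintegral_indicator_const hSm,
        lintegral_indicator_const hSm.compl, one_mul, ← ofReal_measureReal, ← ofReal_measureReal,
        ← ENNReal.ofReal_mul (Real.exp_pos _).le,
        ← ENNReal.ofReal_add (by positivity) (by positivity), probReal_compl_eq_one_sub hSm]
      apply ENNReal.ofReal_le_ofReal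
      have h1 := ha j hj x hxH
      have h2 := Real.add_one_le_exp a
      linarith)
  have h1 : ∫⁻ x, h x ∂Measure.pi μ ≤ 1 := by
    rw [hhdef, lintegral_indicator_const hH, one_mul]
    exact prob_le_one
  have h2 : ∫⁻ x, h x * ∏ j ∈ T, g j x ∂Measure.pi μ ≤ ENNReal.ofReal (Real.exp (a * T.card)) := by
    refine key.trans ((mul_le_of_le_one_right' h1).trans_eq ?_)
    rw [← ENNReal.ofReal_pow (Real.exp_pos _).le, ← Real.exp_nat_mul, mul_comm]
  have h3 : {x | x ∈ H ∧ t ≤ s * (T.filter fun j => x ∈ A j).card} ⊆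
      {x | ENNReal.ofReal (Real.exp t) ≤ h x * ∏ j ∈ T, g j x} := by
    rintro x ⟨hx, hxt⟩
    have e1 : ∏ j ∈ T, g j x =
        ENNReal.ofReal (Real.exp (s * (T.filter fun j => x ∈ A j).card)) := by
      simp only [hgdef]
      rw [Finset.prod_ite, Finset.prod_const, Finset.prod_const_one, mul_one,
        ← ENNReal.ofReal_pow (Real.exp_pos _).le, ← Real.exp_nat_mul, mul_comm]
    simp only [Set.mem_ofPred_eq, hhdef, Set.indicator_of_mem hx, one_mul, e1]
    exact ENNReal.ofReal_le_ofReal (Real.exp_le_exp.2 hxt)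
  have hm : Measurable fun x => h x * ∏ j ∈ T, g j x :=
    hh.mul (Finset.measurable_fun_prod T fun i _ => hg i)
  refine (measure_mono h3).trans ?_
  refine (meas_ge_le_lintegral_div hm.aemeasurable ?_ ENNReal.ofReal_ne_top).trans ?_
  · simp [Real.exp_pos]
  · refine (ENNReal.div_le_div_right h2 _).trans_eq ?_
    rw [← ENNReal.ofReal_div_of_pos (Real.exp_pos _), ← Real.exp_sub]

end ProductMeasure

/-! ### The law of masks and weights, edge by edge. -/

section EdgeLaw

variable {VB : Type u} [Fintype VB] {B : Digraph VB}

/-- A joint choice of mask and weight for all edges of the full lift. -/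
abbrev Config (𝔹 : PerceptronModule.{u, v} B) (n : VB → ℕ) : Type (max u v) :=
  ∀ e : Edge (fullLift B n), Bool × 𝔹.W ((fullLift_isHom n).edge e)

variable {𝔹 : PerceptronModule.{u, v} B} {n : VB → ℕ}

/-- The mask of a configuration. -/
abbrev Config.mask (ω : Config 𝔹 n) (e : Edge (fullLift B n)) : Bool := (ω e).1

/-- The weights of a configuration. -/
abbrev Config.weight (ω : Config 𝔹 n) (e : Edge (fullLift B n)) :
    𝔹.W ((fullLift_isHom n).edge e) := (ω e).2

/-- The probability of presence of the lifts of an edge. -/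
def edgeProb (n : VB → ℕ) (lam : Edge B → ℝ) (e : Edge B) : Set.Icc (0 : ℝ) 1 :=
  Set.projIcc (0 : ℝ) 1 zero_le_one (lam e / (n e.1.1 : ℝ))

theorem edgeProb_le {lam : Edge B → ℝ} (e : Edge B) (h : 0 ≤ lam e) :
    (edgeProb n lam e : ℝ) ≤ lam e / n e.1.1 := by
  rw [edgeProb, Set.coe_projIcc]
  exact max_le (by positivity) (min_le_right _ _)

theorem edgeProb_eq {lam : Edge B → ℝ} (e : Edge B) (h : 0 ≤ lam e) (h1 : lam e ≤ n e.1.1) :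
    (edgeProb n lam e : ℝ) = lam e / n e.1.1 := by
  rw [edgeProb, Set.projIcc_of_mem _ ⟨by positivity, div_le_one_of_le₀ h1 (by positivity)⟩]

variable (𝔹 n) in
/-- The law of the mask and of the weight of an edge. -/
def edgeLaw (lam : Edge B → ℝ) (N : ∀ e : Edge B, Measure (𝔹.W e)) (e : Edge (fullLift B n)) :
    Measure (Bool × 𝔹.W ((fullLift_isHom n).edge e)) :=
  (ProbabilityTheory.bernoulliMeasure true false
    (edgeProb n lam ((fullLift_isHom n).edge e))).prod (N ((fullLift_isHom n).edge e))

variable {lam : Edge B → ℝ} {N : ∀ e : Edge B, Measure (𝔹.W e)}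
  [∀ e, IsProbabilityMeasure (N e)]

instance (e : Edge (fullLift B n)) : IsProbabilityMeasure (edgeLaw 𝔹 n lam N e) := by
  unfold edgeLaw; infer_instance

theorem edgeLaw_true (e : Edge (fullLift B n)) (s : Set (𝔹.W ((fullLift_isHom n).edge e))) :
    edgeLaw 𝔹 n lam N e ({true} ×ˢ s) =
      ENNReal.ofReal (edgeProb n lam ((fullLift_isHom n).edge e)) *
        N ((fullLift_isHom n).edge e) s := by
  rw [edgeLaw, Measure.prod_prod, ← ofReal_measureReal,
    ProbabilityTheory.bernoulliMeasure_real_apply_of_mem_of_notMem _ (by measurability)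
      (by simp) (by simp)]

theorem edgeLaw_false (e : Edge (fullLift B n)) :
    edgeLaw 𝔹 n lam N e ({false} ×ˢ Set.univ) =
      ENNReal.ofReal (1 - edgeProb n lam ((fullLift_isHom n).edge e)) := by
  rw [edgeLaw, Measure.prod_prod, ← ofReal_measureReal,
    ProbabilityTheory.bernoulliMeasure_real_apply_of_notMem_of_mem _ (by measurability)
      (by simp) (by simp), measure_univ, mul_one]

theorem measurePreserving_sparseLiftLaw :
    MeasurePreserving (fun (mw : (Edge (fullLift B n) → Bool) ×
      (∀ e : Edge (fullLift B n), 𝔹.W ((fullLift_isHom n).edge e))) e => (mw.1 e, mw.2 e))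
      (sparseLiftLaw 𝔹 n lam N) (Measure.pi (edgeLaw 𝔹 n lam N)) :=
  measurePreserving_zip _ _

instance : IsProbabilityMeasure (sparseLiftLaw 𝔹 n lam N) := by
  unfold sparseLiftLaw; infer_instance

/-- To hold with probability at least `1 - δ`, it is enough to hold outside of an event of outer
measure at most `δ`. -/
theorem holdsWithProbability_of_config {δ : ℝ} (hδ : 0 ≤ δ)
    {P : (Edge (fullLift B n) → Bool) ×
      (∀ e : Edge (fullLift B n), 𝔹.W ((fullLift_isHom n).edge e)) → Prop}
    {S : Set (Config 𝔹 n)} (hS : Measure.pi (edgeLaw 𝔹 n lam N) S ≤ ENNReal.ofReal δ)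
    (hP : ∀ ω : Config 𝔹 n, ω ∉ S → P (ω.mask, ω.weight)) :
    HoldsWithProbability (sparseLiftLaw 𝔹 n lam N) (1 - δ) P := by
  set ν := Measure.pi (edgeLaw 𝔹 n lam N)
  have hm := measurePreserving_sparseLiftLaw (𝔹 := 𝔹) (n := n) (lam := lam) (N := N)
  -- S need not be measurable, so the event is the complement of its measurable hull.
  refine ⟨_ ⁻¹' (toMeasurable ν S)ᶜ, hm.measurable (measurableSet_toMeasurable ν S).compl, ?_, ?_⟩
  · rw [hm.measure_preimage (measurableSet_toMeasurable ν S).compl.nullMeasurableSet,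
      prob_compl_eq_one_sub (measurableSet_toMeasurable ν S), measure_toMeasurable,
      ENNReal.ofReal_sub _ hδ, ENNReal.ofReal_one]
    exact tsub_le_tsub_left hS 1
  · rintro ⟨m, w⟩ h
    exact hP (fun e => (m e, w e)) fun hcon => h (subset_toMeasurable ν S hcon)

/-- Chernoff bound for the out-degree of a vertex of the sparse lift. -/
theorem measure_outSet_le (hlam : ∀ e, 0 < lam e) (e : Edge B) (i : Fin (n e.1.1)) (t : ℝ) :
    Measure.pi (edgeLaw 𝔹 n lam N)
      {ω : Config 𝔹 n | t ≤ ((outSet (fun e' => ω.mask e' = true) e i).card : ℝ)} ≤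
      ENNReal.ofReal (Real.exp ((Real.exp 1 - 1) * (lam e / n e.1.1) * n e.1.2 - t)) := by
  set ed : Fin (n e.1.2) → Edge (fullLift B n) := fun j => ⟨(⟨e.1.1, i⟩, ⟨e.1.2, j⟩), e.2⟩
  have hed : Function.Injective ed := by
    intro j j' h
    have h1 : (⟨e.1.2, j⟩ : Σ b, Fin (n b)) = ⟨e.1.2, j'⟩ :=
      congrArg (fun x : Edge (fullLift B n) => x.1.2) h
    simpa using h1
  have hA : ∀ j, MeasurableSet {ω : Config 𝔹 n | (ω (ed j)).1 = true} := fun j =>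
    (measurable_fst.comp (measurable_pi_apply (ed j))) (measurableSet_singleton true)
  have key := measure_le_exp_of_blocks (edgeLaw 𝔹 n lam N) (Finset.univ : Finset (Fin (n e.1.2)))
    (E := fun j => {ed j}) (A := fun j => {ω : Config 𝔹 n | (ω (ed j)).1 = true}) (H := Set.univ)
    (s := 1) (t := t) (a := (Real.exp 1 - 1) * (lam e / n e.1.1)) hA MeasurableSet.univ
    (fun j _ j' _ hjj x y => by
      have h1 : ed j' ∉ ({ed j} : Finset _) := by
        rw [Finset.mem_singleton]; exact fun h => hjj (hed h)
      simp only [Set.mem_ofPred_eq, Function.updateFinset, h1, dite_false])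
    (fun _ _ _ _ => Iff.rfl)
    (fun j _ x _ => by
      have h0 : 0 ≤ Real.exp 1 - 1 := by linarith [Real.add_one_le_exp 1]
      refine mul_le_mul_of_nonneg_left ?_ h0
      refine le_trans ?_ (edgeProb_le e (hlam e).le)
      let i₀ : ({ed j} : Finset (Edge (fullLift B n))) := ⟨ed j, Finset.mem_singleton_self _⟩
      have h1 : {y : ∀ i : ({ed j} : Finset (Edge (fullLift B n))),
            Bool × 𝔹.W ((fullLift_isHom n).edge i) |
          Function.updateFinset x {ed j} y ∈ {ω : Config 𝔹 n | (ω (ed j)).1 = true}} =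
          Function.eval i₀ ⁻¹' ({true} ×ˢ Set.univ) := by
        ext y
        simp [Function.updateFinset, i₀]
      rw [h1, Measure.real, (measurePreserving_eval _ _).measure_preimage
        (((measurableSet_singleton true).prod MeasurableSet.univ).nullMeasurableSet),
        edgeLaw_true, measure_univ, mul_one, ENNReal.toReal_ofReal (edgeProb n lam _).2.1])
  simp only [Set.mem_univ, true_and, one_mul, Finset.card_univ, Fintype.card_fin] at key
  exact key

end EdgeLaw

/-! ### Conditional probability of being a copy. -/

namespace LiftedModule

variable {VB : Type u} [Fintype VB] {B : Digraph VB} {𝔹 : PerceptronModule.{u, v} B}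
  {n₀ : 𝔹.I → ℕ} {𝔾 : LiftedModule.{u, v, w} 𝔹 n₀} {n : VB → ℕ}
  {hn : ∀ b : 𝔹.I, n b.1 = n₀ b} {J : ∀ v : 𝔾.V, Set (Fin (n (𝔾.π v)))}
  {w₀ : ∀ e : Edge 𝔾.G, 𝔹.W (𝔾.hom.edge e)} {ρ : ℝ≥0∞}

/-- Being a copy only depends on the edges into the vertex and into the fibres of its
ancestors. -/
theorem IsCopy.congr {ω ω' : Config 𝔹 n} {v : 𝔾.V} {j : Fin (n (𝔾.π v))}
    (h : 𝔾.IsCopy hn J w₀ ρ ω.mask ω.weight v j)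
    (hω : ∀ e : Edge (fullLift B n), (e.1.2 = ⟨𝔾.π v, j⟩ ∨
      Relation.TransGen B.Adj e.1.2.1 (𝔾.π v)) → ω e = ω' e) :
    𝔾.IsCopy hn J w₀ ρ ω'.mask ω'.weight v j := by
  induction h with
  | init v hv => exact IsCopy.init v hv
  | step v hv j hj i hi hm hw ih =>
    refine IsCopy.step v hv j hj i (fun u => ih u fun e he => hω e (Or.inr ?_))
      (fun q hq => ?_) (fun u => ?_)
    · rcases he with he | he
      · rw [he]
        exact Relation.TransGen.single (𝔾.hom u.2)
      · exact he.tail (𝔾.hom u.2)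
    · rw [← hm q hq, Config.mask, Config.mask, hω _ (Or.inl rfl)]
    · have := hw u
      rwa [liftWeight, Config.weight, hω _ (Or.inl rfl)] at this

variable (𝔾 hn J w₀ ρ) in
/-- The event that `(π v, j)` is a copy of `v`. -/
def copyEvent (v : 𝔾.V) (j : Fin (n (𝔾.π v))) : Set (Config 𝔹 n) :=
  {ω | 𝔾.IsCopy hn J w₀ ρ ω.mask ω.weight v j}

/-- The edges of the full lift into a given vertex. -/
def inEdges (n : VB → ℕ) (B : Digraph VB) (p : Σ b : VB, Fin (n b)) :
    Finset (Edge (fullLift B n)) :=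
  Finset.univ.filter fun e => e.1.2 = p

/-- Being a copy only involves edges into the vertex and into ancestral layers. By acyclicity this
applies to two distinct vertices of one layer, which makes their copy events conditionally
independent, and to vertices of parent layers. -/
theorem updateFinset_mem_copyEvent_iff {v : 𝔾.V} {j : Fin (n (𝔾.π v))}
    {p : Σ b : VB, Fin (n b)} (hp : p ≠ ⟨𝔾.π v, j⟩)
    (hp' : ¬ Relation.TransGen B.Adj p.1 (𝔾.π v)) (x : Config 𝔹 n)
    (y : ∀ e : inEdges n B p, Bool × 𝔹.W ((fullLift_isHom n).edge e)) :
    Function.updateFinset x (inEdges n B p) y ∈ 𝔾.copyEvent hn J w₀ ρ v j ↔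
      x ∈ 𝔾.copyEvent hn J w₀ ρ v j := by
  have key : ∀ e : Edge (fullLift B n), (e.1.2 = ⟨𝔾.π v, j⟩ ∨
      Relation.TransGen B.Adj e.1.2.1 (𝔾.π v)) →
      Function.updateFinset x (inEdges n B p) y e = x e := by
    intro e he
    have h1 : e ∉ inEdges n B p := by
      simp only [inEdges, Finset.mem_filter, Finset.mem_univ, true_and]
      rintro rfl
      rcases he with he | he
      · exact hp he
      · exact hp' he
    simp [Function.updateFinset, h1]
  exact ⟨fun h => IsCopy.congr h key, fun h => IsCopy.congr h fun e he => (key e he).symm⟩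

theorem measurableSet_copyEvent (v : 𝔾.V) (j : Fin (n (𝔾.π v))) :
    MeasurableSet (𝔾.copyEvent hn J w₀ ρ v j) := by
  induction v using (𝔾.hom.isAcyclic 𝔹.acyclic).wf.induction with
  | _ v ih =>
    by_cases hv : 𝔾.π v ∈ 𝔹.I
    · simp only [copyEvent, 𝔾.isCopy_iff_of_mem hv]
      exact MeasurableSet.const _
    · simp only [copyEvent, 𝔾.isCopy_iff_of_notMem hv]
      refine measurableSet_setOfPred.2 (measurable_const.and (Measurable.exists fun i =>
        (Measurable.forall fun u => ?_).and
        ((Measurable.forall fun q => Measurable.forall fun hq => ?_).and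
          (Measurable.forall fun u => ?_))))
      · have h1 := ih u.1 u.2 (i u)
        unfold copyEvent at h1
        exact measurableSet_setOfPred.1 h1
      · have h1 : MeasurableSet {ω : Config 𝔹 n | ω.mask ⟨(q, ⟨𝔾.π v, j⟩), hq⟩ = true} :=
          (measurable_fst.comp (measurable_pi_apply (⟨(q, ⟨𝔾.π v, j⟩), hq⟩ :
            Edge (fullLift B n)))) (measurableSet_singleton true)
        exact (measurableSet_setOfPred.1 h1).iff measurable_const
      · have h1 : Measurable fun ω : Config 𝔹 n => ω.weight (𝔾.liftEdge u.2 (i u) j) :=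
          measurable_snd.comp (measurable_pi_apply (𝔾.liftEdge u.2 (i u) j))
        have h2 : MeasurableSet (Metric.closedEBall (w₀ u.edge) ρ) :=
          Metric.isClosed_closedEBall.measurableSet
        have h3 := measurableSet_setOfPred.1 (h1 h2)
        convert h3 using 2 with ω
        rw [← edist_eq_enorm_sub]
        rfl

variable {lam : Edge B → ℝ} {N : ∀ e : Edge B, Measure (𝔹.W e)}
  [∀ e, IsProbabilityMeasure (N e)]

/-- Conditionally on the edges which are not into `(π v, j)`, the probability that `(π v, j)` is a
copy of `v` is bounded below in terms of the numbers of copies of the parents of `v`. -/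
theorem le_measure_copyEvent_block (hJ : 𝔾.IsLabelling J) {v : 𝔾.V} (hv : 𝔾.π v ∉ 𝔹.I)
    {j : Fin (n (𝔾.π v))} (hj : j ∈ J v) (x : Config 𝔹 n) :
    (∏ u : Parent 𝔾.G v, ((Finset.univ.filter fun i =>
        x ∈ 𝔾.copyEvent hn J w₀ ρ u.1 i).card : ℝ≥0∞)) *
      ((∏ u : Parent 𝔾.G v, ENNReal.ofReal (edgeProb n lam (𝔾.hom.edge u.edge)) *
        N (𝔾.hom.edge u.edge) (Metric.closedEBall (w₀ u.edge) ρ)) *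
      ∏ e ∈ inEdges n B ⟨𝔾.π v, j⟩,
        ENNReal.ofReal (1 - edgeProb n lam ((fullLift_isHom n).edge e))) ≤
    Measure.pi (fun e : inEdges n B ⟨𝔾.π v, j⟩ => edgeLaw 𝔹 n lam N e)
      {y | Function.updateFinset x (inEdges n B ⟨𝔾.π v, j⟩) y ∈ 𝔾.copyEvent hn J w₀ ρ v j} := by
  set E := inEdges n B ⟨𝔾.π v, j⟩ with hE
  set S : ∀ u : Parent 𝔾.G v, Finset (Fin (n (𝔾.π u.1))) := fun u => Finset.univ.filter fun i =>
    x ∈ 𝔾.copyEvent hn J w₀ ρ u.1 i with hS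
  set g : (∀ u : Parent 𝔾.G v, Fin (n (𝔾.π u.1))) → Parent 𝔾.G v → Edge (fullLift B n) :=
    fun i u => 𝔾.liftEdge u.2 (i u) j with hg
  have hgE : ∀ i u, g i u ∈ E := fun i u => by
    simp [hg, hE, inEdges]
  have huniq : ∀ i ∈ Fintype.piFinset S, ∀ i' ∈ Fintype.piFinset S, ∀ u u',
      g i u = g i' u' → u = u' := by
    intro i hi i' hi' u u' h
    have h1 := (Finset.mem_filter.1 (Fintype.mem_piFinset.1 hi u)).2
    have h2 := (Finset.mem_filter.1 (Fintype.mem_piFinset.1 hi' u')).2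
    have h3 : (⟨𝔾.π u.1, i u⟩ : Σ b : VB, Fin (n b)) = ⟨𝔾.π u'.1, i' u'⟩ :=
      congrArg (fun e : Edge (fullLift B n) => e.1.1) h
    exact Subtype.ext (IsCopy.unique hJ h1 h2 h3)
  have hinj : ∀ i ∈ Fintype.piFinset S, Function.Injective (g i) := fun i hi u u' h =>
    huniq i hi i hi u u' h
  -- For each choice i of one copy of every parent, a box of outcomes: the chosen edges are present
  -- with close weights, all the other incoming edges are absent. The event contains the union of
  -- these boxes.
  have hext : ∀ i ∈ Fintype.piFinset S, ∃ A : ∀ e : Edge (fullLift B n),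
      Set (Bool × 𝔹.W ((fullLift_isHom n).edge e)),
      (∀ u, A (g i u) = {true} ×ˢ (Metric.closedEBall (w₀ u.edge) ρ :
        Set (𝔹.W (𝔾.hom.edge u.edge)))) ∧
      ∀ e, e ∉ Set.range (g i) → A e = {false} ×ˢ Set.univ := fun i hi =>
    exists_dependent_extension (hinj i hi) _ _
  choose! A hA hA' using hext
  set box : (∀ u : Parent 𝔾.G v, Fin (n (𝔾.π u.1))) →
      Set (∀ e : E, Bool × 𝔹.W ((fullLift_isHom n).edge e)) :=
    fun i => Set.univ.pi fun e : E => A i e with hbox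
  have hAm : ∀ i ∈ Fintype.piFinset S, ∀ e, MeasurableSet (A i e) := by
    intro i hi e
    by_cases he : e ∈ Set.range (g i)
    · obtain ⟨u, rfl⟩ := he
      rw [hA i hi u]
      exact (measurableSet_singleton true).prod Metric.isClosed_closedEBall.measurableSet
    · rw [hA' i hi e he]
      exact (measurableSet_singleton false).prod MeasurableSet.univ
  have hboxm : ∀ i ∈ Fintype.piFinset S, MeasurableSet (box i) := fun i hi =>
    MeasurableSet.univ_pi fun e => hAm i hi e
  have hmask : ∀ i ∈ Fintype.piFinset S, ∀ y ∈ box i, ∀ e : E,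
      (y e).1 = true ↔ e.1 ∈ Set.range (g i) := by
    intro i hi y hy e
    have h1 : y e ∈ A i e := hy e (Set.mem_univ _)
    by_cases he : e.1 ∈ Set.range (g i)
    · obtain ⟨e, heE⟩ := e
      obtain ⟨u, rfl⟩ := he
      rw [hA i hi u] at h1
      have h2 : (y ⟨g i u, heE⟩).1 = true := h1.1
      simp [h2]
    · rw [hA' i hi e he] at h1
      have h2 : (y e).1 = false := h1.1
      simp only [h2, he, iff_false]
      simp
  -- The mask reveals which edges were chosen, hence the choice i, because a vertex copies at most
  -- one parent.
  have hdisj : Set.PairwiseDisjoint (↑(Fintype.piFinset S)) box := by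
    intro i hi i' hi' hne
    rw [Function.onFun, Set.disjoint_left]
    intro y hy hy'
    obtain ⟨u, hu⟩ := Function.ne_iff.1 hne
    have h1 := (hmask i hi y hy ⟨g i u, hgE i u⟩).2 ⟨u, rfl⟩
    obtain ⟨u', h2⟩ := (hmask i' hi' y hy' ⟨g i u, hgE i u⟩).1 h1
    obtain rfl := huniq i hi i' hi' u u' h2.symm
    have h3 : (⟨𝔾.π u.1, i u⟩ : Σ b : VB, Fin (n b)) = ⟨𝔾.π u.1, i' u⟩ :=
      congrArg (fun e : Edge (fullLift B n) => e.1.1) h2.symm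
    exact hu (by simpa using h3)
  have hsub : (⋃ i ∈ Fintype.piFinset S, box i) ⊆
      {y | Function.updateFinset x E y ∈ 𝔾.copyEvent hn J w₀ ρ v j} := by
    intro y hy
    simp only [Set.mem_iUnion] at hy
    obtain ⟨i, hi, hy⟩ := hy
    have hupd : ∀ e (he : e ∈ E), Function.updateFinset x E y e = y ⟨e, he⟩ := fun e he => by
      simp [Function.updateFinset, he]
    refine IsCopy.step v hv j hj i (fun u => ?_) (fun q hq => ?_) (fun u => ?_)
    · have h1 := (Finset.mem_filter.1 (Fintype.mem_piFinset.1 hi u)).2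
      refine (updateFinset_mem_copyEvent_iff (p := ⟨𝔾.π v, j⟩) ?_ ?_ x y).2 h1
      · intro h
        have h2 : 𝔾.π v = 𝔾.π u.1 := congrArg Sigma.fst h
        exact 𝔹.acyclic (𝔾.π v) (by
          have := Relation.TransGen.single (𝔾.hom u.2)
          rwa [← h2] at this)
      · intro h
        exact 𝔹.acyclic _ (h.tail (𝔾.hom u.2))
    · have hqE : (⟨(q, ⟨𝔾.π v, j⟩), hq⟩ : Edge (fullLift B n)) ∈ E := by
        simp [hE, inEdges]
      rw [Config.mask, hupd _ hqE, hmask i hi y hy]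
      constructor
      · rintro ⟨u, hu⟩
        exact ⟨u, (congrArg (fun e : Edge (fullLift B n) => e.1.1) hu).symm⟩
      · rintro ⟨u, rfl⟩
        exact ⟨u, rfl⟩
    · have h1 : y ⟨g i u, hgE i u⟩ ∈ A i (g i u) :=
        hy ⟨g i u, hgE i u⟩ (Set.mem_univ _)
      rw [hA i hi u] at h1
      have h2 := h1.2
      rw [Metric.mem_closedEBall, edist_eq_enorm_sub] at h2
      show ‖(Function.updateFinset x E y (g i u)).2 - w₀ u.edge‖ₑ ≤ ρ
      rw [hupd _ (hgE i u)]
      exact h2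
  refine le_trans ?_ (measure_mono hsub)
  rw [measure_biUnion_finset hdisj hboxm]
  have hcard : ∏ u : Parent 𝔾.G v, ((S u).card : ℝ≥0∞) = ((Fintype.piFinset S).card : ℝ≥0∞) := by
    rw [Fintype.card_piFinset]; push_cast; rfl
  rw [hcard, ← nsmul_eq_mul]
  refine Finset.card_nsmul_le_sum _ _ _ fun i hi => ?_
  rw [hbox, Measure.pi_pi, Finset.prod_coe_sort E fun e => edgeLaw 𝔹 n lam N e (A i e)]
  have himg : Finset.univ.image (g i) ⊆ E := by
    intro e he
    obtain ⟨u, _, rfl⟩ := Finset.mem_image.1 he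
    exact hgE i u
  rw [← Finset.prod_sdiff (f := fun e => edgeLaw 𝔹 n lam N e (A i e)) himg, mul_comm]
  refine mul_le_mul' ?_ (le_of_eq ?_)
  · have h1 : ∏ e ∈ E \ Finset.univ.image (g i), edgeLaw 𝔹 n lam N e (A i e) =
        ∏ e ∈ E \ Finset.univ.image (g i),
          ENNReal.ofReal (1 - edgeProb n lam ((fullLift_isHom n).edge e)) := by
      refine Finset.prod_congr rfl fun e he => ?_
      rw [hA' i hi e, edgeLaw_false]
      rintro ⟨u, rfl⟩
      exact (Finset.mem_sdiff.1 he).2 (Finset.mem_image_of_mem _ (Finset.mem_univ _))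
    rw [h1]
    -- Including absence factors for the chosen edges as well only lowers the bound, and makes it
    -- the same for all choices.
    refine Finset.prod_le_prod_of_subset_of_le_one' Finset.sdiff_subset fun e _ _ => ?_
    rw [ENNReal.ofReal_le_one]
    have := (edgeProb n lam ((fullLift_isHom n).edge e)).2.1
    linarith
  · rw [Finset.prod_image fun u _ u' _ h => hinj i hi h]
    refine Finset.prod_congr rfl fun u _ => ?_
    rw [hA i hi u]
    exact (edgeLaw_true (𝔾.liftEdge u.2 (i u) j) _).symm

end LiftedModule

/-- After inversion and exp y ≥ 1 + y + y²/2 at y = x + x², it remains that x²(1 - x - x² - x³) ≥ 0,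
true up to 1/2. -/
theorem exp_neg_sub_sq_le_one_sub {x : ℝ} (h0 : 0 ≤ x) (h1 : x ≤ 1 / 2) :
    Real.exp (-x - x ^ 2) ≤ 1 - x := by
  have h2 : -x - x ^ 2 = -(x + x ^ 2) := by ring
  rw [h2, Real.exp_neg, inv_le_iff_one_le_mul₀ (Real.exp_pos _)]
  have h3 := Real.quadratic_le_exp_of_nonneg (x := x + x ^ 2) (by positivity)
  refine le_trans ?_ (mul_le_mul_of_nonneg_left h3 (by linarith))
  have h4 : 0 ≤ x ^ 2 * (1 - x - x ^ 2 - x ^ 3) := by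
    have h5 : x ^ 2 ≤ 1 / 4 := by nlinarith
    have h6 : x ^ 3 ≤ 1 / 8 := by nlinarith
    refine mul_nonneg (by positivity) (by linarith)
  nlinarith

/-- Lower bound for the probability that k potential edges are all absent: it is at least exp(-l -
l²/k), and l²/k ≤ 1/3. The hypothesis on λ at the inputs has exactly this form. -/
theorem two_thirds_mul_exp_le_one_sub_pow {l : ℝ} {k : ℕ} (h0 : 0 < l) (h1 : l ≤ k / 2)
    (h2 : l ^ 2 ≤ k / 3) : 2 / 3 * Real.exp (-l) ≤ (1 - l / k) ^ k := by
  have hk : (0 : ℝ) < k := by linarith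
  have h3 : l / k ≤ 1 / 2 := by rw [div_le_iff₀ hk]; linarith
  have h4 := exp_neg_sub_sq_le_one_sub (x := l / k) (by positivity) h3
  have h5 := pow_le_pow_left₀ (Real.exp_pos _).le h4 k
  refine le_trans ?_ h5
  rw [← Real.exp_nat_mul]
  have h6 : (k : ℝ) * (-(l / k) - (l / k) ^ 2) = -l + -(l ^ 2 / k) := by field_simp; ring
  rw [h6, Real.exp_add, mul_comm]
  refine mul_le_mul_of_nonneg_left ?_ (Real.exp_pos _).le
  have h7 := Real.add_one_le_exp (-(l ^ 2 / k))
  have h8 : l ^ 2 / k ≤ 1 / 3 := by rw [div_le_iff₀ hk]; linarith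
  linarith

theorem prod_inEdges {VB : Type u} [Fintype VB] {B : Digraph VB} {n : VB → ℕ} {M : Type*}
    [CommMonoid M] (F : Edge B → M) (b : VB) (j : Fin (n b)) :
    ∏ e ∈ LiftedModule.inEdges n B ⟨b, j⟩, F ((fullLift_isHom n).edge e) =
      ∏ a : Parent B b, F a.edge ^ n a.1 := by
  have h1 : ∏ a : Parent B b, F a.edge ^ n a.1 =
      ∏ q : (Σ a : Parent B b, Fin (n a.1)), F q.1.edge := by
    rw [Fintype.prod_sigma]
    simp
  rw [h1]
  symm
  refine Finset.prod_nbij (fun q => (⟨(⟨q.1.1, q.2⟩, ⟨b, j⟩), q.1.2⟩ : Edge (fullLift B n)))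
    (fun q _ => by simp [LiftedModule.inEdges]) ?_ ?_ (fun _ _ => rfl)
  · rintro ⟨a, i⟩ _ ⟨a', i'⟩ _ h
    have h2 : (⟨a.1, i⟩ : Σ b : VB, Fin (n b)) = ⟨a'.1, i'⟩ :=
      congrArg (fun e : Edge (fullLift B n) => e.1.1) h
    obtain ⟨a, ha⟩ := a
    obtain ⟨a', ha'⟩ := a'
    obtain rfl : a = a' := congrArg Sigma.fst h2
    simp only [Sigma.mk.injEq, heq_eq_eq, true_and] at h2
    rw [h2]
  · rintro ⟨⟨⟨a, i⟩, q⟩, ha⟩ he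
    have h2 : q = ⟨b, j⟩ := (Finset.mem_filter.1 he).2
    subst h2
    exact ⟨⟨⟨a, ha⟩, i⟩, Finset.mem_coe.2 (Finset.mem_univ _), rfl⟩

/-! ### Lower tail of the number of copies. -/

namespace LiftedModule

variable {VB : Type u} [Fintype VB] {B : Digraph VB} {𝔹 : PerceptronModule.{u, v} B}
  {n₀ : 𝔹.I → ℕ} {𝔾 : LiftedModule.{u, v, w} 𝔹 n₀} {n : VB → ℕ}

variable (𝔾 n) in
/-- The fibres may be labelled evenly. -/
theorem exists_labelling : ∃ J : ∀ v : 𝔾.V, Set (Fin (n (𝔾.π v))), 𝔾.IsLabelling J ∧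
    ∀ v, (Finset.univ.filter (· ∈ J v)).card = n (𝔾.π v) / 𝔾.fiberCard (𝔾.π v) := by
  -- With m vertices of the given type, m ⌊n/m⌋ ≤ n leaves room for disjoint blocks of size ⌊n/m⌋.
  have hemb : ∀ b, Nonempty ({v : 𝔾.V // 𝔾.π v = b} × Fin (n b / 𝔾.fiberCard b) ↪ Fin (n b)) := by
    intro b
    refine Function.Embedding.nonempty_of_card_le ?_
    rw [Fintype.card_prod, Fintype.card_fin, Fintype.card_fin, ← Nat.card_eq_fintype_card]
    exact Nat.mul_div_le _ _
  refine ⟨fun v => Set.range fun t => hemb (𝔾.π v) |>.some (⟨v, rfl⟩, t), ?_, ?_⟩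
  · rintro v v' _ ⟨t, rfl⟩ _ ⟨t', rfl⟩ h
    have key : ∀ (b b' : VB) (hb : 𝔾.π v = b) (hb' : 𝔾.π v' = b')
        (t : Fin (n b / 𝔾.fiberCard b)) (t' : Fin (n b' / 𝔾.fiberCard b')),
        (⟨b, (hemb b).some (⟨v, hb⟩, t)⟩ : Σ b : VB, Fin (n b)) =
          ⟨b', (hemb b').some (⟨v', hb'⟩, t')⟩ → v = v' := by
      intro b b' hb hb' t t' h
      obtain rfl : b = b' := congrArg Sigma.fst h
      simp only [Sigma.mk.injEq, heq_eq_eq, true_and, EmbeddingLike.apply_eq_iff_eq,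
        Prod.mk.injEq, Subtype.mk.injEq] at h
      exact h.1
    exact key _ _ rfl rfl t t' h
  · intro v
    trans (Finset.univ.image fun t => (hemb (𝔾.π v)).some (⟨v, rfl⟩, t)).card
    · congr 1
      ext j
      simp
    rw [Finset.card_image_of_injective, Finset.card_univ, Fintype.card_fin]
    intro t t' h
    simpa using h

variable {hn : ∀ b : 𝔹.I, n b.1 = n₀ b} {J : ∀ v : 𝔾.V, Set (Fin (n (𝔾.π v)))}
  {w₀ : ∀ e : Edge 𝔾.G, 𝔹.W (𝔾.hom.edge e)} {ρ : ℝ≥0∞}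
  {lam : Edge B → ℝ} {N : ∀ e : Edge B, Measure (𝔹.W e)} [∀ e, IsProbabilityMeasure (N e)]

variable (𝔾 hn J w₀ ρ) in
/-- The number of copies of a vertex. -/
def copyCount (ω : Config 𝔹 n) (v : 𝔾.V) : ℕ :=
  (Finset.univ.filter fun j => ω ∈ 𝔾.copyEvent hn J w₀ ρ v j).card

variable (𝔾 w₀ ρ lam N) in
/-- A lower bound on the probability of being a copy, for a vertex with the right label. -/
def copyProb (α : 𝔾.V → ℝ) (v : 𝔾.V) : ℝ :=
  (∏ a : Parent B (𝔾.π v), (2 / 3 * Real.exp (-lam a.edge))) *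
    ∏ u : Parent 𝔾.G v, lam (𝔾.hom.edge u.edge) *
      (N (𝔾.hom.edge u.edge)).real (Metric.closedEBall (w₀ u.edge) ρ) * α u.1

/-- In the block bound, the α n available copies of a parent cancel the 1/n in the edge probability
λ/n, which is not truncated under `hlamn`. The absent edges cost at least (2/3) exp(-λ) per parent
type, so no width remains. -/
theorem copyProb_le_measure_block (hlam : ∀ e, 0 < lam e)
    (hlamn : ∀ e : Edge B, lam e ≤ n e.1.1 / 2 ∧ lam e ^ 2 ≤ n e.1.1 / 3)
    (hJ : 𝔾.IsLabelling J) {v : 𝔾.V} (hv : 𝔾.π v ∉ 𝔹.I) {j : Fin (n (𝔾.π v))} (hj : j ∈ J v)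
    (x : Config 𝔹 n) {α : 𝔾.V → ℝ} (hα : ∀ v, 0 ≤ α v)
    (hx : ∀ u : Parent 𝔾.G v, α u.1 * n (𝔾.π u.1) ≤ 𝔾.copyCount hn J w₀ ρ x u.1) :
    𝔾.copyProb w₀ ρ lam N α v ≤
      (Measure.pi (fun e : inEdges n B ⟨𝔾.π v, j⟩ => edgeLaw 𝔹 n lam N e)).real
        {y | Function.updateFinset x (inEdges n B ⟨𝔾.π v, j⟩) y ∈
          𝔾.copyEvent hn J w₀ ρ v j} := by
  have hnpos : ∀ e : Edge B, (0 : ℝ) < n e.1.1 := fun e => by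
    have := hlam e
    have := (hlamn e).1
    linarith
  have hp : ∀ e : Edge B, (edgeProb n lam e : ℝ) = lam e / n e.1.1 := fun e =>
    edgeProb_eq e (hlam e).le (by have := (hlamn e).1; have := hnpos e; linarith)
  have h1 := ENNReal.toReal_mono (measure_ne_top _ _) (le_measure_copyEvent_block (hn := hn)
    (w₀ := w₀) (ρ := ρ) (lam := lam) (N := N) hJ hv hj x)
  refine le_trans ?_ h1
  have h3 : ∀ e : Edge B, 0 ≤ (edgeProb n lam e : ℝ) := fun e => (edgeProb n lam e).2.1
  have h4 : ∀ e : Edge B, 0 ≤ 1 - (edgeProb n lam e : ℝ) := fun e => by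
    linarith [(edgeProb n lam e).2.2]
  simp only [ENNReal.toReal_mul, ENNReal.toReal_prod, ENNReal.toReal_natCast,
    ENNReal.toReal_ofReal (h3 _), ENNReal.toReal_ofReal (h4 _)]
  rw [prod_inEdges (fun e => 1 - (edgeProb n lam e : ℝ)) (𝔾.π v) j, ← mul_assoc,
    ← Finset.prod_mul_distrib, mul_comm, copyProb, mul_comm (∏ a : Parent B (𝔾.π v), _),
    mul_comm (∏ a : Parent B (𝔾.π v), _)]
  refine mul_le_mul ?_ ?_ ?_ ?_
  · refine Finset.prod_le_prod (fun u _ => ?_) (fun u _ => ?_)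
    · have := hlam (𝔾.hom.edge u.edge)
      have := hα u.1
      positivity
    · rw [hp]
      have h5 : (0 : ℝ) < n (𝔾.π u.1) := hnpos (𝔾.hom.edge u.edge)
      have h6 := hlam (𝔾.hom.edge u.edge)
      have h7 : 0 ≤ lam (𝔾.hom.edge u.edge) / n (𝔾.π u.1) *
        (N (𝔾.hom.edge u.edge)).real (Metric.closedEBall (w₀ u.edge) ρ) := by positivity
      refine le_trans (le_of_eq ?_) (mul_le_mul_of_nonneg_right (hx u) h7)
      field_simp
      exact mul_comm _ _
  · refine Finset.prod_le_prod (fun a _ => by positivity) (fun a _ => ?_)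
    rw [hp]
    exact two_thirds_mul_exp_le_one_sub_pow (hlam _) (hlamn a.edge).1 (hlamn a.edge).2
  · exact Finset.prod_nonneg fun a _ => by positivity
  · exact Finset.prod_nonneg fun u _ => by
      have := h3 (𝔾.hom.edge u.edge)
      positivity

/-- It is unlikely that there are few copies of a vertex whose parents have many copies. -/
theorem measure_copyCount_le (hlam : ∀ e, 0 < lam e)
    (hlamn : ∀ e : Edge B, lam e ≤ n e.1.1 / 2 ∧ lam e ^ 2 ≤ n e.1.1 / 3)
    (hJ : 𝔾.IsLabelling J) {v : 𝔾.V} (hv : 𝔾.π v ∉ 𝔹.I) {α : 𝔾.V → ℝ} (hα : ∀ v, 0 ≤ α v)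
    (t : ℝ) :
    Measure.pi (edgeLaw 𝔹 n lam N) {ω : Config 𝔹 n |
      (∀ u : Parent 𝔾.G v, α u.1 * n (𝔾.π u.1) ≤ 𝔾.copyCount hn J w₀ ρ ω u.1) ∧
        (𝔾.copyCount hn J w₀ ρ ω v : ℝ) ≤ t} ≤
      ENNReal.ofReal (Real.exp ((Real.exp (-1) - 1) * 𝔾.copyProb w₀ ρ lam N α v *
        (Finset.univ.filter (· ∈ J v)).card + t)) := by
  set H : Set (Config 𝔹 n) := {ω |
    ∀ u : Parent 𝔾.G v, α u.1 * n (𝔾.π u.1) ≤ 𝔾.copyCount hn J w₀ ρ ω u.1} with hH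
  have hHm : MeasurableSet H := by
    refine measurableSet_setOfPred.2 (Measurable.forall fun u => ?_)
    have h1 : Measurable fun ω : Config 𝔹 n => (𝔾.copyCount hn J w₀ ρ ω u.1 : ℝ) := by
      simp only [copyCount, Finset.card_filter, Nat.cast_sum]
      refine Finset.measurable_fun_sum _ fun i _ => ?_
      simp only [Nat.cast_ite]
      exact Measurable.ite (measurableSet_copyEvent _ _) measurable_const measurable_const
    exact measurableSet_setOfPred.1 (measurableSet_le measurable_const h1)
  -- Chernoff with s = -1 over the vertices labelled v, each with its incoming edges as block. The
  -- conditioning event concerns parent layers only and is unaffected by these blocks.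
  have key := measure_le_exp_of_blocks (edgeLaw 𝔹 n lam N) (Finset.univ.filter (· ∈ J v))
    (E := fun j => inEdges n B ⟨𝔾.π v, j⟩) (A := fun j => 𝔾.copyEvent hn J w₀ ρ v j) (H := H)
    (s := -1) (a := (Real.exp (-1) - 1) * 𝔾.copyProb w₀ ρ lam N α v) (t := -t)
    (fun j => measurableSet_copyEvent v j) hHm
    (fun j _ i _ hij x y => updateFinset_mem_copyEvent_iff
      (fun h => hij (by simpa using h.symm)) (𝔹.acyclic _) x y)
    (fun j _ x y => by
      have h1 : ∀ u : Parent 𝔾.G v,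
          𝔾.copyCount hn J w₀ ρ (Function.updateFinset x (inEdges n B ⟨𝔾.π v, j⟩) y) u.1 =
            𝔾.copyCount hn J w₀ ρ x u.1 := by
        intro u
        refine congrArg Finset.card (Finset.filter_congr fun i _ =>
          updateFinset_mem_copyEvent_iff (fun h => ?_) (fun h => ?_) x y)
        · have h2 : 𝔾.π v = 𝔾.π u.1 := congrArg Sigma.fst h
          have h3 := Relation.TransGen.single (𝔾.hom u.2)
          rw [← h2] at h3
          exact 𝔹.acyclic _ h3
        · exact 𝔹.acyclic _ (h.tail (𝔾.hom u.2))
      simp only [hH, Set.mem_ofPred_eq, h1])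
    (fun j hj x hx => by
      have h1 : Real.exp (-1) - 1 ≤ 0 := by
        exact sub_nonpos.2 (Real.exp_le_one_iff.2 (by norm_num))
      exact mul_le_mul_of_nonpos_left (copyProb_le_measure_block hlam hlamn hJ hv
        (Finset.mem_filter.1 hj).2 x hα hx) h1)
  rw [sub_neg_eq_add] at key
  refine le_trans (measure_mono fun ω hω => ?_) key
  refine ⟨hω.1, ?_⟩
  have h1 : (Finset.univ.filter (· ∈ J v)).filter (fun j => ω ∈ 𝔾.copyEvent hn J w₀ ρ v j) =
      Finset.univ.filter fun j => ω ∈ 𝔾.copyEvent hn J w₀ ρ v j := by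
    ext j
    simp only [Finset.mem_filter, Finset.mem_univ, true_and, and_iff_right_iff_imp]
    exact fun h => ((𝔾.isCopy_iff_of_notMem hv).1 h).1
  have h2 := hω.2
  rw [copyCount] at h2
  rw [h1]
  linarith

end LiftedModule

/-! ### Comparison of α with the probability of being a copy. -/

namespace LiftedModule

variable {VB : Type u} [Fintype VB] {B : Digraph VB} {𝔹 : PerceptronModule.{u, v} B}
  {n₀ : 𝔹.I → ℕ} {𝔾 : LiftedModule.{u, v, w} 𝔹 n₀} {n : VB → ℕ}
  {hn : ∀ b : 𝔹.I, n b.1 = n₀ b} {J : ∀ v : 𝔾.V, Set (Fin (n (𝔾.π v)))}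
  {w₀ : ∀ e : Edge 𝔾.G, 𝔹.W (𝔾.hom.edge e)} {ρ : ℝ≥0∞}
  {lam : Edge B → ℝ} {N : ∀ e : Edge B, Measure (𝔹.W e)} [∀ e, IsProbabilityMeasure (N e)]

theorem toReal_alpha_of_mem {v : 𝔾.V} (hv : 𝔾.π v ∈ 𝔹.I) :
    (𝔾.alpha lam N w₀ ρ v).toReal = (n₀ ⟨𝔾.π v, hv⟩ : ℝ)⁻¹ := by
  rw [alpha_eq, dif_pos hv, ENNReal.toReal_inv, ENNReal.toReal_natCast]

theorem prod_lam_pow (v : 𝔾.V) :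
    ∏ a : Parent B (𝔾.π v), lam a.edge ^ Nat.card {p : Parent 𝔾.G v // 𝔾.π p.1 = a.1} =
      ∏ u : Parent 𝔾.G v, lam (𝔾.hom.edge u.edge) := by
  rw [← Finset.prod_fiberwise' Finset.univ (fun u : Parent 𝔾.G v => 𝔾.hom.parent u)
    (fun a : Parent B (𝔾.π v) => lam a.edge)]
  refine Finset.prod_congr rfl fun a _ => ?_
  rw [Finset.prod_const, Nat.card_eq_fintype_card, Fintype.card_subtype]
  congr 2
  ext p
  simp [Subtype.ext_iff]

/-- The factorials in α can be dropped: distinct parents have disjoint sets of copies, so choices of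
copies are not overcounted and `copyProb` carries no factorial. -/
theorem toReal_alpha_le (hlam : ∀ e, 0 < lam e) {v : 𝔾.V} (hv : 𝔾.π v ∉ 𝔹.I) :
    (𝔾.alpha lam N w₀ ρ v).toReal ≤
      1 / (2 ^ (1 + Nat.card (Parent B (𝔾.π v))) * 𝔾.fiberCard (𝔾.π v)) *
      ((∏ a : Parent B (𝔾.π v), Real.exp (-lam a.edge)) *
      ∏ u : Parent 𝔾.G v, lam (𝔾.hom.edge u.edge) *
        (N (𝔾.hom.edge u.edge)).real (Metric.closedEBall (w₀ u.edge) ρ) *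
          (𝔾.alpha lam N w₀ ρ u.1).toReal) := by
  rw [alpha_eq, dif_neg hv]
  simp only [ENNReal.toReal_mul, ENNReal.toReal_prod, ENNReal.toReal_div, ENNReal.toReal_one,
    ENNReal.toReal_natCast, mul_assoc, Finset.prod_mul_distrib]
  push_cast
  refine mul_le_mul_of_nonneg_left ?_ (by positivity)
  rw [← mul_assoc (∏ a : Parent B (𝔾.π v), Real.exp (-lam a.edge)), ← prod_lam_pow,
    ← Finset.prod_mul_distrib (f := fun a : Parent B (𝔾.π v) => Real.exp (-lam a.edge))]
  refine mul_le_mul_of_nonneg_right ?_ ?_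
  · refine Finset.prod_le_prod (fun _ _ => ENNReal.toReal_nonneg) fun a _ => ?_
    have := hlam a.edge
    rw [ENNReal.toReal_ofReal (by positivity)]
    exact div_le_self (by positivity) (by exact_mod_cast Nat.factorial_pos _)
  · exact mul_nonneg (Finset.prod_nonneg fun _ _ => ENNReal.toReal_nonneg)
      (Finset.prod_nonneg fun _ _ => ENNReal.toReal_nonneg)

/-- All the other factors of α are at most 1. Together with α n ≥ 8 this gives n ≥ 16 #π⁻¹, so
rounding n/#π⁻¹ down costs little. -/
theorem two_mul_fiberCard_mul_alpha_le_one (hlam : ∀ e, 0 < lam e) {v : 𝔾.V} (hv : 𝔾.π v ∉ 𝔹.I) :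
    2 * 𝔾.fiberCard (𝔾.π v) * (𝔾.alpha lam N w₀ ρ v).toReal ≤ 1 := by
  have hm : (0 : ℝ) < 𝔾.fiberCard (𝔾.π v) := by exact_mod_cast 𝔾.fiberCard_pos v
  have h1 : 𝔾.alpha lam N w₀ ρ v ≤ 1 / ((2 ^ (1 + Nat.card (Parent B (𝔾.π v))) *
      𝔾.fiberCard (𝔾.π v) : ℕ) : ℝ≥0∞) := by
    rw [alpha_eq, dif_neg hv, mul_assoc]
    refine mul_le_of_le_one_right' (mul_le_one' ?_ ?_)
    · refine Finset.prod_le_one' fun a _ => ?_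
      have := hlam a.edge
      rw [ENNReal.ofReal_le_one, mul_div_assoc]
      refine (mul_le_mul_of_nonneg_left (Real.pow_div_factorial_le_exp _ this.le _)
        (Real.exp_pos _).le).trans_eq ?_
      rw [← Real.exp_add]; simp
    · exact Finset.prod_le_one' fun p _ => mul_le_one' prob_le_one (𝔾.alpha_le_one hlam _)
  have h2 := ENNReal.toReal_mono (by
    simp only [one_div, ne_eq, ENNReal.inv_eq_top, Nat.cast_eq_zero]
    have := 𝔾.fiberCard_pos v
    positivity) h1
  simp only [ENNReal.toReal_div, ENNReal.toReal_one, ENNReal.toReal_natCast] at h2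
  push_cast at h2
  have h3 : (1 : ℝ) ≤ 2 ^ Nat.card (Parent B (𝔾.π v)) := one_le_pow₀ (by norm_num)
  refine (mul_le_mul_of_nonneg_left h2 (by positivity)).trans ?_
  rw [mul_one_div, div_le_one (by positivity), pow_add, pow_one]
  nlinarith

/-- The expected number of copies is almost twice the required one. -/
theorem alpha_mul_le_copyProb_mul (hlam : ∀ e, 0 < lam e) {v : 𝔾.V} (hv : 𝔾.π v ∉ 𝔹.I)
    (hv' : 8 ≤ (𝔾.alpha lam N w₀ ρ v).toReal * n (𝔾.π v)) :
    15 / 8 * ((𝔾.alpha lam N w₀ ρ v).toReal * n (𝔾.π v)) ≤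
      𝔾.copyProb w₀ ρ lam N (fun u => (𝔾.alpha lam N w₀ ρ u).toReal) v *
        ((n (𝔾.π v) / 𝔾.fiberCard (𝔾.π v) : ℕ) : ℝ) := by
  have hm : (0 : ℝ) < 𝔾.fiberCard (𝔾.π v) := by exact_mod_cast 𝔾.fiberCard_pos v
  have h1 := 𝔾.two_mul_fiberCard_mul_alpha_le_one (N := N) (w₀ := w₀) (ρ := ρ) hlam hv
  have h2 : 16 * (𝔾.fiberCard (𝔾.π v) : ℝ) ≤ n (𝔾.π v) := by
    have := mul_le_mul_of_nonneg_right h1 (Nat.cast_nonneg (n (𝔾.π v)))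
    nlinarith
  have h3 : (15 / 16 : ℝ) * (n (𝔾.π v) / 𝔾.fiberCard (𝔾.π v)) ≤
      ((n (𝔾.π v) / 𝔾.fiberCard (𝔾.π v) : ℕ) : ℝ) := by
    have h4 := (Nat.sub_one_lt_floor ((n (𝔾.π v) : ℝ) / 𝔾.fiberCard (𝔾.π v))).le
    rw [Nat.floor_div_eq_div] at h4
    have h5 : 16 ≤ (n (𝔾.π v) : ℝ) / 𝔾.fiberCard (𝔾.π v) := by
      rwa [le_div_iff₀ hm]
    linarith
  have h0 := 𝔾.toReal_alpha_le (N := N) (w₀ := w₀) (ρ := ρ) hlam hv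
  rw [copyProb, Finset.prod_mul_distrib, Finset.prod_const, Finset.card_univ,
    ← Nat.card_eq_fintype_card]
  set r := Nat.card (Parent B (𝔾.π v))
  rw [mul_assoc ((2 / 3 : ℝ) ^ r)]
  set P := (∏ a : Parent B (𝔾.π v), Real.exp (-lam a.edge)) *
      ∏ u : Parent 𝔾.G v, lam (𝔾.hom.edge u.edge) *
        (N (𝔾.hom.edge u.edge)).real (Metric.closedEBall (w₀ u.edge) ρ) *
          (𝔾.alpha lam N w₀ ρ u.1).toReal
  have hP : 0 ≤ P := mul_nonneg (Finset.prod_nonneg fun _ _ => (Real.exp_pos _).le)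
    (Finset.prod_nonneg fun u _ => mul_nonneg (mul_nonneg (hlam _).le measureReal_nonneg)
      ENNReal.toReal_nonneg)
  -- α carries (1/2)^(1+r) against (2/3)^r in `copyProb`. The spare 1/2 gains a factor 2, and
  -- rounding down keeps 15/16 of it, hence 15/8.
  calc 15 / 8 * ((𝔾.alpha lam N w₀ ρ v).toReal * n (𝔾.π v))
      ≤ 15 / 8 * (1 / (2 ^ (1 + r) * 𝔾.fiberCard (𝔾.π v)) * P * n (𝔾.π v)) := by gcongr
    _ = (1 / 2) ^ r * P * (15 / 16 * (n (𝔾.π v) / 𝔾.fiberCard (𝔾.π v))) := by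
        rw [pow_add, one_div_pow]
        field_simp
        ring
    _ ≤ (2 / 3) ^ r * P * ((n (𝔾.π v) / 𝔾.fiberCard (𝔾.π v) : ℕ) : ℝ) := by
        refine mul_le_mul (mul_le_mul_of_nonneg_right ?_ hP) h3 (by positivity) (by positivity)
        exact pow_le_pow_left₀ (by norm_num) (by norm_num) r

theorem copyCount_of_mem (ω : Config 𝔹 n) {v : 𝔾.V} (hv : 𝔾.π v ∈ 𝔹.I) :
    𝔾.copyCount hn J w₀ ρ ω v = 1 := by
  rw [copyCount, Finset.card_eq_one]
  refine ⟨Fin.cast (hn ⟨𝔾.π v, hv⟩).symm (𝔾.c ⟨v, hv⟩), ?_⟩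
  ext j
  simp [copyEvent, 𝔾.isCopy_iff_of_mem hv]

/-- This deterministic case is treated apart: if B has no edges then Λ is an empty sum, and the
width condition could not pay for a Chernoff bound. -/
theorem copyCount_of_isEmpty (ω : Config 𝔹 n) {v : 𝔾.V} (hv : 𝔾.π v ∉ 𝔹.I)
    (h : IsEmpty (Parent B (𝔾.π v))) :
    𝔾.copyCount hn J w₀ ρ ω v = (Finset.univ.filter (· ∈ J v)).card := by
  refine congrArg Finset.card (Finset.filter_congr fun j _ => ?_)
  have hu : IsEmpty (Parent 𝔾.G v) := ⟨fun u => h.false (𝔾.hom.parent u)⟩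
  show 𝔾.IsCopy hn J w₀ ρ ω.mask ω.weight v j ↔ _
  rw [𝔾.isCopy_iff_of_notMem hv]
  refine ⟨fun h => h.1, fun hj => ⟨hj, fun u => isEmptyElim u, fun u => isEmptyElim u,
    fun q hq => h.elim ⟨q.1, hq⟩, fun u => isEmptyElim u⟩⟩

variable (𝔾 hn J w₀ ρ lam N) in
/-- The event that some vertex has few copies although its parents have many. -/
def scarceEvent (v : 𝔾.V) : Set (Config 𝔹 n) :=
  {ω | (∀ u : Parent 𝔾.G v, (𝔾.alpha lam N w₀ ρ u.1).toReal * n (𝔾.π u.1) ≤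
      𝔾.copyCount hn J w₀ ρ ω u.1) ∧
    (𝔾.copyCount hn J w₀ ρ ω v : ℝ) < (𝔾.alpha lam N w₀ ρ v).toReal * n (𝔾.π v)}

/-- Scarcity is conditional on abundant parents, so excluding it at each vertex gives abundance
everywhere by induction along the graph. -/
theorem le_copyCount_of_notMem_scarceEvent {ω : Config 𝔹 n}
    (hω : ∀ v, ω ∉ 𝔾.scarceEvent hn J w₀ ρ lam N v) (v : 𝔾.V) :
    (𝔾.alpha lam N w₀ ρ v).toReal * n (𝔾.π v) ≤ 𝔾.copyCount hn J w₀ ρ ω v := by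
  induction v using (𝔾.hom.isAcyclic 𝔹.acyclic).wf.induction with
  | _ v ih => exact not_lt.1 fun h => hω v ⟨fun u => ih u.1 u.2, h⟩

/-- Scarcity is unlikely. -/
theorem measure_scarceEvent_le (hlam : ∀ e, 0 < lam e)
    (hlamn : ∀ e : Edge B, lam e ≤ n e.1.1 / 2 ∧ lam e ^ 2 ≤ n e.1.1 / 3)
    (hJ : 𝔾.IsLabelling J)
    (hJn : ∀ v, (Finset.univ.filter (· ∈ J v)).card = n (𝔾.π v) / 𝔾.fiberCard (𝔾.π v))
    {A : ℝ} (hA : Nonempty (Edge B) → 0 ≤ A) (v : 𝔾.V)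
    (hv' : 𝔾.π v ∉ 𝔹.I → 8 ≤ (𝔾.alpha lam N w₀ ρ v).toReal * n (𝔾.π v) ∧
      (Nonempty (Edge B) → 8 * A ≤ (𝔾.alpha lam N w₀ ρ v).toReal * n (𝔾.π v))) :
    Measure.pi (edgeLaw 𝔹 n lam N) (𝔾.scarceEvent hn J w₀ ρ lam N v) ≤
      ENNReal.ofReal (Real.exp (-A)) := by
  by_cases hv : 𝔾.π v ∈ 𝔹.I
  -- An input vertex has exactly one copy, and α n = 1 there.
  · suffices h : 𝔾.scarceEvent hn J w₀ ρ lam N v = ∅ by simp [h]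
    refine Set.eq_empty_of_forall_notMem fun ω hω => ?_
    have h1 := hω.2
    rw [copyCount_of_mem ω hv, toReal_alpha_of_mem hv, ← hn ⟨𝔾.π v, hv⟩] at h1
    have h2 : (((n (𝔾.π v) : ℝ))⁻¹ * n (𝔾.π v)) ≤ 1 := inv_mul_le_one
    push_cast at h1
    linarith
  obtain ⟨h8, hA8⟩ := hv' hv
  have key := alpha_mul_le_copyProb_mul hlam hv h8
  by_cases he : IsEmpty (Parent B (𝔾.π v))
  · suffices h : 𝔾.scarceEvent hn J w₀ ρ lam N v = ∅ by simp [h]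
    refine Set.eq_empty_of_forall_notMem fun ω hω => ?_
    have h1 := hω.2
    have hu : IsEmpty (Parent 𝔾.G v) := ⟨fun u => he.false (𝔾.hom.parent u)⟩
    rw [copyCount_of_isEmpty ω hv he, hJn] at h1
    rw [copyProb, Finset.univ_eq_empty, Finset.univ_eq_empty, Finset.prod_empty,
      Finset.prod_empty, one_mul, one_mul] at key
    linarith
  · rw [not_isEmpty_iff] at he
    obtain ⟨a⟩ := he
    have hne : Nonempty (Edge B) := ⟨a.edge⟩
    have h1 := measure_copyCount_le (hn := hn) (w₀ := w₀) (ρ := ρ) (lam := lam) (N := N) hlam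
      hlamn hJ hv (α := fun u => (𝔾.alpha lam N w₀ ρ u).toReal) (fun _ => ENNReal.toReal_nonneg)
      ((𝔾.alpha lam N w₀ ρ v).toReal * n (𝔾.π v))
    refine le_trans (measure_mono ?_) (h1.trans
      (ENNReal.ofReal_le_ofReal (Real.exp_le_exp.2 ?_)))
    · exact fun ω hω => ⟨hω.1, hω.2.le⟩
    rw [hJn]
    -- The exponent is at most ((15/8)(1/e - 1) + 1) α n, and the bracket is about -0.185, below
    -- -1/8. Hence it is at most -α n/8 ≤ -A.
    have h2 := Real.exp_neg_one_lt_d9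
    have h3 := hA8 hne
    have h4 := hA hne
    nlinarith

end LiftedModule

/-! ### Upper tail of the out-degrees. -/

section Degree

variable {VB : Type u} [Fintype VB] {B : Digraph VB} {𝔹 : PerceptronModule.{u, v} B}
  {n : VB → ℕ} {lam : Edge B → ℝ} {N : ∀ e : Edge B, Measure (𝔹.W e)}
  [∀ e, IsProbabilityMeasure (N e)]

/-- Large out-degrees are unlikely. -/
theorem measure_exists_lt_outSet_le (hlam : ∀ e, 0 < lam e) (e : Edge B) (he : 3 ≤ n e.1.1)
    (hn : (n e.1.1 : ℝ) * Real.log (n e.1.1) ≤ n e.1.2) {A : ℝ} (hA : 0 ≤ A) :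
    Measure.pi (edgeLaw 𝔹 n lam N)
      {ω : Config 𝔹 n | ∃ i, (7 * lam e + 1 + A) * (n e.1.2 / n e.1.1) <
        ((outSet (fun e' => ω.mask e' = true) e i).card : ℝ)} ≤
      ENNReal.ofReal (Real.exp (-A)) := by
  have hna : (0 : ℝ) < n e.1.1 := by exact_mod_cast (by omega : 0 < n e.1.1)
  have h1 : {ω : Config 𝔹 n | ∃ i, (7 * lam e + 1 + A) * (n e.1.2 / n e.1.1) <
      ((outSet (fun e' => ω.mask e' = true) e i).card : ℝ)} ⊆
      ⋃ i, {ω : Config 𝔹 n | (7 * lam e + 1 + A) * (n e.1.2 / n e.1.1) ≤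
        ((outSet (fun e' => ω.mask e' = true) e i).card : ℝ)} := by
    rintro ω ⟨i, hi⟩
    exact Set.mem_iUnion.2 ⟨i, hi.le⟩
  refine (measure_mono h1).trans ((measure_iUnion_fintype_le _ _).trans
    ((Finset.sum_le_sum fun i _ => measure_outSet_le hlam e i _).trans ?_))
  rw [Finset.sum_const, Finset.card_univ, Fintype.card_fin, nsmul_eq_mul,
    ← ENNReal.ofReal_natCast, ← ENNReal.ofReal_mul (by positivity)]
  refine ENNReal.ofReal_le_ofReal ?_
  set r : ℝ := n e.1.2 / n e.1.1 with hr
  -- This is the growth condition n_b ≥ n_a log n_a. The term r ≥ log n_a in the exponent pays for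
  -- the union over the n_a vertices, and r ≥ 1 keeps A.
  have hlog : Real.log (n e.1.1) ≤ r := by rw [hr, le_div_iff₀ hna]; linarith
  have hlog1 : 1 ≤ Real.log (n e.1.1) := by
    rw [Real.le_log_iff_exp_le hna]
    have h3 : (3 : ℝ) ≤ n e.1.1 := by exact_mod_cast he
    linarith [Real.exp_one_lt_three]
  have h4 : (Real.exp 1 - 1) * (lam e / n e.1.1) * n e.1.2 = (Real.exp 1 - 1) * lam e * r := by
    rw [hr]; ring
  rw [h4]
  have h5 : (Real.exp 1 - 1) * lam e * r - (7 * lam e + 1 + A) * r ≤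
      -Real.log (n e.1.1) + -A := by
    have h6 := Real.exp_one_lt_three
    have h7 : 0 ≤ lam e * r := mul_nonneg (hlam e).le (by linarith)
    nlinarith
  calc (n e.1.1 : ℝ) * Real.exp ((Real.exp 1 - 1) * lam e * r - (7 * lam e + 1 + A) * r)
      ≤ n e.1.1 * Real.exp (-Real.log (n e.1.1) + -A) := by gcongr
    _ = Real.exp (-A) := by
        rw [Real.exp_add, Real.exp_neg, Real.exp_log hna, ← mul_assoc, mul_inv_cancel₀ hna.ne',
          one_mul]

end Degree

/-! ### Union bound and convergence above a width threshold. -/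

namespace LiftedModule

variable {VB : Type u} [Fintype VB] {B : Digraph VB} {𝔹 : PerceptronModule.{u, v} B}
  {n₀ : 𝔹.I → ℕ} {𝔾 : LiftedModule.{u, v, w} 𝔹 n₀} {n : VB → ℕ}
  {lam : Edge B → ℝ} {N : ∀ e : Edge B, Measure (𝔹.W e)} [∀ e, IsProbabilityMeasure (N e)]

theorem log_add_log_card_sub_log_nonneg [Nonempty 𝔾.V] {δ : ℝ} (hδ : 0 < δ) (hδ' : δ ≤ 1) :
    0 ≤ Real.log 2 + Real.log ((Nat.card 𝔾.V : ℝ) + (Nat.card (Edge B) : ℝ)) - Real.log δ := by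
  have h1 : (1 : ℝ) ≤ Nat.card 𝔾.V := by exact_mod_cast (Nat.card_pos : 0 < Nat.card 𝔾.V)
  have h2 : (0 : ℝ) ≤ Nat.card (Edge B) := Nat.cast_nonneg _
  have h3 := Real.log_nonneg (x := Nat.card 𝔾.V + Nat.card (Edge B)) (by linarith)
  have h4 := Real.log_nonpos hδ.le hδ'
  have h5 := Real.log_nonneg (x := 2) (by norm_num)
  linarith

theorem le_lambdaStar [Nonempty 𝔾.V] {δ : ℝ} (hδ : 0 < δ) (hδ' : δ ≤ 1)
    (hlam : ∀ e, 0 < lam e) (e : Edge B) :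
    7 * lam e + 1 + (Real.log 2 + Real.log ((Nat.card 𝔾.V : ℝ) + (Nat.card (Edge B) : ℝ)) -
      Real.log δ) ≤ 𝔾.lambdaStar lam δ := by
  have h1 := 𝔾.log_add_log_card_sub_log_nonneg hδ hδ'
  rw [lambdaStar]
  refine le_trans (by linarith) (Finset.single_le_sum (fun e _ => ?_) (Finset.mem_univ e))
  linarith [hlam e]

theorem lambdaStar_nonneg [Nonempty 𝔾.V] {δ : ℝ} (hδ : 0 < δ) (hδ' : δ ≤ 1)
    (hlam : ∀ e, 0 < lam e) : 0 ≤ 𝔾.lambdaStar lam δ := by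
  have h1 := 𝔾.log_add_log_card_sub_log_nonneg hδ hδ'
  exact Finset.sum_nonneg fun e _ => by linarith [hlam e]

/-- If the widths are large, then with high probability there are many copies of every vertex and
no vertex has a large out-degree. -/
theorem exists_measure_le_forall_notMem {w₀ : ∀ e : Edge 𝔾.G, 𝔹.W (𝔾.hom.edge e)} {ρ : ℝ≥0∞}
    (hn : Admissible 𝔹 n₀ n) [Nonempty 𝔾.V] {δ : ℝ} (hδ : 0 < δ) (hδ' : δ ≤ 1)
    (hlam : ∀ e, 0 < lam e)
    (hlamn : ∀ e : Edge B, lam e ≤ n e.1.1 / 2 ∧ lam e ^ 2 ≤ n e.1.1 / 3)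
    (hn3 : ∀ e : Edge B, e.1.1 ∉ 𝔹.I → 3 ≤ n e.1.1)
    (hα : ∀ v, 𝔾.π v ∉ 𝔹.I →
      8 * (1 + 𝔾.lambdaStar lam δ) ≤ (𝔾.alpha lam N w₀ ρ v).toReal * n (𝔾.π v)) :
    ∃ (J : ∀ v : 𝔾.V, Set (Fin (n (𝔾.π v)))) (Λ : Edge B → ℝ) (S : Set (Config 𝔹 n)),
      𝔾.IsLabelling J ∧ (∀ e, 0 ≤ Λ e) ∧ ∑ e, Λ e = 𝔾.lambdaStar lam δ ∧
      Measure.pi (edgeLaw 𝔹 n lam N) S ≤ ENNReal.ofReal δ ∧ ∀ ω, ω ∉ S →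
        (∀ v, (𝔾.alpha lam N w₀ ρ v).toReal * n (𝔾.π v) ≤ 𝔾.copyCount hn.1 J w₀ ρ ω v) ∧
        ∀ e : Edge B, e.1.1 ∉ 𝔹.I → ∀ i,
          ((outSet (fun e' => ω.mask e' = true) e i).card : ℝ) ≤
            Λ e * (n e.1.2 / n e.1.1) := by
  set C : ℝ := (Nat.card 𝔾.V : ℝ) + (Nat.card (Edge B) : ℝ) with hC
  have hC0 : 0 < C := by
    have h1 : (0 : ℝ) < Nat.card 𝔾.V := by exact_mod_cast (Nat.card_pos : 0 < Nat.card 𝔾.V)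
    positivity
  -- A is chosen so that exp(-A) = δ/(2C): one scarcity event per reference vertex and one degree
  -- event per edge of B, at most C events, cost at most δ/2.
  set A : ℝ := Real.log 2 + Real.log C - Real.log δ with hA
  have hA0 : 0 ≤ A := 𝔾.log_add_log_card_sub_log_nonneg hδ hδ'
  have hexp : Real.exp (-A) = δ / (2 * C) := by
    rw [hA, neg_sub, Real.exp_sub, Real.exp_log hδ, Real.exp_add, Real.exp_log (by norm_num),
      Real.exp_log hC0]
  set Λ : Edge B → ℝ := fun e => 7 * lam e + 1 + A with hΛ
  have hΛ0 : ∀ e, 0 ≤ Λ e := fun e => by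
    have := hlam e
    positivity
  have hsum : ∑ e, Λ e = 𝔾.lambdaStar lam δ := by
    rw [lambdaStar]
    refine Finset.sum_congr rfl fun e _ => ?_
    simp only [hΛ, hA, hC]
    ring
  have hΛs := 𝔾.lambdaStar_nonneg hδ hδ' hlam
  have hAΛ : Nonempty (Edge B) → A ≤ 𝔾.lambdaStar lam δ := by
    rintro ⟨e⟩
    linarith [𝔾.le_lambdaStar hδ hδ' hlam e, hlam e]
  obtain ⟨J, hJ, hJn⟩ := 𝔾.exists_labelling n
  refine ⟨J, Λ, (⋃ v, 𝔾.scarceEvent hn.1 J w₀ ρ lam N v) ∪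
    ⋃ e : {e : Edge B // e.1.1 ∉ 𝔹.I}, {ω : Config 𝔹 n | ∃ i, Λ e.1 * (n e.1.1.2 / n e.1.1.1) <
      ((outSet (fun e' => ω.mask e' = true) e.1 i).card : ℝ)}, hJ, hΛ0, hsum, ?_, ?_⟩
  · refine (measure_union_le _ _).trans ((add_le_add ((measure_iUnion_fintype_le _ _).trans
      (Finset.sum_le_card_nsmul _ _ (ENNReal.ofReal (Real.exp (-A))) fun v _ => ?_))
      ((measure_iUnion_fintype_le _ _).trans
      (Finset.sum_le_card_nsmul _ _ (ENNReal.ofReal (Real.exp (-A))) fun e _ => ?_))).trans ?_)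
    · refine measure_scarceEvent_le hlam hlamn hJ hJn (fun _ => hA0) v fun hv => ?_
      have h1 := hα v hv
      refine ⟨by linarith, fun he => ?_⟩
      linarith [hAΛ he]
    · exact measure_exists_lt_outSet_le hlam e.1 (hn3 e.1 e.2) (hn.2 _ _ e.1.2) hA0
    · rw [← add_nsmul, nsmul_eq_mul, ← ENNReal.ofReal_natCast,
        ← ENNReal.ofReal_mul (Nat.cast_nonneg _), hexp]
      refine ENNReal.ofReal_le_ofReal ?_
      have h1 : ((Finset.univ : Finset 𝔾.V).card +
          (Finset.univ : Finset {e : Edge B // e.1.1 ∉ 𝔹.I}).card : ℕ) ≤ C := by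
        rw [hC, Finset.card_univ, Finset.card_univ, Nat.card_eq_fintype_card,
          Nat.card_eq_fintype_card]
        push_cast
        have h2 := Fintype.card_subtype_le fun e : Edge B => e.1.1 ∉ 𝔹.I
        have h3 : (Fintype.card {e : Edge B // e.1.1 ∉ 𝔹.I} : ℝ) ≤ Fintype.card (Edge B) := by
          exact_mod_cast h2
        linarith
      refine (mul_le_mul_of_nonneg_right h1 (by positivity)).trans ?_
      have h2 : C * (δ / (2 * C)) = δ / 2 := by field_simp
      rw [h2]
      linarith
  · intro ω hω
    rw [Set.mem_union, not_or, Set.mem_iUnion, Set.mem_iUnion, not_exists, not_exists] at hω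
    refine ⟨le_copyCount_of_notMem_scarceEvent hω.1, fun e he i => ?_⟩
    have h1 := hω.2 ⟨e, he⟩
    simp only [Set.mem_ofPred_eq, not_exists, not_lt] at h1
    exact h1 i

variable {k : ℕ} {X : Set (InputSpace 𝔹 n₀)} {D : Measure X} [IsProbabilityMeasure D]
  {f : X → EuclideanSpace ℝ (Fin k)} {ε δ : ℝ} {θ : 𝔾.Theta k}

/-- The threshold S serves three purposes: α S ≥ 8(1 + Λ) makes copies abundant, (K/S)(1 + Λ)^rank ≤
α₀/2 leaves half of them alive, and S dominates λ and λ² at non-initial layers. -/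
theorem randomLiftConverges_of_le (h𝔹 : 𝔹.IsC1) (hX : IsCompact X) (hf : MemLp f 2 D)
    (hlam : ∀ e, 0 < lam e)
    (hlamI : ∀ (e : Edge B) (h : e.1.1 ∈ 𝔹.I),
      lam e ≤ min ((n₀ ⟨e.1.1, h⟩ : ℝ) / 2) (√((n₀ ⟨e.1.1, h⟩ : ℝ) / 3)))
    (hn : Admissible 𝔹 n₀ n) [Nonempty 𝔾.V] (hδ : 0 < δ) (hδ' : δ ≤ 1)
    (hε : 𝔾.loss D f θ < ε) (hεL : ε < normSqD D f)
    {α₀ K c : ℝ} (hα₀ : 0 < α₀) (hα : ∀ v, α₀ ≤ (𝔾.alphaStar D f lam N ε θ v).toReal)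
    (hc : 0 < c)
    (hc2 : ∑ i : Fin k, ∑ p : 𝔾.Terminal, 2 * ‖θ.snd (i, p)‖ ^ 2 /
      ((𝔾.alphaStar D f lam N ε θ p.1).toReal * 𝔾.fiberCard (𝔾.π p.1)) ≤ c ^ 2)
    (hK0 : 0 ≤ K)
    (hK : ∀ q : ℕ, (q : ℝ≥0∞) * (𝔾.etaStar D f ε θ / 2) ^ 2 ≤
      ENNReal.ofReal ((2 * c * normSqD D f / (ε - 𝔾.loss D f θ)) ^ 2) → (q : ℝ) ≤ K)
    (hnK : ∀ b, b ∉ 𝔹.I →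
      8 * (1 + K) * (1 + 𝔾.lambdaStar lam δ) ^ (1 + Nat.card VB) / α₀ ≤ n b) :
    RandomLiftConverges D f lam N n hn ε δ (ENNReal.ofReal (3 / (c ^ 2 * normSqD D f ^ 2))) := by
  have hΛs := 𝔾.lambdaStar_nonneg hδ hδ' hlam
  set Λs := 𝔾.lambdaStar lam δ with hΛsdef
  have hαle : ∀ v, (𝔾.alphaStar D f lam N ε θ v).toReal ≤ 1 := fun v =>
    ENNReal.toReal_le_of_le_ofReal one_pos.le (by
      rw [ENNReal.ofReal_one]
      exact 𝔾.alpha_le_one hlam v)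
  obtain ⟨v₀⟩ := ‹Nonempty 𝔾.V›
  have : Nonempty 𝔾.V := ⟨v₀⟩
  have hα₀1 : α₀ ≤ 1 := (hα v₀).trans (hαle v₀)
  set S : ℝ := 8 * (1 + K) * (1 + Λs) ^ (1 + Nat.card VB) / α₀ with hS
  have hVB : 1 ≤ Nat.card VB := by
    have : Nonempty VB := ⟨𝔾.π v₀⟩
    exact Nat.card_pos
  have hS0 : 0 < S := by positivity
  have hSα : 8 * (1 + K) * (1 + Λs) ^ (1 + Nat.card VB) = α₀ * S := by
    rw [hS]; field_simp
  -- The exponent 1 + #V_B is at least 2. A square is wanted because λ² must be compared with the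
  -- widths.
  have hS2 : 8 * (1 + Λs) ^ 2 ≤ α₀ * S := by
    rw [← hSα]
    have h1 : (1 + Λs) ^ 2 ≤ (1 + Λs) ^ (1 + Nat.card VB) :=
      pow_le_pow_right₀ (by linarith) (by omega)
    have h2 : 0 ≤ (1 + Λs) ^ 2 := by positivity
    nlinarith
  have hS3 : 8 * (1 + Λs) ^ 2 ≤ S := hS2.trans (mul_le_of_le_one_left hS0.le hα₀1)
  have hlamn : ∀ e : Edge B, lam e ≤ n e.1.1 / 2 ∧ lam e ^ 2 ≤ n e.1.1 / 3 := by
    intro e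
    have hle := hlam e
    by_cases h : e.1.1 ∈ 𝔹.I
    · have h1 := hlamI e h
      rw [le_min_iff, ← hn.1 ⟨e.1.1, h⟩] at h1
      refine ⟨h1.1, ?_⟩
      have h2 := pow_le_pow_left₀ hle.le h1.2 2
      rwa [Real.sq_sqrt (by positivity)] at h2
    · have h1 := hS3.trans (hnK _ h)
      have h2 : 7 * lam e ≤ Λs := by
        linarith [𝔾.le_lambdaStar hδ hδ' hlam e, 𝔾.log_add_log_card_sub_log_nonneg hδ hδ']
      constructor <;> nlinarith
  obtain ⟨J, Λ, bad, hJ, hΛ0, hΛsum, hbad, hgood⟩ :=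
    exists_measure_le_forall_notMem (𝔾 := 𝔾) (N := N) (w₀ := θ.fst)
      (ρ := 𝔾.etaStar D f ε θ / 2) hn hδ hδ' hlam hlamn
      (fun e he => by
        have h1 := hS3.trans (hnK _ he)
        have h2 : (3 : ℝ) ≤ n e.1.1 := by nlinarith
        exact_mod_cast h2)
      (fun v hv => by
        have h1 : α₀ * S ≤ (𝔾.alpha lam N θ.fst (𝔾.etaStar D f ε θ / 2) v).toReal * n (𝔾.π v) :=
          mul_le_mul (hα v) (hnK _ hv) hS0.le ENNReal.toReal_nonneg
        nlinarith)
  refine holdsWithProbability_of_config hδ.le hbad fun ω hω => ?_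
  obtain ⟨hcount, hdeg⟩ := hgood ω hω
  refine convergenceCriterion_of_copies (J := J)
    (α := fun v => (𝔾.alphaStar D f lam N ε θ v).toReal) h𝔹 hX hf hε hεL hJ
    (fun v => hα₀.trans_le (hα v)) (fun v => ?_) hcount hc hc2 hK fun b hb v => ?_
  · by_cases hv : 𝔾.π v ∈ 𝔹.I
    · rw [hn.1 ⟨𝔾.π v, hv⟩]
      exact (Nat.zero_le _).trans_lt (𝔾.c ⟨v, hv⟩).2
    · exact_mod_cast hS0.trans_le (hnK _ hv)
  · refine (card_deadSet_le 𝔹.acyclic 𝔹.no_parent _ b hb hS0 hnK hΛ0 hdeg (𝔾.π v)).trans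
      (mul_le_mul_of_nonneg_left ?_ (Nat.cast_nonneg _))
    rw [hΛsum]
    have h1 : (1 + Λs) ^ rank B (𝔾.π v) ≤ (1 + Λs) ^ (1 + Nat.card VB) := by
      refine pow_le_pow_right₀ (by linarith) ?_
      have := rank_lt_card 𝔹.acyclic (𝔾.π v)
      rw [Nat.card_eq_fintype_card]
      omega
    have h2 : K / S * (1 + Λs) ^ rank B (𝔾.π v) ≤ α₀ / 2 := by
      rw [div_mul_eq_mul_div, div_le_div_iff₀ hS0 two_pos, ← hSα]
      have h3 := mul_le_mul_of_nonneg_left h1 hK0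
      have h4 : 0 ≤ (1 + Λs) ^ (1 + Nat.card VB) := by positivity
      nlinarith
    linarith [hα v]

end LiftedModule

/-! ### The explicit constants. -/

namespace LiftedModule

variable {VB : Type u} [Fintype VB] {B : Digraph VB} {𝔹 : PerceptronModule.{u, v} B}
  {n₀ : 𝔹.I → ℕ} {𝔾 : LiftedModule.{u, v, w} 𝔹 n₀} {n : VB → ℕ}
  {lam : Edge B → ℝ} {N : ∀ e : Edge B, Measure (𝔹.W e)} [∀ e, IsProbabilityMeasure (N e)]
  {k : ℕ} {X : Set (InputSpace 𝔹 n₀)} {D : Measure X} [IsProbabilityMeasure D]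
  {f : X → EuclideanSpace ℝ (Fin k)} {ε δ : ℝ} {θ : 𝔾.Theta k}

theorem alphaStar_pos (h𝔹 : 𝔹.IsC1) (hX : IsCompact X) (hlam : ∀ e, 0 < lam e)
    (hN : ∀ e, (N e).IsOpenPosMeasure) (hε : 𝔾.loss D f θ < ε) (v : 𝔾.V) :
    0 < 𝔾.alphaStar D f lam N ε θ v :=
  𝔾.alpha_pos hlam hN (ENNReal.half_pos (𝔾.etaStar_pos h𝔹 hX hε).ne') v

theorem alphaStar_ne_top (hlam : ∀ e, 0 < lam e) (v : 𝔾.V) :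
    𝔾.alphaStar D f lam N ε θ v ≠ ⊤ :=
  ((𝔾.alpha_le_one hlam v).trans_lt ENNReal.one_lt_top).ne

variable (𝔾 D f lam N ε θ) in
/-- The real number under the square root defining the intercept. -/
def interceptSq : ℝ :=
  ∑ i : Fin k, ∑ p : 𝔾.Terminal, 2 * ‖θ.snd (i, p)‖ ^ 2 /
    ((𝔾.alphaStar D f lam N ε θ p.1).toReal * 𝔾.fiberCard (𝔾.π p.1))

theorem interceptSq_nonneg : 0 ≤ 𝔾.interceptSq lam N D f ε θ :=
  Finset.sum_nonneg fun _ _ => Finset.sum_nonneg fun _ _ => by positivity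

theorem intercept_eq (h𝔹 : 𝔹.IsC1) (hX : IsCompact X) (hlam : ∀ e, 0 < lam e)
    (hN : ∀ e, (N e).IsOpenPosMeasure) (hε : 𝔾.loss D f θ < ε) :
    𝔾.intercept D f lam N ε θ = ENNReal.ofReal √(𝔾.interceptSq lam N D f ε θ) := by
  rw [intercept, Real.sqrt_eq_rpow, ← ENNReal.ofReal_rpow_of_nonneg interceptSq_nonneg
    (by norm_num), interceptSq]
  congr 1
  rw [ENNReal.ofReal_sum_of_nonneg fun _ _ => Finset.sum_nonneg fun _ _ => by positivity]
  refine Finset.sum_congr rfl fun i _ => ?_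
  rw [ENNReal.ofReal_sum_of_nonneg fun _ _ => by positivity]
  refine Finset.sum_congr rfl fun p _ => ?_
  have h1 : 0 < (𝔾.alphaStar D f lam N ε θ p.1).toReal :=
    ENNReal.toReal_pos (alphaStar_pos h𝔹 hX hlam hN hε p.1).ne' (alphaStar_ne_top hlam p.1)
  have h2 : (0 : ℝ) < 𝔾.fiberCard (𝔾.π p.1) := by exact_mod_cast 𝔾.fiberCard_pos p.1
  rw [ENNReal.ofReal_div_of_pos (by positivity), ENNReal.ofReal_mul (by norm_num),
    ENNReal.ofReal_mul h1.le, ENNReal.ofReal_toReal (alphaStar_ne_top hlam p.1),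
    ENNReal.ofReal_natCast, ENNReal.ofReal_ofNat]

theorem rate_pos (h𝔹 : 𝔹.IsC1) (hX : IsCompact X) (hlam : ∀ e, 0 < lam e)
    (hN : ∀ e, (N e).IsOpenPosMeasure) (hε : 𝔾.loss D f θ < ε) :
    0 < 𝔾.rate D f lam N ε θ := by
  rw [rate, intercept_eq h𝔹 hX hlam hN hε]
  refine ENNReal.div_pos (mul_ne_zero (by norm_num) ?_) (ENNReal.pow_ne_top ENNReal.ofReal_ne_top)
  exact ENNReal.inv_ne_zero.2 (ENNReal.pow_ne_top ENNReal.ofReal_ne_top)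

theorem iInf_alphaStar_ne_zero (h𝔹 : 𝔹.IsC1) (hX : IsCompact X) (hlam : ∀ e, 0 < lam e)
    (hN : ∀ e, (N e).IsOpenPosMeasure) (hε : 𝔾.loss D f θ < ε) :
    (⨅ v, 𝔾.alphaStar D f lam N ε θ v) ≠ 0 := by
  rcases isEmpty_or_nonempty 𝔾.V with h | h
  · rw [iInf_of_empty]
    exact ENNReal.top_ne_zero
  · obtain ⟨v, hv⟩ := exists_eq_ciInf_of_finite (f := fun v => 𝔾.alphaStar D f lam N ε θ v)
    rw [← hv]
    exact (alphaStar_pos h𝔹 hX hlam hN hε v).ne'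

theorem sizeThreshold_lt_top (h𝔹 : 𝔹.IsC1) (hX : IsCompact X) (hlam : ∀ e, 0 < lam e)
    (hN : ∀ e, (N e).IsOpenPosMeasure) (hε : 𝔾.loss D f θ < ε) :
    𝔾.sizeThreshold D f lam N ε δ θ < ⊤ := by
  rw [sizeThreshold, intercept_eq h𝔹 hX hlam hN hε]
  refine ENNReal.mul_lt_top (ENNReal.mul_lt_top (by norm_num) (ENNReal.pow_lt_top
    (ENNReal.add_lt_top.2 ⟨ENNReal.one_lt_top, ENNReal.mul_lt_top ?_ ?_⟩))) ?_
  · exact ENNReal.div_lt_top (ENNReal.mul_ne_top (by norm_num) ENNReal.ofReal_ne_top)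
      (𝔾.etaStar_pos h𝔹 hX hε).ne'
  · exact ENNReal.div_lt_top ENNReal.ofReal_ne_top (by simpa using hε)
  · exact ENNReal.div_lt_top (ENNReal.pow_ne_top ENNReal.ofReal_ne_top)
      (iInf_alphaStar_ne_zero h𝔹 hX hlam hN hε)

/-- The zero readout is already good enough and the loss decreases along the flow, so any κ works,
even ∞. This covers f⋆ = 0 and every witness with c = 0. -/
theorem randomLiftConverges_of_normSqD_le (h𝔹 : 𝔹.IsC1) (hX : IsCompact X) (hf : MemLp f 2 D)
    (hn : Admissible 𝔹 n₀ n) (hδ : 0 < δ) (hεL : normSqD D f ≤ ε) (κ : ℝ≥0∞) :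
    RandomLiftConverges D f lam N n hn ε δ κ := by
  refine ⟨Set.univ, MeasurableSet.univ, ?_, fun mw _ => ?_⟩
  · rw [measure_univ, ENNReal.ofReal_le_one]
    linarith
  · refine convergenceCriterion_of_le ((sparseLift n hn.1 mw.1).differentiable_loss h𝔹 hX hf) ?_ κ
    rwa [loss_of_snd_eq_zero _ D f rfl]

/-- The random sparse lift converges with high probability at the explicit rate as soon as its
widths exceed the explicit threshold. -/
theorem randomLiftConverges_rate (h𝔹 : 𝔹.IsC1) (hX : IsCompact X) (hf : MemLp f 2 D)
    (hlam : ∀ e, 0 < lam e)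
    (hlamI : ∀ (e : Edge B) (h : e.1.1 ∈ 𝔹.I),
      lam e ≤ min ((n₀ ⟨e.1.1, h⟩ : ℝ) / 2) (√((n₀ ⟨e.1.1, h⟩ : ℝ) / 3)))
    (hN : ∀ e, (N e).IsOpenPosMeasure) (hδ : 0 < δ) (hδ' : δ ≤ 1)
    (hε : 𝔾.loss D f θ < ε) (hn : Admissible 𝔹 n₀ n)
    (hnT : ∀ b, b ∉ 𝔹.I → 𝔾.sizeThreshold D f lam N ε δ θ ≤ (n b : ℝ≥0∞)) :
    RandomLiftConverges D f lam N n hn ε δ (𝔾.rate D f lam N ε θ) := by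
  rcases le_or_gt (normSqD D f) ε with hεL | hεL
  · exact randomLiftConverges_of_normSqD_le h𝔹 hX hf hn hδ hεL _
  have hL0 : 0 < normSqD D f := (𝔾.loss_nonneg D f θ).trans_lt (hε.trans hεL)
  -- A zero readout would have loss ‖f⋆‖² > ε. So the witness has a nonzero readout, hence a vertex,
  -- c > 0 and a finite rate.
  obtain ⟨⟨i, p⟩, hip⟩ : ∃ q, θ.snd q ≠ 0 := by
    by_contra! h
    have h1 : θ.snd = 0 := PiLp.ext h
    exact absurd (hε.trans hεL) (by rw [loss_of_snd_eq_zero _ D f h1]; exact lt_irrefl _)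
  have : Nonempty 𝔾.V := ⟨p.1⟩
  have hαpos : ∀ v, 0 < (𝔾.alphaStar D f lam N ε θ v).toReal := fun v =>
    ENNReal.toReal_pos (alphaStar_pos h𝔹 hX hlam hN hε v).ne' (alphaStar_ne_top hlam v)
  set c := √(𝔾.interceptSq lam N D f ε θ) with hc
  have hcpos : 0 < c := by
    refine Real.sqrt_pos.2 (Finset.sum_pos' (fun _ _ => Finset.sum_nonneg fun _ _ => by positivity)
      ⟨i, Finset.mem_univ _, Finset.sum_pos' (fun _ _ => by positivity)
      ⟨p, Finset.mem_univ _, ?_⟩⟩)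
    have h1 := hαpos p.1
    have h2 : (0 : ℝ) < 𝔾.fiberCard (𝔾.π p.1) := by exact_mod_cast 𝔾.fiberCard_pos p.1
    have h3 := norm_pos_iff.2 hip
    positivity
  have hint : 𝔾.intercept D f lam N ε θ = ENNReal.ofReal c := intercept_eq h𝔹 hX hlam hN hε
  have hinf0 := iInf_alphaStar_ne_zero (θ := θ) h𝔹 hX hlam hN hε
  have hinf : ∀ v, (⨅ v, 𝔾.alphaStar D f lam N ε θ v) ≤ 𝔾.alphaStar D f lam N ε θ v := iInf_le _
  have hinft : (⨅ v, 𝔾.alphaStar D f lam N ε θ v) ≠ ⊤ :=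
    ((hinf p.1).trans_lt (alphaStar_ne_top hlam p.1).lt_top).ne
  have hη := 𝔾.etaStar_pos (θ := θ) h𝔹 hX hε
  have hgap : 0 < ε - 𝔾.loss D f θ := sub_pos.2 hε
  have hrate : 𝔾.rate D f lam N ε θ = ENNReal.ofReal (3 / (c ^ 2 * normSqD D f ^ 2)) := by
    rw [rate, hint, ENNReal.ofReal_div_of_pos (by positivity), ENNReal.ofReal_mul (by positivity),
      ENNReal.ofReal_pow hcpos.le, ENNReal.ofReal_pow hL0.le, ENNReal.ofReal_ofNat, div_eq_mul_inv,
      div_eq_mul_inv, ENNReal.mul_inv (Or.inr (by simp)) (Or.inr (by simp [hL0])), mul_assoc]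
  -- K is (R/(η/2))² with R = 2c‖f⋆‖²/(ε - ε₀). If η = ∞, the real conventions give K = 0,
  -- consistent with no edge moving infinitely far.
  set K : ℝ := (4 * c / (𝔾.etaStar D f ε θ).toReal *
    (normSqD D f / (ε - 𝔾.loss D f θ))) ^ 2 with hK
  have hthr : (𝔾.sizeThreshold D f lam N ε δ θ).toReal =
      8 * (1 + 4 * c / (𝔾.etaStar D f ε θ).toReal *
        (normSqD D f / (ε - 𝔾.loss D f θ))) ^ 2 *
      ((1 + 𝔾.lambdaStar lam δ) ^ (1 + Nat.card VB) /
        (⨅ v, 𝔾.alphaStar D f lam N ε θ v).toReal) := by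
    have hΛ := 𝔾.lambdaStar_nonneg hδ hδ' hlam
    have h1 : 4 * ENNReal.ofReal c / 𝔾.etaStar D f ε θ *
        (ENNReal.ofReal (normSqD D f) / ENNReal.ofReal (ε - 𝔾.loss D f θ)) ≠ ⊤ :=
      ENNReal.mul_ne_top (ENNReal.div_ne_top (ENNReal.mul_ne_top (by norm_num)
        ENNReal.ofReal_ne_top) hη.ne') (ENNReal.div_ne_top ENNReal.ofReal_ne_top (by simpa using hε))
    rw [sizeThreshold, hint]
    simp only [ENNReal.toReal_mul, ENNReal.toReal_pow, ENNReal.toReal_div,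
      ENNReal.toReal_add ENNReal.one_ne_top h1, ENNReal.toReal_ofReal hcpos.le,
      ENNReal.toReal_ofReal hL0.le, ENNReal.toReal_ofReal hgap.le, ENNReal.toReal_one,
      ENNReal.toReal_ofNat, ENNReal.toReal_ofReal (by linarith : 0 ≤ 1 + 𝔾.lambdaStar lam δ)]
  rw [hrate]
  refine randomLiftConverges_of_le (K := K) (α₀ := (⨅ v, 𝔾.alphaStar D f lam N ε θ v).toReal)
    h𝔹 hX hf hlam hlamI hn hδ hδ' hε hεL (ENNReal.toReal_pos hinf0 hinft)
    (fun v => ENNReal.toReal_mono (alphaStar_ne_top hlam v) (hinf v)) hcpos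
    (Real.sq_sqrt interceptSq_nonneg).ge (sq_nonneg _) (fun q hq => ?_) (fun b hb => ?_)
  · have hη2 : (𝔾.etaStar D f ε θ / 2) ^ 2 ≠ 0 := pow_ne_zero _ (ENNReal.half_pos hη.ne').ne'
    rw [← ENNReal.le_div_iff_mul_le (Or.inl hη2) (Or.inr ENNReal.ofReal_ne_top)] at hq
    have h1 := ENNReal.toReal_mono (ENNReal.div_ne_top ENNReal.ofReal_ne_top hη2) hq
    rw [ENNReal.toReal_natCast, ENNReal.toReal_div, ENNReal.toReal_pow, ENNReal.toReal_div,
      ENNReal.toReal_ofReal (by positivity), ENNReal.toReal_ofNat] at h1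
    refine h1.trans_eq ?_
    rw [hK]
    ring
  · have h1 := ENNReal.toReal_mono (ENNReal.natCast_ne_top _) (hnT b hb)
    rw [hthr, ENNReal.toReal_natCast] at h1
    refine le_trans ?_ h1
    rw [mul_div_assoc]
    have hΛ := 𝔾.lambdaStar_nonneg hδ hδ' hlam
    refine mul_le_mul_of_nonneg_right (mul_le_mul_of_nonneg_left ?_ (by norm_num))
      (by positivity)
    have h2 : 0 ≤ 4 * c / (𝔾.etaStar D f ε θ).toReal *
      (normSqD D f / (ε - 𝔾.loss D f θ)) := by positivity
    -- 1 + s² ≤ (1 + s)² for s ≥ 0, with K = s².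
    rw [hK]
    nlinarith

end LiftedModule

end

end SparseLift

theorem mainTheorem1 {VB : Type u} [Fintype VB] {B : Digraph VB}
    (𝔹 : PerceptronModule.{u, v} B) (h𝔹 : 𝔹.IsC1)
    (n₀ : 𝔹.I → ℕ) (k : ℕ)
    (X : Set (InputSpace 𝔹 n₀)) (hX : IsCompact X)
    (D : Measure X) [IsProbabilityMeasure D]
    (f : X → EuclideanSpace ℝ (Fin k)) (hf : MemLp f 2 D)
    (lam : Edge B → ℝ) (hlam : ∀ e, 0 < lam e)
    (hlamI : ∀ (e : Edge B) (h : e.1.1 ∈ 𝔹.I),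
      lam e ≤ min ((n₀ ⟨e.1.1, h⟩ : ℝ) / 2) (√((n₀ ⟨e.1.1, h⟩ : ℝ) / 3)))
    (N : ∀ e : Edge B, Measure (𝔹.W e)) [∀ e, IsProbabilityMeasure (N e)]
    (hN : ∀ e, (N e).IsOpenPosMeasure)
    (ε δ : ℝ) (hε : 0 < ε) (hδ : 0 < δ) (hδ' : δ ≤ 1) :
    ((∃ (𝔾 : LiftedModule.{u, v, w} 𝔹 n₀) (θ : 𝔾.Theta k), 𝔾.loss D f θ < ε) →
      ∃ κ : ℝ, 0 < κ ∧ ∃ N₁ : VB → ℕ, (∀ b : 𝔹.I, N₁ b.1 = n₀ b) ∧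
        ∀ (n : VB → ℕ) (hn : Admissible 𝔹 n₀ n), (∀ b, N₁ b ≤ n b) →
          RandomLiftConverges D f lam N n hn ε δ (ENNReal.ofReal κ)) ∧
    (∀ (𝔾 : LiftedModule.{u, v, w} 𝔹 n₀) (θ : 𝔾.Theta k), 𝔾.loss D f θ < ε →
      0 < 𝔾.etaStar D f ε θ ∧ (∀ b, 0 < 𝔾.alphaStar D f lam N ε θ b) ∧
      0 < 𝔾.rate D f lam N ε θ ∧ 𝔾.sizeThreshold D f lam N ε δ θ < ⊤ ∧
      ∀ (n : VB → ℕ) (hn : Admissible 𝔹 n₀ n),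
        (∀ b, b ∉ 𝔹.I → 𝔾.sizeThreshold D f lam N ε δ θ ≤ (n b : ENNReal)) →
          RandomLiftConverges D f lam N n hn ε δ (𝔾.rate D f lam N ε θ)) := by
  have part2 : ∀ (𝔾 : LiftedModule.{u, v, w} 𝔹 n₀) (θ : 𝔾.Theta k), 𝔾.loss D f θ < ε →
      0 < 𝔾.etaStar D f ε θ ∧ (∀ b, 0 < 𝔾.alphaStar D f lam N ε θ b) ∧
      0 < 𝔾.rate D f lam N ε θ ∧ 𝔾.sizeThreshold D f lam N ε δ θ < ⊤ ∧
      ∀ (n : VB → ℕ) (hn : Admissible 𝔹 n₀ n),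
        (∀ b, b ∉ 𝔹.I → 𝔾.sizeThreshold D f lam N ε δ θ ≤ (n b : ENNReal)) →
          RandomLiftConverges D f lam N n hn ε δ (𝔾.rate D f lam N ε θ) := fun 𝔾 θ h =>
    ⟨𝔾.etaStar_pos h𝔹 hX h, 𝔾.alphaStar_pos h𝔹 hX hlam hN h, 𝔾.rate_pos h𝔹 hX hlam hN h,
      𝔾.sizeThreshold_lt_top h𝔹 hX hlam hN h,
      fun n hn hnT => 𝔾.randomLiftConverges_rate h𝔹 hX hf hlam hlamI hN hδ hδ' h hn hnT⟩
  refine ⟨?_, part2⟩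
  rintro ⟨𝔾, θ, h⟩
  obtain ⟨-, -, hrate, hT, hconv⟩ := part2 𝔾 θ h
  -- The explicit rate may be ∞ while part (1) asks for a real κ, hence the minimum with 1.
  have hmin : min (𝔾.rate D f lam N ε θ) 1 ≠ ⊤ := ((min_le_right _ _).trans_lt
    ENNReal.one_lt_top).ne
  classical
  refine ⟨(min (𝔾.rate D f lam N ε θ) 1).toReal, ENNReal.toReal_pos
    (lt_min hrate one_pos).ne' hmin, fun b => if hb : b ∈ 𝔹.I then n₀ ⟨b, hb⟩
      else ⌈(𝔾.sizeThreshold D f lam N ε δ θ).toReal⌉₊, fun b => by simp, fun n hn hN₁ => ?_⟩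
  obtain ⟨A, hA, hA', hAc⟩ := hconv n hn fun b hb => by
    have h1 := hN₁ b
    beta_reduce at h1
    rw [dif_neg hb, Nat.ceil_le] at h1
    rw [← ENNReal.ofReal_natCast]
    exact (ENNReal.le_ofReal_iff_toReal_le hT.ne (Nat.cast_nonneg _)).2 h1
  refine ⟨A, hA, hA', fun ω hω => (hAc ω hω).mono ?_⟩
  rw [ENNReal.ofReal_toReal hmin]
  exact min_le_left _ _
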